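/- Let $f\in C^1(\mathbb{R})$ be of bistable type: $f(0)=f(1)=0$, $f'(0)<0$, $f'(1)<0$, and there is $\alpha\in(0,1)$ such that $f<0$ on $(0,\alpha)$ and $f>0$ on $(\alpha,1)$. Let $a<b$ and $c\in\mathbb{R}$. (1) The boundary value problem $$U''(\xi)+cU'(\xi)+f(U(\xi))=0\quad (a<\xi<b),\qquad U(a)=0,\quad U(b)=1,\qquad 0\le U\le 1,$$ has one and only one solution $\Phi_c$ in the class of functions that are continuous on $[a,b]$ and twice differentiable in $(a,b)$. Moreover $\Phi_c\in C^2[a,b]$ and $\Phi_c$ is strictly increasing, with $\Phi_c'(x)>0$ for all $x\in[a,b]$ (one-sided derivatives at the end points). (2) Let $L_0q=q''+cq'+f'(\Phi_c)q$, as an unbounded operator in $C([a,b];\mathbb{C})$ with the sup norm and with domain $D(L_0)=\{q\in C^2([a,b];\mathbb{C}): q(a)=q(b)=0\}$. Then $\sigma(L_0)\subset\{z\in\mathbb{C}:\operatorname{Re} z<0\}$. (3) $\Phi_c$ is an exponentially asymptotically stable equilibrium of the problem $$u_t=u_{xx}+cu_x+f(u)\ \ (a<x<b,\ t>0),\qquad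 u(a,t)=0,\ \ u(b,t)=1\ \ (t>0),\qquad u(x,0)=u_0(x)\ \ (a\le x\le b).$$ That is, there are $K,\omega,\delta>0$, depending only on $f,c,a,b$, such that for every $u_0\in C[a,b]$ with $u_0(a)=0$, $u_0(b)=1$ and $\|u_0-\Phi_c\|_\infty\le\delta$ the problem has one and only one classical solution $u$ on $[0,\infty)$ (continuous on $[a,b]\times[0,\infty)$, with $u_t,u_x,u_{xx}$ existing and continuous on $(a,b)\times(0,\infty)$), and $$\|u(\cdot,t)-\Phi_c\|_\infty\le K\,\|u_0-\Phi_c\|_\infty\,e^{-\omega t}\qquad\text{for all } t\ge 0,$$ where $\|\cdot\|_\infty$ is the sup norm on $[a,b]$. -/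

import Mathlib

open Set

namespace TravellingWave

noncomputable section

/-- Nonlinearities of bistable type: `f ∈ C¹`, `f(0) = f(1) = 0`, `f'(0) < 0`, `f'(1) < 0`, and
there is `α ∈ (0,1)` with `f < 0` on `(0,α)` and `f > 0` on `(α,1)`. -/
structure IsBistable (f : ℝ → ℝ) : Prop where
  contDiff : ContDiff ℝ 1 f
  map_zero : f 0 = 0
  map_one : f 1 = 0
  deriv_zero_neg : deriv f 0 < 0
  deriv_one_neg : deriv f 1 < 0
  exists_threshold : ∃ α ∈ Ioo (0 : ℝ) 1,
    (∀ u ∈ Ioo 0 α, f u < 0) ∧ (∀ u ∈ Ioo α 1, 0 < f u)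

/-- `U` (of which only the values on `[a,b]` matter) is a classical solution of
`U'' + c U' + f(U) = 0` on `(a,b)`, `U(a) = 0`, `U(b) = 1`, `0 ≤ U ≤ 1`.
Only continuity on `[a,b]` and two derivatives in `(a,b)` are asked for. -/
structure IsEquilibrium (f : ℝ → ℝ) (c a b : ℝ) (U : ℝ → ℝ) : Prop where
  continuousOn : ContinuousOn U (Icc a b)
  differentiable : ∀ ξ ∈ Ioo a b, DifferentiableAt ℝ U ξ
  differentiable_deriv : ∀ ξ ∈ Ioo a b, DifferentiableAt ℝ (deriv U) ξ
  ode : ∀ ξ ∈ Ioo a b, deriv (deriv U) ξ + c * deriv U ξ + f (U ξ) = 0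
  left : U a = 0
  right : U b = 1
  mem_Icc : ∀ ξ ∈ Icc a b, 0 ≤ U ξ ∧ U ξ ≤ 1

/-- `u = u(x,t)` (of which only the values on `[a,b] × [0,∞)` matter) is a global classical
solution of `u_t = u_xx + c u_x + f(u)` in `(a,b) × (0,∞)`, `u(a,t) = 0`, `u(b,t) = 1`,
`u(x,0) = u₀(x)`: it is continuous on `[a,b] × [0,∞)` and its derivatives `u_t`, `u_x`, `u_xx`
exist and are continuous on `(a,b) × (0,∞)`. -/
structure IsClassicalSolution (f : ℝ → ℝ) (c a b : ℝ) (u₀ : ℝ → ℝ) (u : ℝ → ℝ → ℝ) : Prop where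
  continuousOn : ContinuousOn (fun p : ℝ × ℝ => u p.1 p.2) (Icc a b ×ˢ Ici 0)
  equation : ∃ ut ux uxx : ℝ → ℝ → ℝ,
    ContinuousOn (fun p : ℝ × ℝ => ut p.1 p.2) (Ioo a b ×ˢ Ioi 0) ∧
    ContinuousOn (fun p : ℝ × ℝ => ux p.1 p.2) (Ioo a b ×ˢ Ioi 0) ∧
    ContinuousOn (fun p : ℝ × ℝ => uxx p.1 p.2) (Ioo a b ×ˢ Ioi 0) ∧
    ∀ x ∈ Ioo a b, ∀ t ∈ Ioi (0 : ℝ),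
      HasDerivAt (fun s => u x s) (ut x t) t ∧
      HasDerivAt (fun y => u y t) (ux x t) x ∧
      HasDerivAt (fun y => ux y t) (uxx x t) x ∧
      ut x t = uxx x t + c * ux x t + f (u x t)
  left : ∀ t > 0, u a t = 0
  right : ∀ t > 0, u b t = 1
  initial : ∀ x ∈ Icc a b, u x 0 = u₀ x

/-- The sup distance `‖g - h‖_∞` on `[a,b]` (it is used for `g`, `h` continuous on `[a,b]`). -/
def supDist (a b : ℝ) (g h : ℝ → ℝ) : ℝ :=
  ⨆ x : Icc a b, |g x - h x|

/-- Exponential asymptotic stability, in the sup norm on `[a,b]`, of the equilibrium `Φ` of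
`u_t = u_xx + c u_x + f(u)`, `u(a,t) = 0`, `u(b,t) = 1`: every continuous initial datum `u₀` with
`u₀(a) = 0`, `u₀(b) = 1` that is close enough to `Φ` has one and only one global classical
solution, and it converges to `Φ` exponentially, with constants independent of `u₀`. -/
def IsExponentiallyStable (f : ℝ → ℝ) (c a b : ℝ) (Φ : ℝ → ℝ) : Prop :=
  ∃ K > 0, ∃ ω > 0, ∃ δ > 0, ∀ u₀ : ℝ → ℝ,
    ContinuousOn u₀ (Icc a b) → u₀ a = 0 → u₀ b = 1 → supDist a b u₀ Φ ≤ δ →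
    ∃ u : ℝ → ℝ → ℝ, IsClassicalSolution f c a b u₀ u ∧
      (∀ v : ℝ → ℝ → ℝ, IsClassicalSolution f c a b u₀ v →
        ∀ x ∈ Icc a b, ∀ t ≥ 0, v x t = u x t) ∧
      ∀ t ≥ 0, supDist a b (fun x => u x t) Φ ≤ K * supDist a b u₀ Φ * Real.exp (-ω * t)

/-- The domain `{q ∈ C²[a,b] : q(a) = q(b) = 0}` (complex-valued functions). -/
def dirichletDomain (a b : ℝ) : Set (ℝ → ℂ) :=
  {q | ContDiffOn ℝ 2 q (Icc a b) ∧ q a = 0 ∧ q b = 0}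

/-- The linearization `L₀ q = q'' + c q' + f'(Φ) q` at the points of `[a,b]`; the derivatives at
the end points are one-sided. -/
def linearization (f : ℝ → ℝ) (c a b : ℝ) (Φ : ℝ → ℝ) (q : ℝ → ℂ) (x : ℝ) : ℂ :=
  derivWithin (derivWithin q (Icc a b)) (Icc a b) x + (c : ℂ) * derivWithin q (Icc a b) x
    + ((deriv f (Φ x) : ℝ) : ℂ) * q x

/-- The resolvent set of `L₀`, as an unbounded operator in `C([a,b]; ℂ)` with the sup norm and
domain `dirichletDomain a b`: those `z` for which `z - L₀` maps the domain onto `C([a,b]; ℂ)` and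
has a bounded inverse (the bound contains the injectivity). -/
def resolventSetLin (f : ℝ → ℝ) (c a b : ℝ) (Φ : ℝ → ℝ) : Set ℂ :=
  {z | (∀ g : ℝ → ℂ, ContinuousOn g (Icc a b) → ∃ q ∈ dirichletDomain a b,
          ∀ x ∈ Icc a b, z * q x - linearization f c a b Φ q x = g x) ∧
       ∃ M : ℝ, ∀ q ∈ dirichletDomain a b, ∀ N : ℝ,
          (∀ x ∈ Icc a b, ‖z * q x - linearization f c a b Φ q x‖ ≤ N) →
          ∀ x ∈ Icc a b, ‖q x‖ ≤ M * N}

/-- The spectrum `σ(L₀)`. -/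
def spectrumLin (f : ℝ → ℝ) (c a b : ℝ) (Φ : ℝ → ℝ) : Set ℂ :=
  (resolventSetLin f c a b Φ)ᶜ

end

end TravellingWave

/-! The boundary value problem is a phase-plane argument. Replacing `f` by `0` outside `[0,1]` makes
it bounded and globally Lipschitz, and equilibria become restrictions of solutions on the whole
line. Shooting from `a` gives existence (`IsConnection.exists_connection`): slope `0` gives the zero
solution, a large slope reaches at least `1` at `b`, and the intermediate value theorem does the
rest. Uniqueness and monotonicity come from sliding one solution along another
(`IsConnection.lt_translate`). ODE uniqueness plays the role of the strong maximum principle and of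
the Hopf lemma: two solutions that touch with equal slopes coincide.

Spectrum and stability rest on one function. `Φ'` is positive on the closed interval and is
annihilated by the differential expression of `L₀`. Multiplied by `A - e^{lx}` it becomes a positive
`ψ` with `L₀ψ ≤ -2ωψ` up to the boundary (`IsConnection.exists_barrier`). The maximum principle
applied to `|q|/ψ` bounds the resolvent on `Re z ≥ 0` (`IsBarrier.norm_le`), and injectivity gives
surjectivity because the Dirichlet problem is a linear ODE. For the parabolic problem `±εψe^{-ωt}`
are barriers for the nonlinear perturbation equation when `ε` is small: half of the rate `2ω` pays
for the nonlinear remainder (`IsBarrier.abs_le_of_initial_le`).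

Classical solutions are constructed by hand. The perturbation of `Φ` is multiplied by `e^{cx/2}` to
remove the drift, its reaction term is cut off, and the data are reflected oddly about both end
points, so that the Dirichlet condition follows from symmetry. On the line, Duhamel's formula with a
damped heat kernel is a contraction for all times at once
(`IsDirichletReaction.exists_mild_solution`). Two derivatives are recovered as follows: mild
solutions are Lipschitz in space with constant of order `1 + t^{-1/2}`, hence so is the source, and
the zero mean of the second derivative of the heat kernel turns its `τ^{-1}` singularity into the
integrable `τ^{-1/2}`. The decay estimate finally shows that the cutoff is never active. -/

namespace TravellingWave

open scoped NNReal Topology BoundedContinuousFunction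

/-! ### Global initial value problems by Picard iteration in a weighted norm -/

section GlobalODE

variable {E : Type*} [NormedAddCommGroup E] [NormedSpace ℝ E]

theorem integral_exp_const_mul {l : ℝ} (hl : l ≠ 0) (t : ℝ) :
    ∫ s in (0 : ℝ)..t, Real.exp (l * s) = (Real.exp (l * t) - 1) / l := by
  have h : ∀ s ∈ uIcc 0 t, HasDerivAt (fun s => Real.exp (l * s) / l) (Real.exp (l * s)) s := by
    intro s _
    have := (((hasDerivAt_id s).const_mul l).exp).div_const l
    simpa [hl] using this
  rw [intervalIntegral.integral_eq_sub_of_hasDerivAt h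
    ((by fun_prop : Continuous fun s => Real.exp (l * s)).intervalIntegrable _ _)]
  simp [sub_div]

theorem norm_integral_le_exp_of_nonneg {f : ℝ → E} {l C t : ℝ} (hl : 0 < l) (hC : 0 ≤ C)
    (ht : 0 ≤ t) (h : ∀ s, ‖f s‖ ≤ C * Real.exp (l * |s|)) :
    ‖∫ s in (0 : ℝ)..t, f s‖ ≤ C / l * Real.exp (l * |t|) := by
  have h1 : ‖∫ s in (0 : ℝ)..t, f s‖ ≤ ∫ s in (0 : ℝ)..t, C * Real.exp (l * s) := by
    apply intervalIntegral.norm_integral_le_of_norm_le ht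
    · refine MeasureTheory.ae_of_all _ fun s hs => ?_
      simpa [abs_of_pos hs.1] using h s
    · exact (by fun_prop : Continuous fun s => C * Real.exp (l * s)).intervalIntegrable _ _
  rw [intervalIntegral.integral_const_mul, integral_exp_const_mul hl.ne'] at h1
  rw [abs_of_nonneg ht]
  refine h1.trans ?_
  have : C * ((Real.exp (l * t) - 1) / l) = C / l * Real.exp (l * t) - C / l := by ring
  rw [this]
  linarith [div_nonneg hC hl.le]

/-- Integration against the weight `e^{l|s|}` gains a factor `1/l`; with `l` large this makes the
Picard map a contraction on the whole line. -/
theorem norm_integral_le_exp {f : ℝ → E} {l C : ℝ} (hl : 0 < l) (hC : 0 ≤ C)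
    (h : ∀ s, ‖f s‖ ≤ C * Real.exp (l * |s|)) (t : ℝ) :
    ‖∫ s in (0 : ℝ)..t, f s‖ ≤ C / l * Real.exp (l * |t|) := by
  rcases le_total 0 t with ht | ht
  · exact norm_integral_le_exp_of_nonneg hl hC ht h
  · have h1 := norm_integral_le_exp_of_nonneg (f := fun s => f (-s)) (t := -t) hl hC
      (by linarith) (fun s => by simpa using h (-s))
    rw [intervalIntegral.integral_comp_neg, neg_neg, neg_zero, intervalIntegral.integral_symm,
      norm_neg, abs_neg] at h1
    exact h1

variable [CompleteSpace E]

theorem exists_integral_equation_solution (F : ℝ → E → E) (hc : Continuous (Function.uncurry F))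
    {K : ℝ≥0} (hK : ∀ t, LipschitzWith K (F t)) {M : ℝ} (hM : ∀ t, ‖F t 0‖ ≤ M) (y₀ : E) :
    ∃ y : ℝ → E, Continuous y ∧ ∀ t, y t = y₀ + ∫ s in (0 : ℝ)..t, F s (y s) := by
  -- The unknown is `y = e^{l|t|} ω` with `ω` bounded. This `l` gives `K / l ≤ 1/2`, the contraction
  -- constant.
  set l : ℝ := 2 * K + 1 with hl
  have hlpos : 0 < l := by positivity
  have hM0 : 0 ≤ M := (norm_nonneg _).trans (hM 0)
  have hcont : ∀ ω : ℝ →ᵇ E, Continuous fun s => F s (Real.exp (l * |s|) • ω s) := fun ω =>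
    hc.comp (continuous_id.prodMk (by fun_prop))
  have hFb : ∀ (ω : ℝ →ᵇ E) (s : ℝ),
      ‖F s (Real.exp (l * |s|) • ω s)‖ ≤ (M + K * ‖ω‖) * Real.exp (l * |s|) := by
    intro ω s
    have h1 : ‖F s (Real.exp (l * |s|) • ω s) - F s 0‖ ≤ K * (Real.exp (l * |s|) * ‖ω s‖) := by
      have := (hK s).norm_sub_le (Real.exp (l * |s|) • ω s) 0
      simpa [norm_smul] using this
    have h2 : ‖F s (Real.exp (l * |s|) • ω s)‖ ≤ M + K * (Real.exp (l * |s|) * ‖ω s‖) := by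
      calc _ = ‖F s 0 + (F s (Real.exp (l * |s|) • ω s) - F s 0)‖ := by congr 1; abel
        _ ≤ _ := (norm_add_le _ _).trans (add_le_add (hM s) h1)
    have h3 : 1 ≤ Real.exp (l * |s|) := Real.one_le_exp (by positivity)
    have h4 := ω.norm_coe_le_norm s
    calc _ ≤ _ := h2
      _ ≤ M * Real.exp (l * |s|) + K * (Real.exp (l * |s|) * ‖ω‖) := by
        gcongr
        nlinarith
      _ = _ := by ring
  let T : (ℝ →ᵇ E) → (ℝ →ᵇ E) := fun ω => BoundedContinuousFunction.ofNormedAddCommGroup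
    (fun t => Real.exp (-(l * |t|)) • (y₀ + ∫ s in (0 : ℝ)..t, F s (Real.exp (l * |s|) • ω s)))
    (by
      have := intervalIntegral.continuous_primitive
        (fun a b => (hcont ω).intervalIntegrable (μ := MeasureTheory.volume) a b) 0
      fun_prop)
    (‖y₀‖ + (M + K * ‖ω‖) / l)
    (by
      intro t
      have h1 := norm_integral_le_exp hlpos (by positivity) (hFb ω) t
      rw [norm_smul, Real.norm_of_nonneg (Real.exp_pos _).le]
      have h2 : Real.exp (-(l * |t|)) ≤ 1 := Real.exp_le_one_iff.2 (by simp; positivity)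
      have h3 : Real.exp (-(l * |t|)) * Real.exp (l * |t|) = 1 := by rw [← Real.exp_add]; simp
      calc _ ≤ Real.exp (-(l * |t|)) * (‖y₀‖ + (M + K * ‖ω‖) / l * Real.exp (l * |t|)) := by
            gcongr
            exact (norm_add_le _ _).trans (by gcongr)
        _ = Real.exp (-(l * |t|)) * ‖y₀‖ + (M + K * ‖ω‖) / l *
              (Real.exp (-(l * |t|)) * Real.exp (l * |t|)) := by ring
        _ ≤ _ := by
          rw [h3, mul_one]
          gcongr
          exact mul_le_of_le_one_left (norm_nonneg _) h2)
  have hT : ContractingWith (1 / 2) T := by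
    refine ⟨by norm_num [← NNReal.coe_lt_coe], LipschitzWith.of_dist_le_mul fun ω ω' => ?_⟩
    rw [dist_eq_norm, dist_eq_norm]
    refine (BoundedContinuousFunction.norm_le (by positivity)).2 fun t => ?_
    have hi := fun ω => (hcont ω).intervalIntegrable (μ := MeasureTheory.volume) 0 t
    have h0 : (T ω - T ω') t = Real.exp (-(l * |t|)) • ∫ s in (0 : ℝ)..t,
        (F s (Real.exp (l * |s|) • ω s) - F s (Real.exp (l * |s|) • ω' s)) := by
      rw [intervalIntegral.integral_sub (hi ω) (hi ω')]
      simp only [T, BoundedContinuousFunction.coe_sub, Pi.sub_apply,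
        BoundedContinuousFunction.coe_ofNormedAddCommGroup, ← smul_sub]
      congr 1
      abel
    have h1 := norm_integral_le_exp (f := fun s => F s (Real.exp (l * |s|) • ω s) -
      F s (Real.exp (l * |s|) • ω' s)) (C := K * ‖ω - ω'‖) hlpos (by positivity) (by
        intro s
        refine ((hK s).norm_sub_le _ _).trans ?_
        rw [← smul_sub, norm_smul, Real.norm_of_nonneg (Real.exp_pos _).le, mul_comm (Real.exp _),
          mul_assoc]
        gcongr
        exact (ω - ω').norm_coe_le_norm s) t
    have h3 : Real.exp (-(l * |t|)) * Real.exp (l * |t|) = 1 := by rw [← Real.exp_add]; simp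
    rw [h0, norm_smul, Real.norm_of_nonneg (Real.exp_pos _).le]
    calc _ ≤ Real.exp (-(l * |t|)) * (K * ‖ω - ω'‖ / l * Real.exp (l * |t|)) := by gcongr
      _ = K / l * ‖ω - ω'‖ * (Real.exp (-(l * |t|)) * Real.exp (l * |t|)) := by ring
      _ = K / l * ‖ω - ω'‖ := by rw [h3, mul_one]
      _ ≤ _ := by
        gcongr
        rw [div_le_iff₀ hlpos]
        push_cast
        rw [hl]
        linarith
  obtain ⟨ω, hω⟩ : ∃ ω, T ω = ω := ⟨_, hT.fixedPoint_isFixedPt⟩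
  refine ⟨fun t => Real.exp (l * |t|) • ω t, by fun_prop, fun t => ?_⟩
  have h3 : Real.exp (l * |t|) * Real.exp (-(l * |t|)) = 1 := by rw [← Real.exp_add]; simp
  have h4 : ω t = Real.exp (-(l * |t|)) •
      (y₀ + ∫ s in (0 : ℝ)..t, F s (Real.exp (l * |s|) • ω s)) := by
    conv_lhs => rw [← hω]
    rfl
  change Real.exp (l * |t|) • ω t = _
  rw [h4, smul_smul, h3, one_smul]

/-- Global solvability of the initial value problem for a globally Lipschitz vector field. -/
theorem exists_global_solution (F : ℝ → E → E) (hc : Continuous (Function.uncurry F))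
    {K : ℝ≥0} (hK : ∀ t, LipschitzWith K (F t)) {M : ℝ} (hM : ∀ t, ‖F t 0‖ ≤ M) (t₀ : ℝ) (y₀ : E) :
    ∃ y : ℝ → E, y t₀ = y₀ ∧ ∀ t, HasDerivAt y (F t (y t)) t := by
  obtain ⟨y, hyc, hy⟩ := exists_integral_equation_solution (fun t => F (t + t₀))
    (hc.comp (by fun_prop : Continuous fun p : ℝ × E => (p.1 + t₀, p.2))) (fun t => hK _)
    (fun t => hM _) y₀
  have hd : ∀ t, HasDerivAt y (F (t + t₀) (y t)) t := by
    intro t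
    have hcs : Continuous fun s => F (s + t₀) (y s) := hc.comp
      (by fun_prop : Continuous fun s => (s + t₀, y s))
    have h1 := intervalIntegral.integral_hasDerivAt_right (hcs.intervalIntegrable 0 t)
      (hcs.stronglyMeasurableAtFilter _ _) hcs.continuousAt
    exact (h1.const_add y₀).congr_of_eventuallyEq (Filter.Eventually.of_forall hy)
  refine ⟨fun t => y (t - t₀), by simp [hy 0], fun t => ?_⟩
  simpa using (hd (t - t₀)).comp_sub_const t t₀

end GlobalODE

end TravellingWave

/-! ### Solutions of the autonomous equation on the whole line -/

namespace TravellingWave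

open scoped NNReal Topology

/-- `V` (with derivative `P`) solves `V'' + c V' + F(V) = 0` on the whole line. -/
structure IsEntireSolution (c : ℝ) (F V P : ℝ → ℝ) : Prop where
  hasDerivAt_fst : ∀ x, HasDerivAt V (P x) x
  hasDerivAt_snd : ∀ x, HasDerivAt P (-c * P x - F (V x)) x

namespace IsEntireSolution

/-- The first order vector field of the equation `V'' + c V' + F(V) = 0`. -/
def field (c : ℝ) (F : ℝ → ℝ) (p : ℝ × ℝ) : ℝ × ℝ := (p.2, -c * p.2 - F p.1)

theorem exists_lipschitzWith_field (c : ℝ) {F : ℝ → ℝ} {K : ℝ≥0} (hF : LipschitzWith K F) :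
    ∃ L, LipschitzWith L (field c F) := by
  have h1 : LipschitzWith ‖-c‖₊ (fun x : ℝ => -c * x) :=
    LipschitzWith.of_dist_le_mul fun x y => by
      rw [Real.dist_eq, Real.dist_eq, ← mul_sub, abs_mul]; rfl
  exact ⟨_, LipschitzWith.prod_snd.prodMk
    ((h1.comp LipschitzWith.prod_snd).sub (hF.comp LipschitzWith.prod_fst))⟩

variable {c : ℝ} {F V P V₁ P₁ V₂ P₂ : ℝ → ℝ} {K : ℝ≥0}

theorem hasDerivAt_pair (h : IsEntireSolution c F V P) (x : ℝ) :
    HasDerivAt (fun x => (V x, P x)) (field c F (V x, P x)) x :=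
  (h.hasDerivAt_fst x).prodMk (h.hasDerivAt_snd x)

theorem unique (hF : LipschitzWith K F) (h₁ : IsEntireSolution c F V₁ P₁)
    (h₂ : IsEntireSolution c F V₂ P₂) {x₀ : ℝ} (hV : V₁ x₀ = V₂ x₀) (hP : P₁ x₀ = P₂ x₀) :
    V₁ = V₂ ∧ P₁ = P₂ := by
  obtain ⟨L, hL⟩ := exists_lipschitzWith_field c hF
  have := ODE_solution_unique_univ (v := fun _ => field c F) (s := fun _ => univ) (K := L)
    (t₀ := x₀) (f := fun x => (V₁ x, P₁ x)) (g := fun x => (V₂ x, P₂ x))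
    (fun _ => hL.lipschitzOnWith) (fun t => ⟨h₁.hasDerivAt_pair t, trivial⟩)
    (fun t => ⟨h₂.hasDerivAt_pair t, trivial⟩) (Prod.ext hV hP)
  exact ⟨funext fun x => congrArg Prod.fst (congrFun this x),
    funext fun x => congrArg Prod.snd (congrFun this x)⟩

theorem exists_of_initial (c : ℝ) (hF : LipschitzWith K F) (x₀ v p : ℝ) :
    ∃ V P, IsEntireSolution c F V P ∧ V x₀ = v ∧ P x₀ = p := by
  obtain ⟨L, hL⟩ := exists_lipschitzWith_field c hF
  obtain ⟨y, hy0, hy⟩ := exists_global_solution (fun _ => field c F)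
    (hL.continuous.comp continuous_snd) (fun _ => hL) (fun _ => le_rfl) x₀ (v, p)
  exact ⟨fun x => (y x).1, fun x => (y x).2, ⟨fun x => (hy x).fst, fun x => (hy x).snd⟩,
    by simp [hy0], by simp [hy0]⟩

theorem const {k : ℝ} (hk : F k = 0) : IsEntireSolution c F (fun _ => k) (fun _ => 0) :=
  ⟨fun x => hasDerivAt_const x k, fun x => by simpa [hk] using hasDerivAt_const x (0 : ℝ)⟩

/-- Such a point is a rest point of the phase-plane flow. This is the substitute for the strong
maximum principle and the Hopf lemma in what follows. -/
theorem eq_const (hF : LipschitzWith K F) (h : IsEntireSolution c F V P) {x₀ : ℝ}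
    (hP : P x₀ = 0) (h0 : F (V x₀) = 0) (x : ℝ) : V x = V x₀ :=
  congrFun (h.unique hF (const h0) (x₀ := x₀) rfl hP).1 x

theorem translate (h : IsEntireSolution c F V P) (r : ℝ) :
    IsEntireSolution c F (fun x => V (x + r)) (fun x => P (x + r)) :=
  ⟨fun x => (h.hasDerivAt_fst (x + r)).comp_add_const x r,
    fun x => (h.hasDerivAt_snd (x + r)).comp_add_const x r⟩

theorem continuous_fst (h : IsEntireSolution c F V P) : Continuous V :=
  continuous_iff_continuousAt.2 fun x => (h.hasDerivAt_fst x).continuousAt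

theorem continuous_snd (h : IsEntireSolution c F V P) : Continuous P :=
  continuous_iff_continuousAt.2 fun x => (h.hasDerivAt_snd x).continuousAt

/-- Solutions depend continuously on the initial velocity. -/
theorem abs_sub_le (hF : LipschitzWith K F) (a b : ℝ) (hab : a ≤ b) :
    ∃ C, 0 ≤ C ∧ ∀ V₁ P₁ V₂ P₂, IsEntireSolution c F V₁ P₁ → IsEntireSolution c F V₂ P₂ →
      V₁ a = V₂ a → |V₁ b - V₂ b| ≤ C * |P₁ a - P₂ a| := by
  obtain ⟨L, hL⟩ := exists_lipschitzWith_field c hF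
  refine ⟨Real.exp (L * (b - a)), (Real.exp_pos _).le, fun V₁ P₁ V₂ P₂ h₁ h₂ h0 => ?_⟩
  have := dist_le_of_trajectories_ODE (v := fun _ => field c F) (K := L) (a := a) (b := b)
    (f := fun x => (V₁ x, P₁ x)) (g := fun x => (V₂ x, P₂ x)) (δ := |P₁ a - P₂ a|)
    (fun _ => hL) (h₁.continuous_fst.prodMk h₁.continuous_snd).continuousOn
    (fun t _ => (h₁.hasDerivAt_pair t).hasDerivWithinAt)
    (h₂.continuous_fst.prodMk h₂.continuous_snd).continuousOn
    (fun t _ => (h₂.hasDerivAt_pair t).hasDerivWithinAt)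
    (by simp [Prod.dist_eq, h0, Real.dist_eq]) b (right_mem_Icc.2 hab)
  rw [mul_comm]
  refine le_trans ?_ this
  rw [← Real.dist_eq]
  exact le_max_left _ _

/-- With a bounded nonlinearity, a large initial velocity gives a large final value. -/
theorem exists_le_of_bounded {M : ℝ} (hM : ∀ u, |F u| ≤ M) (a b : ℝ) (hab : a < b) :
    ∃ s₀ > 0, ∀ V P, IsEntireSolution c F V P → V a = 0 → P a = s₀ → 1 ≤ V b := by
  have hM0 : 0 ≤ M := (abs_nonneg _).trans (hM 0)
  obtain ⟨L, hL⟩ := exists_lipschitzWith_field c (LipschitzWith.const (0 : ℝ) : LipschitzWith 0 _)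
  obtain ⟨E, Q, hE, hE0, hQ0⟩ := exists_of_initial c
    (LipschitzWith.const (0 : ℝ) : LipschitzWith 0 _) a 0 1
  -- `E` solves the equation without reaction term, so `E' > 0` explicitly and `E b > 0`.
  have hQ : ∀ x, Q x = Real.exp (-c * (x - a)) := by
    intro x
    have hd : ∀ y, HasDerivAt (fun y => Q y * Real.exp (c * (y - a))) 0 y := fun y => by
      have := (hE.hasDerivAt_snd y).mul ((((hasDerivAt_id y).sub_const a).const_mul c).exp)
      refine this.congr_deriv ?_
      simp
      ring
    have h1 := is_const_of_deriv_eq_zero (fun y => (hd y).differentiableAt)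
      (fun y => (hd y).deriv) x a
    simp only [hQ0, sub_self, mul_zero, Real.exp_zero, mul_one] at h1
    rw [neg_mul, Real.exp_neg, ← eq_inv_of_mul_eq_one_left h1]
  have hEb : 0 < E b := by
    have hmono : StrictMono E := strictMono_of_hasDerivAt_pos hE.hasDerivAt_fst
      (fun x => by rw [hQ]; exact Real.exp_pos _)
    simpa [hE0] using hmono hab
  -- The Grönwall bound on `V - s * E` does not involve `s`, because both trajectories start from
  -- the same data and the defect is at most `M`. Hence `s` may be chosen after `B`, with `s * E b =
  -- |B| + 1`.
  set B := gronwallBound 0 L (M + 0) (b - a)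
  refine ⟨(|B| + 1) / E b, by positivity, fun V P h h0 hs => ?_⟩
  set s := (|B| + 1) / E b
  have hsE : IsEntireSolution c (fun _ => 0) (fun x => s * E x) (fun x => s * Q x) :=
    ⟨fun x => (hE.hasDerivAt_fst x).const_mul s, fun x =>
      ((hE.hasDerivAt_snd x).const_mul s).congr_deriv (by ring)⟩
  have := dist_le_of_approx_trajectories_ODE (v := fun _ => field c fun _ => 0) (K := L) (a := a)
    (b := b) (f := fun x => (V x, P x)) (g := fun x => (s * E x, s * Q x)) (δ := 0)
    (εf := M) (εg := 0)
    (fun _ => hL) (h.continuous_fst.prodMk h.continuous_snd).continuousOn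
    (fun t _ => (h.hasDerivAt_pair t).hasDerivWithinAt)
    (fun t _ => by simpa [field, Prod.dist_eq, Real.dist_eq, hM0] using hM (V t))
    (hsE.continuous_fst.prodMk hsE.continuous_snd).continuousOn
    (fun t _ => (hsE.hasDerivAt_pair t).hasDerivWithinAt)
    (fun t _ => by simp)
    (by simp [h0, hs, hE0, hQ0]) b (right_mem_Icc.2 hab.le)
  have h1 : |V b - s * E b| ≤ B := by
    refine le_trans ?_ this
    rw [← Real.dist_eq]
    exact le_max_left _ _
  have h2 : s * E b = |B| + 1 := div_mul_cancel₀ _ hEb.ne'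
  have := (abs_le.1 h1).1
  have := le_abs_self B
  linarith

end IsEntireSolution

/-- An entire solution that connects `0` at `a` with `1` at `b` through values in `[0,1]`. -/
structure IsConnection (c a b : ℝ) (F V P : ℝ → ℝ) : Prop extends IsEntireSolution c F V P where
  left : V a = 0
  right : V b = 1
  mem_Icc : ∀ x ∈ Icc a b, V x ∈ Icc (0 : ℝ) 1

/-! ### Connections from `0` to `1`: sliding, monotonicity and shooting -/

namespace IsConnection

variable {c a b : ℝ} {F V P V₁ P₁ V₂ P₂ : ℝ → ℝ} {K : ℝ≥0}

/-- An interior zero would be a minimum, hence a rest point, and `V` would be constant; this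
contradicts the value `1` at `b`. -/
theorem pos (hF : LipschitzWith K F) (h0 : F 0 = 0) (h : IsConnection c a b F V P)
    {x : ℝ} (hx : x ∈ Ioc a b) : 0 < V x := by
  refine lt_of_le_of_ne (h.mem_Icc x (Ioc_subset_Icc_self hx)).1 fun hVx => ?_
  have hxb : x ≠ b := fun e => by rw [e, h.right] at hVx; exact zero_ne_one hVx
  have hx' : x ∈ Ioo a b := ⟨hx.1, lt_of_le_of_ne hx.2 hxb⟩
  have hmin : IsLocalMin V x := by
    filter_upwards [Icc_mem_nhds hx'.1 hx'.2] with y hy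
    rw [← hVx]
    exact (h.mem_Icc y hy).1
  have := h.eq_const hF (hmin.hasDerivAt_eq_zero (h.hasDerivAt_fst x)) (by rw [← hVx, h0]) b
  rw [h.right, ← hVx] at this
  exact one_ne_zero this

theorem lt_one (hF : LipschitzWith K F) (h1 : F 1 = 0) (h : IsConnection c a b F V P)
    {x : ℝ} (hx : x ∈ Ico a b) : V x < 1 := by
  refine lt_of_le_of_ne (h.mem_Icc x (Ico_subset_Icc_self hx)).2 fun hVx => ?_
  have hxa : a ≠ x := fun e => by rw [← e, h.left] at hVx; exact zero_ne_one hVx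
  have hx' : x ∈ Ioo a b := ⟨lt_of_le_of_ne hx.1 hxa, hx.2⟩
  have hmax : IsLocalMax V x := by
    filter_upwards [Icc_mem_nhds hx'.1 hx'.2] with y hy
    rw [hVx]
    exact (h.mem_Icc y hy).2
  have := h.eq_const hF (hmax.hasDerivAt_eq_zero (h.hasDerivAt_fst x)) (by rw [hVx, h1]) a
  rw [h.left, hVx] at this
  exact zero_ne_one this

/-- The sliding method. -/
theorem lt_translate (hF : LipschitzWith K F) (h0 : F 0 = 0) (h1 : F 1 = 0)
    (H₁ : IsConnection c a b F V₁ P₁) (H₂ : IsConnection c a b F V₂ P₂) {r x : ℝ} (hr : 0 < r)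
    (hx : a ≤ x) (hxr : x + r ≤ b) : V₁ x < V₂ (x + r) := by
  by_contra hcon
  -- The pairs (point, shift) at which the claim fails form a compact set, so there is a largest bad
  -- shift `s`. Beyond it the inequality is strict, and by continuity it holds weakly at `s`.
  set S : Set (ℝ × ℝ) := {q | a ≤ q.1 ∧ 0 ≤ q.2 ∧ q.1 + q.2 ≤ b ∧ V₂ (q.1 + q.2) ≤ V₁ q.1}
  have hSc : IsCompact S := by
    refine (isCompact_Icc (a := ((a, 0) : ℝ × ℝ)) (b := (b, b - a))).of_isClosed_subset ?_ ?_
    · have c1 := H₁.continuous_fst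
      have c2 := H₂.continuous_fst
      exact (isClosed_le continuous_const continuous_fst).inter
        ((isClosed_le continuous_const continuous_snd).inter
        ((isClosed_le (continuous_fst.add continuous_snd) continuous_const).inter
        (isClosed_le (c2.comp (continuous_fst.add continuous_snd)) (c1.comp continuous_fst))))
    · rintro ⟨y, s⟩ ⟨h1, h2, h3, -⟩
      simp only at h1 h2 h3
      exact ⟨⟨h1, h2⟩, ⟨by simp only; linarith, by simp only; linarith⟩⟩
  obtain ⟨⟨y, s⟩, ⟨hy, hs0, hys, hle⟩, hmax⟩ :=
    hSc.exists_isMaxOn ⟨(x, r), hx, hr.le, hxr, not_lt.1 hcon⟩ continuous_snd.continuousOn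
  simp only at hy hs0 hys hle
  have hs : 0 < s := hr.trans_le (hmax (show (x, r) ∈ S from ⟨hx, hr.le, hxr, not_lt.1 hcon⟩))
  have hgt : ∀ z s', a ≤ z → s < s' → z + s' ≤ b → V₁ z < V₂ (z + s') := by
    intro z s' hz hs' hzs
    by_contra hc
    have : s' ≤ s := hmax (show (z, s') ∈ S from ⟨hz, by simp only; linarith, hzs, not_lt.1 hc⟩)
    linarith
  have hge : ∀ z, a ≤ z → z + s < b → V₁ z ≤ V₂ (z + s) := by
    intro z hz hzs
    have ht : Filter.Tendsto (fun s' => V₂ (z + s')) (𝓝[>] s) (𝓝 (V₂ (z + s))) := by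
      have c2 := H₂.continuous_fst
      exact ((by fun_prop : Continuous fun s' => V₂ (z + s')).tendsto s).mono_left
        nhdsWithin_le_nhds
    refine ge_of_tendsto ht ?_
    filter_upwards [Ioo_mem_nhdsGT (show s < b - z by linarith)] with s' hs'
    exact (hgt z s' hz hs'.1 (by linarith [hs'.2])).le
  -- The point of contact is interior: at the left end `V₁ = 0 < V₂`, at the right end `V₁ < 1 =
  -- V₂`.
  have hya : a ≠ y := by
    rintro rfl
    have := H₂.pos hF h0 (x := a + s) ⟨by linarith, hys⟩
    rw [H₁.left] at hle
    linarith
  have hyb : y + s ≠ b := by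
    intro e
    have := H₁.lt_one hF h1 (x := y) ⟨hy, by linarith⟩
    rw [e, H₂.right] at hle
    linarith
  have hya' : a < y := lt_of_le_of_ne hy hya
  have hyb' : y + s < b := lt_of_le_of_ne hys hyb
  have heq : V₂ (y + s) = V₁ y := le_antisymm hle (hge y hy hyb')
  -- Values and slopes agree at `y`, so the translate of `V₂` is `V₁` by ODE uniqueness; at `a` this
  -- reads `V₂ (a + s) = 0`, against positivity.
  have hmin : IsLocalMin (fun z => V₂ (z + s) - V₁ z) y := by
    filter_upwards [Ioo_mem_nhds hya' (show y < b - s by linarith)] with z hz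
    have := hge z hz.1.le (by linarith [hz.2])
    simp only [heq, sub_self]
    linarith
  have hT := H₂.translate s
  have hP := hmin.hasDerivAt_eq_zero ((hT.hasDerivAt_fst y).sub (H₁.hasDerivAt_fst y))
  have := congrFun (hT.unique hF H₁.toIsEntireSolution heq (sub_eq_zero.1 hP)).1 a
  simp only [H₁.left] at this
  have h3 := H₂.pos hF h0 (x := a + s) ⟨by linarith, by linarith⟩
  linarith

/-- Let the shift tend to `0` in the sliding inequality, then exchange the roles of the two
solutions. -/
theorem eqOn (hF : LipschitzWith K F) (h0 : F 0 = 0) (h1 : F 1 = 0)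
    (H₁ : IsConnection c a b F V₁ P₁) (H₂ : IsConnection c a b F V₂ P₂) :
    EqOn V₁ V₂ (Icc a b) := by
  have key : ∀ {V₁ P₁ V₂ P₂}, IsConnection c a b F V₁ P₁ → IsConnection c a b F V₂ P₂ →
      ∀ x ∈ Ico a b, V₁ x ≤ V₂ x := by
    intro V₁ P₁ V₂ P₂ H₁ H₂ x hx
    have ht : Filter.Tendsto (fun s => V₂ (x + s)) (𝓝[>] 0) (𝓝 (V₂ (x + 0))) := by
      have c2 := H₂.continuous_fst
      exact ((by fun_prop : Continuous fun s => V₂ (x + s)).tendsto 0).mono_left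
        nhdsWithin_le_nhds
    rw [add_zero] at ht
    refine ge_of_tendsto ht ?_
    filter_upwards [Ioo_mem_nhdsGT (show (0 : ℝ) < b - x by linarith [hx.2])] with s hs
    exact (lt_translate hF h0 h1 H₁ H₂ hs.1 hx.1 (by linarith [hs.2])).le
  intro x hx
  rcases hx.2.eq_or_lt with rfl | hlt
  · rw [H₁.right, H₂.right]
  · exact le_antisymm (key H₁ H₂ x ⟨hx.1, hlt⟩) (key H₂ H₁ x ⟨hx.1, hlt⟩)

theorem strictMonoOn (hF : LipschitzWith K F) (h0 : F 0 = 0) (h1 : F 1 = 0)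
    (H : IsConnection c a b F V P) : StrictMonoOn V (Icc a b) := by
  intro x hx y hy hxy
  simpa using lt_translate hF h0 h1 H H (r := y - x) (x := x) (by linarith) hx.1
    (by linarith [hy.2])

/-- Monotonicity gives `P ≥ 0`. At an interior zero `P` is minimal, so `P' = 0` and the equation
yields `F(V) = 0`; at the end points `F(V) = 0` anyway. Either way the point is a rest point and `V`
would be constant. -/
theorem deriv_pos (hF : LipschitzWith K F) (h0 : F 0 = 0) (h1 : F 1 = 0) (hab : a < b)
    (H : IsConnection c a b F V P) {x : ℝ} (hx : x ∈ Icc a b) : 0 < P x := by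
  have hint : ∀ y ∈ Ioo a b, 0 ≤ P y := by
    intro y hy
    have := (H.strictMonoOn hF h0 h1).monotoneOn.derivWithin_nonneg (x := y)
    rwa [derivWithin_of_mem_nhds (Icc_mem_nhds hy.1 hy.2), (H.hasDerivAt_fst y).deriv] at this
  have hnn : ∀ y ∈ Icc a b, 0 ≤ P y := by
    rw [← closure_Ioo hab.ne]
    exact fun y hy => closure_minimal hint (isClosed_le continuous_const H.continuous_snd) hy
  refine lt_of_le_of_ne (hnn x hx) fun hPx => ?_
  have hFx : F (V x) = 0 := by
    rcases hx.1.eq_or_lt with rfl | hax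
    · rw [H.left, h0]
    rcases hx.2.eq_or_lt with rfl | hxb
    · rw [H.right, h1]
    have hmin : IsLocalMin P x := by
      filter_upwards [Icc_mem_nhds hax hxb] with y hy
      rw [← hPx]
      exact hnn y hy
    have := hmin.hasDerivAt_eq_zero (H.hasDerivAt_snd x)
    rw [← hPx] at this
    linarith
  have ha := H.eq_const hF hPx.symm hFx a
  have hb := H.eq_const hF hPx.symm hFx b
  rw [H.left] at ha
  rw [H.right, ← ha] at hb
  exact one_ne_zero hb

/-- The bounds `0 ≤ V ≤ 1` are automatic: at a minimum below `0` or a maximum above `1` the reaction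
vanishes, so that point is a rest point and `V` would be constant. -/
theorem of_boundary (hF : LipschitzWith K F) (hneg : ∀ u ≤ 0, F u = 0) (hone : ∀ u, 1 ≤ u → F u = 0)
    (hab : a < b) (h : IsEntireSolution c F V P) (ha : V a = 0) (hb : V b = 1) :
    IsConnection c a b F V P := by
  refine ⟨h, ha, hb, fun x hx => ⟨?_, ?_⟩⟩
  · obtain ⟨y, hy, hmin⟩ := isCompact_Icc.exists_isMinOn (nonempty_Icc.2 hab.le)
      h.continuous_fst.continuousOn
    refine le_trans ?_ (hmin hx)
    by_contra! hlt
    have hya : a ≠ y := by rintro rfl; linarith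
    have hyb : y ≠ b := by rintro rfl; linarith
    have hloc := hmin.isLocalMin (Icc_mem_nhds (lt_of_le_of_ne hy.1 hya) (lt_of_le_of_ne hy.2 hyb))
    have := h.eq_const hF (hloc.hasDerivAt_eq_zero (h.hasDerivAt_fst y)) (hneg _ hlt.le) a
    linarith
  · obtain ⟨y, hy, hmax⟩ := isCompact_Icc.exists_isMaxOn (nonempty_Icc.2 hab.le)
      h.continuous_fst.continuousOn
    refine le_trans (hmax hx) ?_
    by_contra! hlt
    have hya : a ≠ y := by rintro rfl; linarith
    have hyb : y ≠ b := by rintro rfl; linarith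
    have hloc := hmax.isLocalMax (Icc_mem_nhds (lt_of_le_of_ne hy.1 hya) (lt_of_le_of_ne hy.2 hyb))
    have := h.eq_const hF (hloc.hasDerivAt_eq_zero (h.hasDerivAt_fst y)) (hone _ hlt.le) b
    linarith

/-- Existence by shooting from `a`. -/
theorem exists_connection (c : ℝ) (hF : LipschitzWith K F) (hneg : ∀ u ≤ 0, F u = 0)
    (hone : ∀ u, 1 ≤ u → F u = 0) {M : ℝ} (hM : ∀ u, |F u| ≤ M) (hab : a < b) :
    ∃ V P, IsConnection c a b F V P := by
  have hex := fun s => IsEntireSolution.exists_of_initial c hF a 0 s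
  choose V P hVP hV0 hP0 using hex
  obtain ⟨C, hC, hCb⟩ := IsEntireSolution.abs_sub_le (c := c) hF a b hab.le
  obtain ⟨s₀, hs₀, hs₀b⟩ := IsEntireSolution.exists_le_of_bounded (c := c) hM a b hab
  have hcont : Continuous fun s => V s b := by
    refine (LipschitzWith.of_dist_le_mul (K := ⟨C, hC⟩) fun s t => ?_).continuous
    have := hCb _ _ _ _ (hVP s) (hVP t) ((hV0 s).trans (hV0 t).symm)
    rwa [hP0, hP0] at this
  -- Zero slope gives the constant solution `0`, the lower end of the shooting interval.
  have h00 : V 0 b = 0 := by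
    rw [(hVP 0).eq_const hF (hP0 0) (by rw [hV0, hneg 0 le_rfl]) b, hV0]
  obtain ⟨s, -, hs⟩ := intermediate_value_Icc hs₀.le hcont.continuousOn
    (show (1 : ℝ) ∈ Icc (V 0 b) (V s₀ b) from
      ⟨by rw [h00]; exact zero_le_one, hs₀b _ _ (hVP s₀) (hV0 s₀) (hP0 s₀)⟩)
  exact ⟨V s, P s, of_boundary hF hneg hone hab (hVP s) (hV0 s) hs⟩

end IsConnection

/-! ### Truncation of the nonlinearity and passage from equilibria to connections -/

/-- The nonlinearity `f`, extended from `[0,1]` by its values at the end points. -/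
noncomputable def truncation (f : ℝ → ℝ) (u : ℝ) : ℝ := f (projIcc 0 1 zero_le_one u)

theorem truncation_of_mem {f : ℝ → ℝ} {u : ℝ} (hu : u ∈ Icc (0 : ℝ) 1) : truncation f u = f u := by
  rw [truncation, projIcc_of_mem _ hu]

theorem exists_lipschitzWith_truncation {f : ℝ → ℝ} (hf : ContDiff ℝ 1 f) :
    ∃ K, LipschitzWith K (truncation f) := by
  obtain ⟨K, hK⟩ := hf.locallyLipschitz.locallyLipschitzOn.exists_lipschitzOnWith_of_compact
    (isCompact_Icc (a := (0 : ℝ)) (b := 1))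
  exact ⟨_, hK.to_restrict.comp (LipschitzWith.projIcc zero_le_one)⟩

theorem exists_bound_truncation {f : ℝ → ℝ} (hf : ContDiff ℝ 1 f) :
    ∃ M, ∀ u, |truncation f u| ≤ M := by
  obtain ⟨M, hM⟩ := (isCompact_Icc (a := (0 : ℝ)) (b := 1)).exists_bound_of_continuousOn
    hf.continuous.continuousOn
  exact ⟨M, fun u => hM _ (projIcc 0 1 zero_le_one u).2⟩

namespace IsBistable

variable {f : ℝ → ℝ} {c a b : ℝ}

theorem truncation_of_nonpos (hf : IsBistable f) (u : ℝ) (hu : u ≤ 0) : truncation f u = 0 := by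
  rw [truncation, projIcc_of_le_left _ hu]
  exact hf.map_zero

theorem truncation_of_one_le (hf : IsBistable f) (u : ℝ) (hu : 1 ≤ u) : truncation f u = 0 := by
  rw [truncation, projIcc_of_right_le _ hu]
  exact hf.map_one

theorem exists_connection (hf : IsBistable f) (c : ℝ) (hab : a < b) :
    ∃ V P, IsConnection c a b (truncation f) V P := by
  obtain ⟨K, hK⟩ := exists_lipschitzWith_truncation hf.contDiff
  obtain ⟨M, hM⟩ := exists_bound_truncation hf.contDiff
  exact IsConnection.exists_connection c hK hf.truncation_of_nonpos hf.truncation_of_one_le hM hab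

end IsBistable

theorem IsConnection.isEquilibrium {f V P : ℝ → ℝ} {c a b : ℝ}
    (h : IsConnection c a b (truncation f) V P) : IsEquilibrium f c a b V := by
  have hd : deriv V = P := funext fun x => (h.hasDerivAt_fst x).deriv
  refine ⟨h.continuous_fst.continuousOn, fun x _ => (h.hasDerivAt_fst x).differentiableAt,
    fun x _ => by rw [hd]; exact (h.hasDerivAt_snd x).differentiableAt, fun x hx => ?_,
    h.left, h.right, fun x hx => h.mem_Icc x hx⟩
  rw [hd, (h.hasDerivAt_snd x).deriv, truncation_of_mem (h.mem_Icc x (Ioo_subset_Icc_self hx))]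
  ring

/-- Every equilibrium is the restriction of an entire solution of the truncated equation. -/
theorem IsEquilibrium.exists_connection {f U : ℝ → ℝ} {c a b : ℝ} (hf : ContDiff ℝ 1 f)
    (hab : a < b) (h : IsEquilibrium f c a b U) :
    ∃ V P, IsConnection c a b (truncation f) V P ∧ EqOn U V (Icc a b) := by
  obtain ⟨K, hK⟩ := exists_lipschitzWith_truncation hf
  obtain ⟨L, hL⟩ := IsEntireSolution.exists_lipschitzWith_field c hK
  -- The Cauchy data are read off at an interior point because `U` is not assumed differentiable at
  -- the ends. Agreement on the open interval extends to `[a,b]` by continuity.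
  obtain ⟨m, hm⟩ := exists_between hab
  obtain ⟨V, P, hV, hV0, hP0⟩ := IsEntireSolution.exists_of_initial c hK m (U m) (deriv U m)
  have hd : ∀ x ∈ Ioo a b, HasDerivAt (fun x => (U x, deriv U x))
      (IsEntireSolution.field c (truncation f) (U x, deriv U x)) x := by
    intro x hx
    refine (h.differentiable x hx).hasDerivAt.prodMk
      ((h.differentiable_deriv x hx).hasDerivAt.congr_deriv ?_)
    have := h.ode x hx
    rw [truncation_of_mem (h.mem_Icc x (Ioo_subset_Icc_self hx))]
    linarith
  have heq := ODE_solution_unique_of_mem_Ioo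
    (v := fun _ => IsEntireSolution.field c (truncation f)) (s := fun _ => univ) (K := L)
    (t₀ := m) (f := fun x => (U x, deriv U x)) (g := fun x => (V x, P x))
    (fun _ _ => hL.lipschitzOnWith) hm (fun t ht => ⟨hd t ht, trivial⟩)
    (fun t _ => ⟨hV.hasDerivAt_pair t, trivial⟩) (by simp [hV0, hP0])
  have hEq : EqOn U V (Icc a b) := by
    have h1 : EqOn U V (Ioo a b) := fun x hx => congrArg Prod.fst (heq hx)
    exact h1.of_subset_closure h.continuousOn hV.continuous_fst.continuousOn Ioo_subset_Icc_self
      (closure_Ioo hab.ne).ge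
  refine ⟨V, P, ⟨hV, ?_, ?_, fun x hx => ?_⟩, hEq⟩
  · rw [← hEq (left_mem_Icc.2 hab.le), h.left]
  · rw [← hEq (right_mem_Icc.2 hab.le), h.right]
  · rw [← hEq hx]
    exact h.mem_Icc x hx

end TravellingWave

/-! ### The barrier built from the derivative of the equilibrium -/

namespace TravellingWave

open scoped NNReal Topology

/-- With a positive second derivative `x` would also be a local minimum, so `g` would be locally
constant, with zero second derivative. -/
theorem _root_.IsLocalMax.second_deriv_nonpos {g g₁ : ℝ → ℝ} {g₂ x : ℝ} (hmax : IsLocalMax g x)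
    (h₁ : ∀ᶠ y in 𝓝 x, HasDerivAt g (g₁ y) y) (h₂ : HasDerivAt g₁ g₂ x) : g₂ ≤ 0 := by
  by_contra! hpos
  have hd : deriv g =ᶠ[𝓝 x] g₁ := h₁.mono fun y hy => hy.deriv
  have hdd : deriv (deriv g) x = g₂ := by rw [hd.deriv_eq, h₂.deriv]
  have hmin : IsLocalMin g x := isLocalMin_of_deriv_deriv_pos (by rw [hdd]; exact hpos)
    hmax.deriv_eq_zero h₁.self_of_nhds.continuousAt
  have hc : g =ᶠ[𝓝 x] fun _ => g x := by
    filter_upwards [hmax, hmin] with y h1 h2 using le_antisymm h1 h2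
  have hz : deriv g =ᶠ[𝓝 x] fun _ => 0 := by
    filter_upwards [hc.eventuallyEq_nhds] with y hy
    rw [hy.deriv_eq, deriv_const]
  rw [hz.deriv_eq, deriv_const] at hdd
  exact hpos.ne hdd

theorem contDiff_two_of_hasDerivAt {E : Type*} [NormedAddCommGroup E] [NormedSpace ℝ E]
    {q p r : ℝ → E} (hq : ∀ x, HasDerivAt q (p x) x) (hp : ∀ x, HasDerivAt p (r x) x)
    (hr : Continuous r) : ContDiff ℝ 2 q := by
  have hdq : deriv q = p := funext fun x => (hq x).deriv
  have hdp : deriv p = r := funext fun x => (hp x).deriv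
  have h1 : ContDiff ℝ 1 p := contDiff_one_iff_deriv.2
    ⟨fun x => (hp x).differentiableAt, by rwa [hdp]⟩
  have : ContDiff ℝ (1 + 1) q := contDiff_succ_iff_deriv.2
    ⟨fun x => (hq x).differentiableAt, by simp, by rwa [hdq]⟩
  exact this

/-- A positive strict supersolution `ψ` (with derivatives `ψ₁`, `ψ₂`) of the linearization
at `V`, on all of `[a,b]`. -/
structure IsBarrier (f : ℝ → ℝ) (c a b : ℝ) (V ψ ψ₁ ψ₂ : ℝ → ℝ) (ω m M : ℝ) : Prop where
  rate_pos : 0 < ω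
  lower_pos : 0 < m
  lower : ∀ x ∈ Icc a b, m ≤ ψ x
  upper : ∀ x ∈ Icc a b, ψ x ≤ M
  hasDerivAt_fst : ∀ x ∈ Icc a b, HasDerivAt ψ (ψ₁ x) x
  hasDerivAt_snd : ∀ x ∈ Icc a b, HasDerivAt ψ₁ (ψ₂ x) x
  supersolution : ∀ x ∈ Icc a b, ψ₂ x + c * ψ₁ x + deriv f (V x) * ψ x ≤ -(2 * ω) * ψ x

namespace IsBarrier

variable {f V ψ ψ₁ ψ₂ : ℝ → ℝ} {c a b ω m M : ℝ}

theorem pos (h : IsBarrier f c a b V ψ ψ₁ ψ₂ ω m M) {x : ℝ} (hx : x ∈ Icc a b) : 0 < ψ x :=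
  h.lower_pos.trans_le (h.lower x hx)

theorem continuousOn (h : IsBarrier f c a b V ψ ψ₁ ψ₂ ω m M) : ContinuousOn ψ (Icc a b) :=
  fun x hx => (h.hasDerivAt_fst x hx).continuousAt.continuousWithinAt

end IsBarrier

/-- Differentiating the ODE shows `L P = 0` for the linearization `L`, so `L(P w) = P w'' + (2P' +
cP) w'`. With `w = A - e^{lx}` this is `-l e^{lx} (lP + cP + 2P')`, which is negative for large `l`
because `P` is bounded away from `0`. -/
theorem IsConnection.exists_barrier {f V P : ℝ → ℝ} {c a b : ℝ} (hf : IsBistable f) (hab : a < b)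
    (H : IsConnection c a b (truncation f) V P) :
    ∃ ψ ψ₁ ψ₂ ω m M, IsBarrier f c a b V ψ ψ₁ ψ₂ ω m M := by
  obtain ⟨K, hK⟩ := exists_lipschitzWith_truncation hf.contDiff
  have hpos : ∀ x ∈ Icc a b, 0 < P x := fun x hx => H.deriv_pos hK
    (hf.truncation_of_nonpos 0 le_rfl) (hf.truncation_of_one_le 1 le_rfl) hab hx
  obtain ⟨y, hy, hmin⟩ := isCompact_Icc.exists_isMinOn (nonempty_Icc.2 hab.le)
    H.continuous_snd.continuousOn
  obtain ⟨Pm, hPm⟩ := (isCompact_Icc (a := a) (b := b)).exists_bound_of_continuousOn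
    H.continuous_snd.continuousOn
  -- Written with `f` rather than its truncation, which need not be differentiable at `0` and `1`;
  -- on `[a,b]` the two agree.
  set P' : ℝ → ℝ := fun x => -c * P x - f (V x) with hP'
  have hP'c : Continuous P' := by
    have := H.continuous_snd
    have := H.continuous_fst
    have := hf.contDiff.continuous
    fun_prop
  obtain ⟨B, hB⟩ := (isCompact_Icc (a := a) (b := b)).exists_bound_of_continuousOn
    ((H.continuous_snd.const_mul c).add (hP'c.const_mul 2)).continuousOn
  have hp0 : 0 < P y := hpos y hy
  have hB0 : 0 ≤ B := (norm_nonneg _).trans (hB y hy)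
  -- `P y` is the minimum of `P` and `B` bounds `|cP + 2P'|`, so `lP + cP + 2P' ≥ 1`.
  set l : ℝ := (B + 1) / P y with hl
  have hl0 : 0 < l := by positivity
  have hlP : l * P y = B + 1 := div_mul_cancel₀ _ hp0.ne'
  set A : ℝ := Real.exp (l * b) + 1 with hA
  have hA0 : 0 < A := by positivity
  have hPm0 : 0 < Pm := hp0.trans_le ((le_abs_self _).trans (hPm y hy))
  have hP1 : ∀ x ∈ Icc a b, HasDerivAt P (P' x) x := by
    intro x hx
    have := H.hasDerivAt_snd x
    rwa [truncation_of_mem (H.mem_Icc x hx)] at this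
  have hP2 : ∀ x ∈ Icc a b, HasDerivAt P' (-c * P' x - deriv f (V x) * P x) x := by
    intro x hx
    exact ((hP1 x hx).const_mul (-c)).sub
      (((hf.contDiff.differentiable one_ne_zero _).hasDerivAt).comp x (H.hasDerivAt_fst x))
  have hw : ∀ x, HasDerivAt (fun x => A - Real.exp (l * x)) (-(l * Real.exp (l * x))) x := by
    intro x
    have := (((hasDerivAt_id x).const_mul l).exp).const_sub A
    exact this.congr_deriv (by simp [mul_comm])
  have hw1 : ∀ x, HasDerivAt (fun x => -(l * Real.exp (l * x))) (-(l * (l * Real.exp (l * x)))) x := by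
    intro x
    have := ((((hasDerivAt_id x).const_mul l).exp).const_mul l).neg
    exact this.congr_deriv (by simp [mul_comm])
  have hwle : ∀ x ∈ Icc a b, 1 ≤ A - Real.exp (l * x) ∧ A - Real.exp (l * x) ≤ A := by
    intro x hx
    have : Real.exp (l * x) ≤ Real.exp (l * b) :=
      Real.exp_le_exp.2 (mul_le_mul_of_nonneg_left hx.2 hl0.le)
    exact ⟨by rw [hA]; linarith, by linarith [Real.exp_pos (l * x)]⟩
  have hupper : ∀ x ∈ Icc a b, P x * (A - Real.exp (l * x)) ≤ Pm * A := by
    intro x hx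
    have h1 := (le_abs_self _).trans (hPm x hx)
    exact mul_le_mul h1 (hwle x hx).2 (by linarith [(hwle x hx).1]) hPm0.le
  -- Since `1 ≤ A - e^{lx} ≤ A`, the barrier lies between `P y` and `Pm * A`. The rate is chosen so
  -- that `2ωψ ≤ l e^{la}`, the guaranteed size of the negative right side.
  refine ⟨fun x => P x * (A - Real.exp (l * x)),
    fun x => P' x * (A - Real.exp (l * x)) + P x * -(l * Real.exp (l * x)), _,
    l * Real.exp (l * a) / (2 * (Pm * A)), P y, Pm * A, ⟨by positivity, hp0, fun x hx => ?_, hupper,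
    fun x hx => (hP1 x hx).mul (hw x), fun x hx =>
      ((hP2 x hx).mul (hw x)).add ((hP1 x hx).mul (hw1 x)), fun x hx => ?_⟩⟩
  · have h1 : P y ≤ P x := hmin hx
    have h2 := (hwle x hx).1
    nlinarith
  · have h1 : P y ≤ P x := hmin hx
    have h2 : -B ≤ c * P x + 2 * P' x := (abs_le.1 (hB x hx)).1
    have h3 : 1 ≤ l * P x + (c * P x + 2 * P' x) := by nlinarith
    have h4 : Real.exp (l * a) ≤ Real.exp (l * x) :=
      Real.exp_le_exp.2 (mul_le_mul_of_nonneg_left hx.1 hl0.le)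
    have h5 : 2 * (l * Real.exp (l * a) / (2 * (Pm * A))) * (P x * (A - Real.exp (l * x))) ≤
        l * Real.exp (l * a) := by
      calc _ ≤ 2 * (l * Real.exp (l * a) / (2 * (Pm * A))) * (Pm * A) :=
              mul_le_mul_of_nonneg_left (hupper x hx) (by positivity)
        _ = _ := by field_simp
    have h6 : l * Real.exp (l * x) ≤
        l * Real.exp (l * x) * (l * P x + (c * P x + 2 * P' x)) :=
      le_mul_of_one_le_right (by positivity) h3
    have h7 : l * Real.exp (l * a) ≤ l * Real.exp (l * x) := by gcongr
    linarith

/-! ### The spectrum of the linearization -/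

section Spectrum

variable {f V ψ ψ₁ ψ₂ : ℝ → ℝ} {c a b ω m M : ℝ}

theorem hasDerivAt_derivWithin_of_contDiffOn {q : ℝ → ℂ} (hq : ContDiffOn ℝ 2 q (Icc a b)) {x : ℝ}
    (hx : x ∈ Ioo a b) : HasDerivAt q (derivWithin q (Icc a b) x) x ∧
      HasDerivAt (derivWithin q (Icc a b)) (derivWithin (derivWithin q (Icc a b)) (Icc a b) x) x := by
  have hn := Icc_mem_nhds hx.1 hx.2
  have hu := uniqueDiffOn_Icc (hx.1.trans hx.2)
  have hx' := Ioo_subset_Icc_self hx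
  have h1 : ContDiffOn ℝ 1 (derivWithin q (Icc a b)) (Icc a b) :=
    hq.derivWithin hu (by norm_num [one_add_one_eq_two])
  exact ⟨((hq.differentiableOn (by norm_num) x hx').hasDerivWithinAt).hasDerivAt hn,
    ((h1.differentiableOn (by norm_num) x hx').hasDerivWithinAt).hasDerivAt hn⟩

/-- The a priori bound for the resolvent in the closed right half plane. -/
theorem IsBarrier.norm_le (hB : IsBarrier f c a b V ψ ψ₁ ψ₂ ω m M) (hab : a < b) {z : ℂ}
    (hz : 0 ≤ z.re) {q : ℝ → ℂ} (hq : q ∈ dirichletDomain a b) {N : ℝ}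
    (hN : ∀ x ∈ Icc a b, ‖z * q x - linearization f c a b V q x‖ ≤ N) {x : ℝ} (hx : x ∈ Icc a b) :
    ‖q x‖ ≤ M / (2 * ω * m) * N := by
  obtain ⟨hq2, hqa, hqb⟩ := hq
  have hω := hB.rate_pos
  have hm := hB.lower_pos
  have hN0 : 0 ≤ N := (norm_nonneg _).trans (hN x hx)
  have hM0 : 0 ≤ M := (hB.pos hx).le.trans (hB.upper x hx)
  obtain ⟨y, hy, hmax⟩ := isCompact_Icc.exists_isMaxOn (nonempty_Icc.2 hab.le)
    (hq2.continuousOn.norm.div hB.continuousOn fun x hx => (hB.pos hx).ne')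
  set Q := ‖q y‖ / ψ y with hQ
  have hle : ∀ x ∈ Icc a b, ‖q x‖ ≤ Q * ψ x := fun x hx =>
    (div_le_iff₀ (hB.pos hx)).1 (hmax hx)
  have hψy := hB.pos hy
  have hQy : ‖q y‖ = Q * ψ y := (div_mul_cancel₀ _ hψy.ne').symm
  rcases eq_or_ne (q y) 0 with h0 | h0
  · have : Q = 0 := by rw [hQ, h0]; simp
    have h1 := hle x hx
    rw [this, zero_mul] at h1
    exact h1.trans (by positivity)
  have hn0 : 0 < ‖q y‖ := norm_pos_iff.2 h0
  have hQ0 : 0 < Q := div_pos hn0 hψy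
  have hya : a ≠ y := by rintro rfl; exact h0 hqa
  have hyb : y ≠ b := by rintro rfl; exact h0 hqb
  have hy' : y ∈ Ioo a b := ⟨lt_of_le_of_ne hy.1 hya, lt_of_le_of_ne hy.2 hyb⟩
  -- Rotating the phase so that `θ * q y = ‖q y‖` reduces the complex problem to the maximum
  -- principle for a real function.
  set θ : ℂ := (starRingEnd ℂ) (q y) / (‖q y‖ : ℂ) with hθ
  have hθn : ‖θ‖ = 1 := by
    rw [hθ, norm_div, RCLike.norm_conj, Complex.norm_real, norm_norm, div_self hn0.ne']
  have hθq : θ * q y = (‖q y‖ : ℂ) := by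
    rw [hθ, div_mul_eq_mul_div, Complex.conj_mul', sq,
      mul_div_cancel_right₀ _ (by exact_mod_cast hn0.ne')]
  have hre : ∀ w : ℂ, (θ * w).re ≤ ‖w‖ := fun w => by
    have := Complex.re_le_norm (θ * w)
    rwa [norm_mul, hθn, one_mul] at this
  have hder : ∀ {g : ℝ → ℂ} {g' : ℂ} {t : ℝ}, HasDerivAt g g' t →
      HasDerivAt (fun t => (θ * g t).re) (θ * g').re t := fun h => by
    exact Complex.reCLM.hasFDerivAt.comp_hasDerivAt _ (h.const_mul θ)
  set q₁ := derivWithin q (Icc a b)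
  set q₂ := derivWithin q₁ (Icc a b)
  have hd₁ : ∀ t ∈ Ioo a b, HasDerivAt (fun t => (θ * q t).re - Q * ψ t)
      ((θ * q₁ t).re - Q * ψ₁ t) t := fun t ht =>
    (hder (hasDerivAt_derivWithin_of_contDiffOn hq2 ht).1).sub
      ((hB.hasDerivAt_fst t (Ioo_subset_Icc_self ht)).const_mul Q)
  have hd₂ : HasDerivAt (fun t => (θ * q₁ t).re - Q * ψ₁ t) ((θ * q₂ y).re - Q * ψ₂ y) y :=
    (hder (hasDerivAt_derivWithin_of_contDiffOn hq2 hy').2).sub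
      ((hB.hasDerivAt_snd y hy).const_mul Q)
  -- `Re(θq) ≤ |q| ≤ Qψ` with equality at `y`. Hence first derivatives agree there and second
  -- derivatives are ordered. The term `Re z * ‖q y‖` has a good sign, and the supersolution
  -- inequality leaves `2ω‖q y‖ ≤ N`.
  have hloc : IsLocalMax (fun t => (θ * q t).re - Q * ψ t) y := by
    filter_upwards [Icc_mem_nhds hy'.1 hy'.2] with t ht
    rw [hθq, Complex.ofReal_re, hQy, sub_self]
    linarith [hre (q t), hle t ht]
  have e1 := hloc.hasDerivAt_eq_zero (hd₁ y hy')
  have e2 := hloc.second_deriv_nonpos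
    (Filter.eventually_of_mem (Ioo_mem_nhds hy'.1 hy'.2) hd₁) hd₂
  have e3 : (θ * (z * q y - linearization f c a b V q y)).re =
      z.re * ‖q y‖ - ((θ * q₂ y).re + c * (θ * q₁ y).re + deriv f (V y) * ‖q y‖) := by
    have : θ * (z * q y - linearization f c a b V q y) =
        z * (θ * q y) - (θ * q₂ y + c * (θ * q₁ y) + (deriv f (V y) : ℝ) * (θ * q y)) := by
      simp only [linearization, q₁, q₂]
      ring
    rw [this, hθq]
    simp
  have e4 := (hre _).trans (hN y hy)
  rw [e3] at e4
  have e5 := hB.supersolution y hy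
  have e6 : 2 * ω * ‖q y‖ ≤ N := by
    have h1 : (θ * q₁ y).re = Q * ψ₁ y := sub_eq_zero.1 e1
    have h2 : Q * (ψ₂ y + c * ψ₁ y + deriv f (V y) * ψ y) ≤ Q * (-(2 * ω) * ψ y) := by gcongr
    have h3 : 0 ≤ z.re * ‖q y‖ := by positivity
    have h4 : (deriv f (V y)) * ‖q y‖ = Q * (deriv f (V y) * ψ y) := by rw [hQy]; ring
    have h5 : 2 * ω * ‖q y‖ = Q * (2 * ω * ψ y) := by rw [hQy]; ring
    rw [h1, h4] at e4
    rw [h5]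
    linarith
  calc ‖q x‖ ≤ Q * ψ x := hle x hx
    _ ≤ (N / (2 * ω)) / m * M := by
      refine mul_le_mul ?_ (hB.upper x hx) (hB.pos hx).le (by positivity)
      rw [hQ]
      refine div_le_div₀ (by positivity) ?_ hm (hB.lower y hy)
      rw [le_div_iff₀ (by positivity)]
      linarith
    _ = _ := by field_simp

/-- Solvability of the linear initial value problem. -/
theorem exists_linear_solution (z : ℂ) (c a : ℝ) {d : ℝ → ℝ} (hd : Continuous d) {D : ℝ}
    (hD : ∀ x, |d x| ≤ D) {g : ℝ → ℂ} (hg : Continuous g) {N : ℝ} (hN : ∀ x, ‖g x‖ ≤ N) (p₀ : ℂ) :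
    ∃ q p : ℝ → ℂ, q a = 0 ∧ p a = p₀ ∧ (∀ x, HasDerivAt q (p x) x) ∧
      ∀ x, HasDerivAt p (z * q x - c * p x - d x * q x - g x) x := by
  have hD0 : 0 ≤ D := (abs_nonneg _).trans (hD 0)
  obtain ⟨y, hy0, hy⟩ := exists_global_solution
    (fun t (u : ℂ × ℂ) => (u.2, z * u.1 - c * u.2 - d t * u.1 - g t))
    (by
      unfold Function.uncurry
      fun_prop)
    (K := ⟨1 + ‖z‖ + |c| + D, by positivity⟩)
    (fun t => LipschitzWith.of_dist_le_mul fun u v => by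
      rw [dist_eq_norm, dist_eq_norm]
      have h1 : ‖u.1 - v.1‖ ≤ ‖u - v‖ := norm_fst_le (u - v)
      have h2 : ‖u.2 - v.2‖ ≤ ‖u - v‖ := norm_snd_le (u - v)
      have h0 := norm_nonneg (u - v)
      refine norm_prod_le_iff.2 ⟨?_, ?_⟩
      · refine h2.trans (le_mul_of_one_le_left h0 ?_)
        change 1 ≤ 1 + ‖z‖ + |c| + D
        have := norm_nonneg z
        have := abs_nonneg c
        linarith
      · have e : z * u.1 - c * u.2 - d t * u.1 - g t - (z * v.1 - c * v.2 - d t * v.1 - g t) =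
            z * (u.1 - v.1) - c * (u.2 - v.2) - d t * (u.1 - v.1) := by ring
        simp only [Prod.snd_sub]
        rw [e]
        calc _ ≤ ‖z * (u.1 - v.1)‖ + ‖(c : ℂ) * (u.2 - v.2)‖ + ‖(d t : ℂ) * (u.1 - v.1)‖ :=
              (norm_sub_le _ _).trans (by gcongr; exact norm_sub_le _ _)
          _ = ‖z‖ * ‖u.1 - v.1‖ + |c| * ‖u.2 - v.2‖ + |d t| * ‖u.1 - v.1‖ := by
              simp
          _ ≤ ‖z‖ * ‖u - v‖ + |c| * ‖u - v‖ + D * ‖u - v‖ := by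
              gcongr
              exact hD t
          _ ≤ (1 + ‖z‖ + |c| + D) * ‖u - v‖ := by nlinarith
          _ = _ := rfl)
    (M := N)
    (fun t => norm_prod_le_iff.2 ⟨by simpa using (norm_nonneg _).trans (hN 0),
      by simpa using hN t⟩)
    a (0, p₀)
  exact ⟨fun x => (y x).1, fun x => (y x).2, by simp [hy0], by simp [hy0],
    fun x => (hy x).fst, fun x => (hy x).snd⟩

theorem linearization_eq_of_hasDerivAt (hab : a < b) {q p r : ℝ → ℂ} {Φ : ℝ → ℝ}
    (hq : ∀ x, HasDerivAt q (p x) x) (hp : ∀ x, HasDerivAt p (r x) x) {x : ℝ} (hx : x ∈ Icc a b) :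
    linearization f c a b Φ q x = r x + c * p x + (deriv f (Φ x) : ℝ) * q x := by
  have h1 : ∀ y ∈ Icc a b, derivWithin q (Icc a b) y = p y := fun y hy =>
    (hq y).hasDerivWithinAt.derivWithin (uniqueDiffOn_Icc hab y hy)
  rw [linearization, derivWithin_congr h1 (h1 x hx), h1 x hx,
    (hp x).hasDerivWithinAt.derivWithin (uniqueDiffOn_Icc hab x hx)]

/-- Surjectivity by linear shooting: a particular solution and a homogeneous one, both zero at `a`,
are combined to vanish at `b`. This needs the homogeneous one to be nonzero at `b`, which is the
injectivity contained in the a priori bound. -/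
theorem IsBarrier.mem_resolventSetLin (hB : IsBarrier f c a b V ψ ψ₁ ψ₂ ω m M) (hab : a < b)
    (hf : ContDiff ℝ 1 f) (hV : ContinuousOn V (Icc a b)) {z : ℂ} (hz : 0 ≤ z.re) :
    z ∈ resolventSetLin f c a b V := by
  refine ⟨fun g hg => ?_, M / (2 * ω * m), fun q hq N hN x hx => hB.norm_le hab hz hq hN hx⟩
  have hdc : ContinuousOn (fun x => deriv f (V x)) (Icc a b) :=
    (hf.continuous_deriv le_rfl).comp_continuousOn hV
  set d : ℝ → ℝ := IccExtend hab.le ((Icc a b).domRestrict fun x => deriv f (V x)) with hd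
  have hdcont : Continuous d := (continuousOn_iff_continuous_domRestrict.1 hdc).Icc_extend'
  have hdeq : ∀ x ∈ Icc a b, d x = deriv f (V x) := fun x hx => IccExtend_of_mem _ _ hx
  obtain ⟨D, hD⟩ := (isCompact_Icc (a := a) (b := b)).exists_bound_of_continuousOn hdc
  have hDb : ∀ x, |d x| ≤ D := fun x => hD _ (projIcc a b hab.le x).2
  set G : ℝ → ℂ := IccExtend hab.le ((Icc a b).domRestrict g) with hG
  have hGcont : Continuous G := (continuousOn_iff_continuous_domRestrict.1 hg).Icc_extend'
  have hGeq : ∀ x ∈ Icc a b, G x = g x := fun x hx => IccExtend_of_mem _ _ hx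
  obtain ⟨N, hN⟩ := (isCompact_Icc (a := a) (b := b)).exists_bound_of_continuousOn hg
  have hNb : ∀ x, ‖G x‖ ≤ N := fun x => hN _ (projIcc a b hab.le x).2
  obtain ⟨q₀, p₀, hq0a, -, hq0, hp0⟩ := exists_linear_solution z c a hdcont hDb hGcont hNb 0
  obtain ⟨q₁, p₁, hq1a, hp1a, hq1, hp1⟩ := exists_linear_solution z c a hdcont hDb
    (g := fun _ => 0) continuous_const (N := 0) (by simp) 1
  have cont : ∀ {q p r : ℝ → ℂ}, (∀ x, HasDerivAt q (p x) x) → (∀ x, HasDerivAt p (r x) x) →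
      Continuous q ∧ Continuous p := fun h1 h2 =>
    ⟨continuous_iff_continuousAt.2 fun x => (h1 x).continuousAt,
      continuous_iff_continuousAt.2 fun x => (h2 x).continuousAt⟩
  -- Otherwise `q₁` is in the domain with zero right side, so the bound with `N = 0` makes it vanish
  -- on `[a,b]`, against its unit slope at `a`.
  have hq1b : q₁ b ≠ 0 := by
    intro hb
    have hc := cont hq1 hp1
    have hdom : q₁ ∈ dirichletDomain a b := ⟨(contDiff_two_of_hasDerivAt hq1 hp1
      (by have := hc.1; have := hc.2; fun_prop)).contDiffOn, hq1a, hb⟩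
    have hzero : ∀ x ∈ Icc a b, q₁ x = 0 := by
      intro x hx
      have := hB.norm_le hab hz hdom (N := 0) (fun y hy => by
        rw [linearization_eq_of_hasDerivAt hab hq1 hp1 hy, hdeq y hy]
        refine (norm_eq_zero.2 ?_).le
        ring) hx
      simpa using this
    have h1 := (hq1 a).hasDerivWithinAt (s := Icc a b)
    have h2 := (hasDerivWithinAt_const a (Icc a b) (0 : ℂ)).congr hzero hq1a
    have := (uniqueDiffOn_Icc hab a (left_mem_Icc.2 hab.le)).eq_deriv _ h1 h2
    rw [hp1a] at this
    exact one_ne_zero this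
  set k : ℂ := q₀ b / q₁ b
  have hq : ∀ x, HasDerivAt (fun x => q₀ x - k * q₁ x) (p₀ x - k * p₁ x) x := fun x =>
    (hq0 x).sub ((hq1 x).const_mul k)
  have hp : ∀ x, HasDerivAt (fun x => p₀ x - k * p₁ x)
      ((z * q₀ x - c * p₀ x - d x * q₀ x - G x) -
        k * (z * q₁ x - c * p₁ x - d x * q₁ x - 0)) x := fun x =>
    (hp0 x).sub ((hp1 x).const_mul k)
  have hc0 := cont hq0 hp0
  have hc1 := cont hq1 hp1
  refine ⟨fun x => q₀ x - k * q₁ x, ⟨(contDiff_two_of_hasDerivAt hq hp ?_).contDiffOn, ?_, ?_⟩,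
    fun x hx => ?_⟩
  · obtain ⟨h1, h2⟩ := hc0
    obtain ⟨h3, h4⟩ := hc1
    fun_prop
  · simp [hq0a, hq1a]
  · simp [k, div_mul_cancel₀ _ hq1b]
  · rw [linearization_eq_of_hasDerivAt hab hq hp hx, hdeq x hx, hGeq x hx]
    ring

theorem IsBarrier.spectrumLin_subset (hB : IsBarrier f c a b V ψ ψ₁ ψ₂ ω m M) (hab : a < b)
    (hf : ContDiff ℝ 1 f) (hV : ContinuousOn V (Icc a b)) :
    spectrumLin f c a b V ⊆ {z : ℂ | z.re < 0} := fun z hz => by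
  by_contra h
  exact hz (hB.mem_resolventSetLin hab hf hV (not_lt.1 h))

end Spectrum

theorem linearization_congr {f Φ V : ℝ → ℝ} {c a b : ℝ} (h : EqOn Φ V (Icc a b)) (q : ℝ → ℂ)
    {x : ℝ} (hx : x ∈ Icc a b) : linearization f c a b Φ q x = linearization f c a b V q x := by
  rw [linearization, linearization, h hx]

theorem spectrumLin_congr {f Φ V : ℝ → ℝ} {c a b : ℝ} (h : EqOn Φ V (Icc a b)) :
    spectrumLin f c a b Φ = spectrumLin f c a b V := by
  rw [spectrumLin, spectrumLin, compl_inj_iff]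
  ext z
  simp +contextual only [resolventSetLin, mem_ofPred_eq, linearization_congr h]

end TravellingWave

/-! ### Parabolic comparison and uniqueness of classical solutions -/

namespace TravellingWave

open scoped NNReal Topology

/-- The maximum in time may occur at the final time, where only slopes from the left are controlled.
-/
theorem _root_.HasDerivAt.nonneg_of_forall_le_left {g : ℝ → ℝ} {g' s t : ℝ} (h : HasDerivAt g g' t)
    (hst : s < t) (hmax : ∀ r ∈ Icc s t, g r ≤ g t) : 0 ≤ g' := by
  have h1 := (hasDerivWithinAt_iff_tendsto_slope' (self_notMem_Iio (a := t))).1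
    (h.hasDerivWithinAt (s := Iio t))
  refine ge_of_tendsto h1 ?_
  filter_upwards [Ioo_mem_nhdsLT hst] with r hr
  rw [slope_def_field]
  exact div_nonneg_of_nonpos (sub_nonpos.2 (hmax r ⟨hr.1.le, hr.2.le⟩)) (by linarith [hr.2])

/-- The weak maximum principle on `[a,b] × [0,T]`. -/
theorem parabolic_comparison {a b c K T : ℝ} {d dt dx dxx : ℝ → ℝ → ℝ}
    (hcont : ContinuousOn (fun p : ℝ × ℝ => d p.1 p.2) (Icc a b ×ˢ Icc 0 T))
    (hinit : ∀ x ∈ Icc a b, d x 0 ≤ 0) (hleft : ∀ t ∈ Ioc 0 T, d a t ≤ 0)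
    (hright : ∀ t ∈ Ioc 0 T, d b t ≤ 0)
    (hder : ∀ x ∈ Ioo a b, ∀ t ∈ Ioc 0 T, HasDerivAt (fun s => d x s) (dt x t) t ∧
      HasDerivAt (fun y => d y t) (dx x t) x ∧ HasDerivAt (fun y => dx y t) (dxx x t) x)
    (hle : ∀ x ∈ Ioo a b, ∀ t ∈ Ioc 0 T, 0 < d x t →
      dt x t ≤ dxx x t + c * dx x t + K * d x t) :
    ∀ x ∈ Icc a b, ∀ t ∈ Icc 0 T, d x t ≤ 0 := by
  intro x₁ hx₁ t₁ ht₁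
  by_contra! hpos
  -- At a positive maximum of `e^{-(K+1)t} d` one has `d_t ≥ (K+1) d`, whereas the differential
  -- inequality gives `d_t ≤ K d`. It is needed only where `d > 0`.
  obtain ⟨⟨x, t⟩, ⟨hx, ht⟩, hmax⟩ := (isCompact_Icc.prod isCompact_Icc).exists_isMaxOn
    ⟨(x₁, t₁), hx₁, ht₁⟩ ((by fun_prop : Continuous fun p : ℝ × ℝ =>
      Real.exp (-((K + 1) * p.2))).continuousOn.mul hcont)
  simp only at hx ht
  have hmax' : ∀ y ∈ Icc a b, ∀ s ∈ Icc 0 T, Real.exp (-((K + 1) * s)) * d y s ≤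
      Real.exp (-((K + 1) * t)) * d x t := fun y hy s hs => hmax (show (y, s) ∈ _ from ⟨hy, hs⟩)
  have hdpos : 0 < d x t := by
    have h1 := hmax' x₁ hx₁ t₁ ht₁
    have h2 : 0 < Real.exp (-((K + 1) * t₁)) * d x₁ t₁ := by positivity
    exact pos_of_mul_pos_right (h2.trans_le h1) (Real.exp_pos _).le
  have ht0 : 0 < t := by
    refine lt_of_le_of_ne ht.1 ?_
    rintro rfl
    exact absurd (hinit x hx) (not_le.2 hdpos)
  have ht' : t ∈ Ioc 0 T := ⟨ht0, ht.2⟩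
  have hxa : a ≠ x := by
    rintro rfl
    exact absurd (hleft t ht') (not_le.2 hdpos)
  have hxb : x ≠ b := by
    rintro rfl
    exact absurd (hright t ht') (not_le.2 hdpos)
  have hx' : x ∈ Ioo a b := ⟨lt_of_le_of_ne hx.1 hxa, lt_of_le_of_ne hx.2 hxb⟩
  obtain ⟨h1, h2, h3⟩ := hder x hx' t ht'
  have hloc : IsLocalMax (fun y => d y t) x := by
    filter_upwards [Icc_mem_nhds hx'.1 hx'.2] with y hy
    exact le_of_mul_le_mul_left (hmax' y hy t ht) (Real.exp_pos _)
  have e1 := hloc.hasDerivAt_eq_zero h2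
  have e2 := hloc.second_deriv_nonpos (Filter.eventually_of_mem (Ioo_mem_nhds hx'.1 hx'.2)
    fun y hy => (hder y hy t ht').2.1) h3
  have h4 := ((((hasDerivAt_id t).const_mul (K + 1)).neg.exp).mul h1).nonneg_of_forall_le_left ht0
    (fun r hr => hmax' x hx r ⟨hr.1, hr.2.trans ht.2⟩)
  have h5 : Real.exp (-((K + 1) * t)) * (dt x t - (K + 1) * d x t) =
      Real.exp (-((K + 1) * t)) * -((K + 1) * 1) * d x t + Real.exp (-((K + 1) * t)) * dt x t := by
    ring
  have h6 : 0 ≤ dt x t - (K + 1) * d x t := by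
    refine nonneg_of_mul_nonneg_right (a := Real.exp (-((K + 1) * t))) ?_ (Real.exp_pos _)
    rw [h5]
    simpa using h4
  have h7 := hle x hx' t ht' hdpos
  rw [e1] at h7
  linarith

namespace IsClassicalSolution

variable {f : ℝ → ℝ} {c a b : ℝ} {u₀ : ℝ → ℝ} {u v : ℝ → ℝ → ℝ}

/-- Up to a fixed time both solutions take values in a compact interval, on which `f` is Lipschitz;
so where the difference is positive it satisfies a linear inequality. -/
theorem le (hf : ContDiff ℝ 1 f) (hu : IsClassicalSolution f c a b u₀ u)
    (hv : IsClassicalSolution f c a b u₀ v) : ∀ x ∈ Icc a b, ∀ t ≥ 0, u x t ≤ v x t := by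
  intro x hx t ht
  obtain ⟨ut, ux, uxx, -, -, -, hud⟩ := hu.equation
  obtain ⟨vt, vx, vxx, -, -, -, hvd⟩ := hv.equation
  have hsub : Icc a b ×ˢ Icc 0 t ⊆ Icc a b ×ˢ Ici 0 :=
    prod_mono_right Icc_subset_Ici_self
  have hcomp : IsCompact (Icc a b ×ˢ Icc 0 t) := isCompact_Icc.prod isCompact_Icc
  obtain ⟨M₁, hM₁⟩ := hcomp.exists_bound_of_continuousOn (hu.continuousOn.mono hsub)
  obtain ⟨M₂, hM₂⟩ := hcomp.exists_bound_of_continuousOn (hv.continuousOn.mono hsub)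
  obtain ⟨K, hK⟩ := hf.locallyLipschitz.locallyLipschitzOn.exists_lipschitzOnWith_of_compact
    (isCompact_Icc (a := -max M₁ M₂) (b := max M₁ M₂))
  have := parabolic_comparison (c := c) (K := K) (T := t) (d := fun x s => u x s - v x s)
    (dt := fun x s => ut x s - vt x s) (dx := fun x s => ux x s - vx x s)
    (dxx := fun x s => uxx x s - vxx x s) (a := a) (b := b)
    ((hu.continuousOn.sub hv.continuousOn).mono hsub)
    (fun y hy => by rw [hu.initial y hy, hv.initial y hy, sub_self])
    (fun s hs => by rw [hu.left s hs.1, hv.left s hs.1, sub_self])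
    (fun s hs => by rw [hu.right s hs.1, hv.right s hs.1, sub_self])
    (fun y hy s hs => ⟨(hud y hy s hs.1).1.sub (hvd y hy s hs.1).1,
      (hud y hy s hs.1).2.1.sub (hvd y hy s hs.1).2.1,
      (hud y hy s hs.1).2.2.1.sub (hvd y hy s hs.1).2.2.1⟩)
    (fun y hy s hs hpos => by
      have hmem : (y, s) ∈ Icc a b ×ˢ Icc 0 t := ⟨Ioo_subset_Icc_self hy, Ioc_subset_Icc_self hs⟩
      have h1 := hK.dist_le_mul (u y s) (abs_le.1 ((hM₁ _ hmem).trans (le_max_left _ _)))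
        (v y s) (abs_le.1 ((hM₂ _ hmem).trans (le_max_right _ _)))
      rw [Real.dist_eq, Real.dist_eq, abs_of_pos hpos] at h1
      have h2 := le_abs_self (f (u y s) - f (v y s))
      rw [(hud y hy s hs.1).2.2.2, (hvd y hy s hs.1).2.2.2]
      linarith) x hx t ⟨ht, le_rfl⟩
  exact sub_nonpos.1 this

theorem unique (hf : ContDiff ℝ 1 f) (hu : IsClassicalSolution f c a b u₀ u)
    (hv : IsClassicalSolution f c a b u₀ v) : ∀ x ∈ Icc a b, ∀ t ≥ 0, v x t = u x t :=
  fun x hx t ht => le_antisymm (hv.le hf hu x hx t ht) (hu.le hf hv x hx t ht)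

end IsClassicalSolution

end TravellingWave

namespace TravellingWave

open MeasureTheory
open scoped NNReal Topology

noncomputable section

/-! ### The heat kernel and its averages -/

section HeatKernel

theorem integrable_exp_neg_abs : Integrable fun z : ℝ => Real.exp (-|z|) := by
  refine (integrable_inv_one_add_sq.const_mul 2).mono'
    (by fun_prop : Continuous fun z : ℝ => Real.exp (-|z|)).aestronglyMeasurable
    (ae_of_all _ fun z => ?_)
  have h1 := Real.quadratic_le_exp_of_nonneg (abs_nonneg z)
  rw [Real.norm_of_nonneg (Real.exp_pos _).le, Real.exp_neg, ← div_eq_mul_inv,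
    inv_eq_one_div, div_le_div_iff₀ (Real.exp_pos _) (by positivity)]
  have := sq_abs z
  nlinarith [abs_nonneg z]

/-- The heat kernel at time `1`. -/
def heatKernel (z : ℝ) : ℝ := (√(4 * Real.pi))⁻¹ * Real.exp (-(1 / 4) * z ^ 2)

/-- Minus the first derivative of the heat kernel at time `1`. -/
def heatKernel₁ (z : ℝ) : ℝ := z / 2 * heatKernel z

/-- The second derivative of the heat kernel at time `1`. -/
def heatKernel₂ (z : ℝ) : ℝ := (z ^ 2 / 4 - 1 / 2) * heatKernel z

@[fun_prop]
theorem continuous_heatKernel : Continuous heatKernel := by unfold heatKernel; fun_prop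

@[fun_prop]
theorem continuous_heatKernel₁ : Continuous heatKernel₁ := by unfold heatKernel₁; fun_prop

@[fun_prop]
theorem continuous_heatKernel₂ : Continuous heatKernel₂ := by unfold heatKernel₂; fun_prop

theorem heatKernel_pos (z : ℝ) : 0 < heatKernel z := by
  unfold heatKernel
  have := Real.pi_pos
  positivity

theorem heatKernel_neg (z : ℝ) : heatKernel (-z) = heatKernel z := by simp [heatKernel]

theorem integral_heatKernel : ∫ z, heatKernel z = 1 := by
  unfold heatKernel
  rw [integral_const_mul, integral_gaussian, show Real.pi / (1 / 4) = 4 * Real.pi by ring]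
  exact inv_mul_cancel₀ (Real.sqrt_pos.2 (by have := Real.pi_pos; positivity)).ne'

theorem hasDerivAt_heatKernel (z : ℝ) : HasDerivAt heatKernel (-heatKernel₁ z) z := by
  have := ((((hasDerivAt_id z).pow 2).const_mul (-(1 / 4))).exp).const_mul (√(4 * Real.pi))⁻¹
  refine this.congr_deriv ?_
  simp [heatKernel₁, heatKernel]
  ring

theorem hasDerivAt_heatKernel₁ (z : ℝ) : HasDerivAt heatKernel₁ (-heatKernel₂ z) z := by
  have := ((hasDerivAt_id z).div_const 2).mul (hasDerivAt_heatKernel z)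
  refine this.congr_deriv ?_
  simp [heatKernel₁, heatKernel₂]
  ring

/-- Completing the square: `z²/4 - 3|z| + 9 = (|z| - 6)²/4`. Of the three factors `e^{-|z|}`, one
absorbs the `z²` of `heatKernel₂` and another the extra `z` in `z * heatKernel₂ z`, so that one
always remains. -/
theorem heatKernel_le (z : ℝ) : heatKernel z ≤ Real.exp 9 * Real.exp (-|z|) ^ 3 := by
  have h1 : (√(4 * Real.pi))⁻¹ ≤ 1 := by
    refine inv_le_one_of_one_le₀ (Real.one_le_sqrt.2 ?_)
    linarith [Real.pi_gt_three]
  calc heatKernel z ≤ 1 * Real.exp (-(1 / 4) * z ^ 2) := by unfold heatKernel; gcongr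
    _ ≤ Real.exp (9 + 3 * -|z|) := by
      rw [one_mul, Real.exp_le_exp]
      have := sq_abs z
      nlinarith [sq_nonneg (|z| - 6)]
    _ = _ := by
      rw [Real.exp_add, ← Real.exp_nat_mul]
      norm_num

/-- Exponential decay of a kernel. -/
def ExpDecay (φ : ℝ → ℝ) : Prop := ∀ z, |φ z| ≤ Real.exp 9 * Real.exp (-|z|)

theorem abs_mul_exp_le (z : ℝ) : |z| * Real.exp (-|z|) ≤ 1 := by
  have := Real.add_one_le_exp |z|
  rw [Real.exp_neg, ← div_eq_mul_inv, div_le_one (Real.exp_pos _)]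
  linarith

theorem sq_mul_exp_le (z : ℝ) : z ^ 2 * Real.exp (-|z|) ≤ 2 := by
  have := Real.quadratic_le_exp_of_nonneg (abs_nonneg z)
  rw [Real.exp_neg, ← div_eq_mul_inv, div_le_iff₀ (Real.exp_pos _)]
  have := sq_abs z
  nlinarith [abs_nonneg z]

theorem abs_heatKernel₂_le (z : ℝ) : |heatKernel₂ z| ≤ Real.exp 9 * Real.exp (-|z|) ^ 2 := by
  have h1 := heatKernel_le z
  have h2 := sq_mul_exp_le z
  have h0 := Real.exp_pos (-|z|)
  have h3 : Real.exp (-|z|) ≤ 1 := Real.exp_le_one_iff.2 (by simp)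
  have h9 := Real.exp_pos 9
  have h4 : |z ^ 2 / 4 - 1 / 2| ≤ z ^ 2 / 4 + 1 / 2 := by
    rw [abs_le]; constructor <;> nlinarith [sq_nonneg z]
  rw [heatKernel₂, abs_mul, abs_of_pos (heatKernel_pos z)]
  calc _ ≤ (z ^ 2 / 4 + 1 / 2) * (Real.exp 9 * Real.exp (-|z|) ^ 3) := by
        have := (heatKernel_pos z).le
        gcongr
    _ = Real.exp 9 * Real.exp (-|z|) ^ 2 * ((z ^ 2 * Real.exp (-|z|)) / 4 + Real.exp (-|z|) / 2) := by
        ring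
    _ ≤ Real.exp 9 * Real.exp (-|z|) ^ 2 * 1 := by
        gcongr
        linarith
    _ = _ := mul_one _

theorem expDecay_heatKernel : ExpDecay heatKernel := by
  intro z
  have h3 : Real.exp (-|z|) ≤ 1 := Real.exp_le_one_iff.2 (by simp)
  rw [abs_of_pos (heatKernel_pos z)]
  refine (heatKernel_le z).trans ?_
  gcongr
  exact pow_le_of_le_one (Real.exp_pos _).le h3 (by norm_num)

theorem expDecay_heatKernel₁ : ExpDecay heatKernel₁ := by
  intro z
  have h0 := Real.exp_pos (-|z|)
  have h3 : Real.exp (-|z|) ≤ 1 := Real.exp_le_one_iff.2 (by simp)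
  have h2 := abs_mul_exp_le z
  have h9 := Real.exp_pos 9
  rw [heatKernel₁, abs_mul, abs_of_pos (heatKernel_pos z), abs_div, abs_two]
  calc _ ≤ |z| / 2 * (Real.exp 9 * Real.exp (-|z|) ^ 3) := by
        gcongr
        exact heatKernel_le z
    _ = Real.exp 9 * Real.exp (-|z|) * (|z| * Real.exp (-|z|) * (Real.exp (-|z|) / 2)) := by ring
    _ ≤ Real.exp 9 * Real.exp (-|z|) * (1 * 1) := by
        gcongr
        linarith
    _ = _ := by ring

theorem expDecay_heatKernel₂ : ExpDecay heatKernel₂ := by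
  intro z
  have h3 : Real.exp (-|z|) ≤ 1 := Real.exp_le_one_iff.2 (by simp)
  refine (abs_heatKernel₂_le z).trans ?_
  gcongr
  exact pow_le_of_le_one (Real.exp_pos _).le h3 (by norm_num)

theorem expDecay_mul_heatKernel₂ : ExpDecay fun z => z * heatKernel₂ z := by
  intro z
  have h0 := Real.exp_pos (-|z|)
  have h2 := abs_mul_exp_le z
  have h9 := Real.exp_pos 9
  rw [abs_mul]
  calc _ ≤ |z| * (Real.exp 9 * Real.exp (-|z|) ^ 2) := by
        gcongr
        exact abs_heatKernel₂_le z
    _ = Real.exp 9 * Real.exp (-|z|) * (|z| * Real.exp (-|z|)) := by ring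
    _ ≤ Real.exp 9 * Real.exp (-|z|) * 1 := by gcongr
    _ = _ := by ring

theorem ExpDecay.integrable {φ : ℝ → ℝ} (h : ExpDecay φ) (hc : Continuous φ) : Integrable φ :=
  (integrable_exp_neg_abs.const_mul (Real.exp 9)).mono' hc.aestronglyMeasurable (ae_of_all _ h)

theorem integral_heatKernel₂ : ∫ z, heatKernel₂ z = 0 := by
  have h := integral_eq_zero_of_hasDerivAt_of_integrable hasDerivAt_heatKernel₁
    (expDecay_heatKernel₂.integrable continuous_heatKernel₂).neg
    (expDecay_heatKernel₁.integrable continuous_heatKernel₁)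
  rwa [integral_neg, neg_eq_zero] at h

/-- The total mass of the exponential bound of the kernels. -/
def kernelMass : ℝ := ∫ z, Real.exp 9 * Real.exp (-|z|)

theorem kernelMass_nonneg : 0 ≤ kernelMass := integral_nonneg fun z => by positivity

/-- The average of `h(x + σ z)` against the kernel `φ`. -/
def average (φ h : ℝ → ℝ) (x σ : ℝ) : ℝ := ∫ z, h (x + σ * z) * φ z

variable {φ χ h : ℝ → ℝ} {M : ℝ}

theorem integrable_average (hφ : ExpDecay φ) (hφc : Continuous φ) (hh : Continuous h)
    (hM : ∀ x, |h x| ≤ M) (x σ : ℝ) : Integrable fun z => h (x + σ * z) * φ z := by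
  refine (hφ.integrable hφc).bdd_mul (c := M)
    (by fun_prop : Continuous fun z => h (x + σ * z)).aestronglyMeasurable
    (ae_of_all _ fun z => hM _)

theorem abs_average_le (hφ : ExpDecay φ) (hM : ∀ x, |h x| ≤ M) (x σ : ℝ) :
    |average φ h x σ| ≤ M * kernelMass := by
  have hM0 : 0 ≤ M := (abs_nonneg _).trans (hM 0)
  rw [average, kernelMass, ← integral_const_mul]
  rw [← Real.norm_eq_abs]
  refine norm_integral_le_of_norm_le ((integrable_exp_neg_abs.const_mul _).const_mul _)
    (ae_of_all _ fun z => ?_)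
  rw [Real.norm_eq_abs, abs_mul]
  gcongr
  · exact hM _
  · exact hφ z

theorem abs_average_heatKernel_le (hM : ∀ x, |h x| ≤ M) (x σ : ℝ) :
    |average heatKernel h x σ| ≤ M := by
  have : ∫ z, M * heatKernel z = M := by rw [integral_const_mul, integral_heatKernel, mul_one]
  rw [← this, average]
  rw [← Real.norm_eq_abs]
  refine norm_integral_le_of_norm_le
    ((expDecay_heatKernel.integrable continuous_heatKernel).const_mul _) (ae_of_all _ fun z => ?_)
  rw [Real.norm_eq_abs, abs_mul, abs_of_pos (heatKernel_pos z)]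
  have := heatKernel_pos z
  gcongr
  exact hM _

/-- The kernel has zero mean, so `h x` can be subtracted from `h`; Lipschitz continuity then gains a
factor `σ = √τ` against the singular prefactor `τ⁻¹`. -/
theorem abs_average_heatKernel₂_le {l : ℝ} (hh : Continuous h) (hM : ∀ x, |h x| ≤ M)
    (hl : ∀ x y, |h x - h y| ≤ l * |x - y|) (x : ℝ) {σ : ℝ} (hσ : 0 ≤ σ) :
    |average heatKernel₂ h x σ| ≤ l * σ * kernelMass := by
  have hl0 : 0 ≤ l := by simpa using (abs_nonneg _).trans (hl 1 0)
  have h1 : average heatKernel₂ h x σ = ∫ z, (h (x + σ * z) - h x) * heatKernel₂ z := by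
    simp only [sub_mul]
    rw [integral_sub (integrable_average expDecay_heatKernel₂ continuous_heatKernel₂ hh hM x σ)
      ((expDecay_heatKernel₂.integrable continuous_heatKernel₂).const_mul _), integral_const_mul,
      integral_heatKernel₂, mul_zero, sub_zero, average]
  rw [h1, kernelMass, ← integral_const_mul]
  rw [← Real.norm_eq_abs]
  refine norm_integral_le_of_norm_le ((integrable_exp_neg_abs.const_mul _).const_mul _)
    (ae_of_all _ fun z => ?_)
  rw [Real.norm_eq_abs, abs_mul]
  calc _ ≤ l * |x + σ * z - x| * |heatKernel₂ z| := by gcongr; exact hl _ _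
    _ = l * σ * |z * heatKernel₂ z| := by
      rw [add_sub_cancel_left, abs_mul, abs_mul, abs_of_nonneg hσ]; ring
    _ ≤ _ := by gcongr; exact expDecay_mul_heatKernel₂ z

theorem average_heatKernel_zero (h : ℝ → ℝ) (x : ℝ) : average heatKernel h x 0 = h x := by
  simp [average, integral_const_mul, integral_heatKernel]

/-- The substitution moves `x` and `σ` from `h` into the kernel, so that averages can be
differentiated for merely continuous `h`. -/
theorem average_eq (φ h : ℝ → ℝ) (x : ℝ) {σ : ℝ} (hσ : 0 < σ) :
    average φ h x σ = ∫ y, σ⁻¹ * (h y * φ ((y - x) / σ)) := by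
  have h1 := Measure.integral_comp_mul_left (fun y => h (x + y) * φ (y / σ)) σ
  have h2 := integral_add_left_eq_self (μ := volume) (fun y => h y * φ ((y - x) / σ)) x
  simp only [add_sub_cancel_left] at h2
  simp only [mul_div_cancel_left₀ _ hσ.ne'] at h1
  rw [average, h1, h2, abs_of_pos (inv_pos.2 hσ), smul_eq_mul, integral_const_mul]

theorem integrable_kernel_rescaled (x : ℝ) {σ : ℝ} (hσ : σ ≠ 0) :
    Integrable fun y => Real.exp (-|(y - x) / σ|) :=
  (integrable_exp_neg_abs.comp_div hσ).comp_sub_right x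

/-- Differentiation of the averages in `x`. -/
theorem hasDerivAt_average (hφ : ExpDecay φ) (hφc : Continuous φ) (hχ : ExpDecay χ)
    (hχc : Continuous χ) (hd : ∀ z, HasDerivAt φ (-χ z) z) (hh : Continuous h)
    (hM : ∀ x, |h x| ≤ M) (x : ℝ) {σ : ℝ} (hσ : 0 < σ) :
    HasDerivAt (fun x => average φ h x σ) (σ⁻¹ * average χ h x σ) x := by
  have hM0 : 0 ≤ M := (abs_nonneg _).trans (hM 0)
  have key := (hasDerivAt_integral_of_dominated_loc_of_deriv_le (μ := volume)
    (F := fun x y => σ⁻¹ * (h y * φ ((y - x) / σ)))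
    (F' := fun x y => σ⁻¹ * (σ⁻¹ * (h y * χ ((y - x) / σ)))) (x₀ := x)
    -- Moving the centre by less than `σ` changes `|(y - x)/σ|` by at most `1`, which costs the
    -- factor `e`.
    (bound := fun y => σ⁻¹ * (σ⁻¹ * (M * (Real.exp 9 * (Real.exp 1 *
      Real.exp (-|(y - x) / σ|))))))
    (Metric.ball_mem_nhds x hσ)
    (Filter.Eventually.of_forall fun x' =>
      (by fun_prop : Continuous fun y => σ⁻¹ * (h y * φ ((y - x') / σ))).aestronglyMeasurable)
    ?_ (by fun_prop : Continuous _).aestronglyMeasurable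
    (ae_of_all _ fun y x' hx' => ?_) ?_ (ae_of_all _ fun y x' _ => ?_)).2
  · simp only [average_eq _ h _ hσ]
    rw [← integral_const_mul]
    exact key
  · refine Integrable.const_mul ((((hφ.integrable hφc).comp_div hσ.ne').comp_sub_right x).bdd_mul
      (c := M) hh.aestronglyMeasurable (ae_of_all _ hM)) _
  · rw [norm_mul, norm_mul, norm_mul, Real.norm_of_nonneg (inv_pos.2 hσ).le, Real.norm_eq_abs,
      Real.norm_eq_abs]
    gcongr
    · exact hM y
    · refine (hχ _).trans ?_
      rw [← Real.exp_add 1]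
      gcongr
      have h1 : |(y - x) / σ| ≤ |(y - x') / σ| + |(x' - x) / σ| := by
        refine le_trans (le_of_eq ?_) (abs_add_le _ _)
        congr 1
        ring
      have h2 : |(x' - x) / σ| ≤ 1 := by
        rw [abs_div, abs_of_pos hσ, div_le_one hσ]
        exact (by simpa [Real.dist_eq] using hx' : |x' - x| < σ).le
      linarith
  · exact ((((integrable_kernel_rescaled x hσ.ne').const_mul _).const_mul _).const_mul _ |>.const_mul
      _ |>.const_mul _)
  · have h1 : HasDerivAt (fun x => (y - x) / σ) (-σ⁻¹) x' := by
      have := ((hasDerivAt_id x').const_sub y).div_const σ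
      exact this.congr_deriv (by rw [neg_div, one_div])
    have := (((hd ((y - x') / σ)).comp x' h1).const_mul (h y)).const_mul σ⁻¹
    exact this.congr_deriv (by ring)

/-- Differentiation of the heat averages in `σ`. -/
theorem hasDerivAt_average_scale (hh : Continuous h) (hM : ∀ x, |h x| ≤ M) (x : ℝ) {σ : ℝ}
    (hσ : 0 < σ) :
    HasDerivAt (fun σ => average heatKernel h x σ) (2 / σ * average heatKernel₂ h x σ) σ := by
  have hM0 : 0 ≤ M := (abs_nonneg _).trans (hM 0)
  have key := (hasDerivAt_integral_of_dominated_loc_of_deriv_le (μ := volume)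
    (F := fun r y => r⁻¹ * (h y * heatKernel ((y - x) / r)))
    (F' := fun r y => 2 / r * (r⁻¹ * (h y * heatKernel₂ ((y - x) / r)))) (x₀ := σ)
    -- Worst case over `σ/2 < r < 2σ`: the prefactors at `σ/2`, the decay at `2σ`.
    (bound := fun y => 4 / σ * (2 / σ * (M * (Real.exp 9 *
      Real.exp (-|(y - x) / (2 * σ)|)))))
    (Ioo_mem_nhds (show σ / 2 < σ by linarith) (show σ < 2 * σ by linarith))
    (Filter.Eventually.of_forall fun r =>
      (by fun_prop : Continuous fun y => r⁻¹ * (h y * heatKernel ((y - x) / r))).aestronglyMeasurable)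
    ?_ (by fun_prop : Continuous _).aestronglyMeasurable
    (ae_of_all _ fun y r hr => ?_) ?_ (ae_of_all _ fun y r hr => ?_)).2
  · rw [average_eq _ h _ hσ, ← integral_const_mul]
    refine key.congr_of_eventuallyEq ?_
    filter_upwards [Ioi_mem_nhds hσ] with r hr
    exact average_eq _ h _ hr
  · refine Integrable.const_mul ((((expDecay_heatKernel.integrable
      continuous_heatKernel).comp_div hσ.ne').comp_sub_right x).bdd_mul
      (c := M) hh.aestronglyMeasurable (ae_of_all _ hM)) _
  · have hr0 : 0 < r := by linarith [hr.1]
    rw [norm_mul, norm_mul, norm_mul, Real.norm_of_nonneg (show 0 ≤ 2 / r by positivity),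
      Real.norm_of_nonneg (inv_pos.2 hr0).le, Real.norm_eq_abs, Real.norm_eq_abs]
    have h1 : 2 / r ≤ 4 / σ := by
      rw [div_le_div_iff₀ hr0 hσ]
      linarith [hr.1]
    have h2 : r⁻¹ ≤ 2 / σ := by
      rw [inv_eq_one_div, div_le_div_iff₀ hr0 hσ]
      linarith [hr.1]
    have h3 : |heatKernel₂ ((y - x) / r)| ≤ Real.exp 9 * Real.exp (-|(y - x) / (2 * σ)|) := by
      refine (expDecay_heatKernel₂ _).trans ?_
      gcongr 3
      rw [abs_div, abs_div, abs_of_pos hr0, abs_of_pos (by positivity : 0 < 2 * σ)]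
      gcongr
      exact hr.2.le
    refine mul_le_mul h1 (mul_le_mul h2 (mul_le_mul (hM y) h3 (abs_nonneg _) hM0)
      (by positivity) (by positivity)) (by positivity) (by positivity)
  · exact (((integrable_kernel_rescaled x (by positivity : 2 * σ ≠ 0)).const_mul _).const_mul _
      |>.const_mul _ |>.const_mul _)
  · have hr0 : 0 < r := by linarith [hr.1]
    have h1 : HasDerivAt (fun r => (y - x) / r) (-(y - x) / r ^ 2) r := by
      have := (hasDerivAt_const r (y - x)).div (hasDerivAt_id r) hr0.ne'
      exact this.congr_deriv (by simp)
    have := (hasDerivAt_inv hr0.ne').mul (((hasDerivAt_heatKernel ((y - x) / r)).comp r h1).const_mul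
      (h y))
    refine this.congr_deriv ?_
    simp only [heatKernel₁, heatKernel₂, Function.comp_apply]
    field_simp
    ring

/-- The heat averages solve the heat equation. -/
theorem hasDerivAt_average_time (hh : Continuous h) (hM : ∀ x, |h x| ≤ M) (x : ℝ) {τ : ℝ}
    (hτ : 0 < τ) :
    HasDerivAt (fun τ => average heatKernel h x √τ) (τ⁻¹ * average heatKernel₂ h x √τ) τ := by
  have h1 := (hasDerivAt_average_scale hh hM x (Real.sqrt_pos.2 hτ)).comp τ
    (Real.hasDerivAt_sqrt hτ.ne')
  refine h1.congr_deriv ?_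
  have h2 : τ⁻¹ = (√τ)⁻¹ * (√τ)⁻¹ := by rw [← mul_inv, Real.mul_self_sqrt hτ.le]
  have h3 := (Real.sqrt_pos.2 hτ).ne'
  rw [h2]
  field_simp

/-- Odd symmetry about a point makes the heat averages vanish there. -/
theorem average_heatKernel_eq_zero {x : ℝ} (hodd : ∀ y, h (x - y) = -h (x + y)) (σ : ℝ) :
    average heatKernel h x σ = 0 := by
  have h1 := integral_neg_eq_self (μ := volume) (fun z => h (x + σ * z) * heatKernel z)
  have h2 : ∀ z, h (x + σ * -z) * heatKernel (-z) = -(h (x + σ * z) * heatKernel z) := fun z => by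
    rw [heatKernel_neg, mul_neg, ← sub_eq_add_neg, hodd]
    ring
  simp only [h2, integral_neg] at h1
  rw [average]
  linarith

/-- Joint continuity of the averages. -/
theorem continuous_average (hφ : ExpDecay φ) (hφc : Continuous φ) {g : ℝ → ℝ → ℝ}
    (hg : Continuous fun p : ℝ × ℝ => g p.1 p.2) (hM : ∀ x s, |g x s| ≤ M) :
    Continuous fun p : ℝ × ℝ × ℝ => average φ (fun x => g x p.2.2) p.1 p.2.1 := by
  have hM0 : 0 ≤ M := (abs_nonneg _).trans (hM 0 0)
  -- Before the substitution the majorant does not depend on `σ`, so continuity includes `σ = 0`,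
  -- where the initial value is attained.
  refine continuous_of_dominated (bound := fun z => M * (Real.exp 9 * Real.exp (-|z|)))
    (fun p => ?_) (fun p => ae_of_all _ fun z => ?_)
    ((integrable_exp_neg_abs.const_mul _).const_mul _) (ae_of_all _ fun z => ?_)
  · exact ((hg.comp (by fun_prop : Continuous fun z => (p.1 + p.2.1 * z, p.2.2))).mul
      hφc).aestronglyMeasurable
  · rw [norm_mul, Real.norm_eq_abs, Real.norm_eq_abs]
    gcongr
    · exact hM _ _
    · exact hφ z
  · exact (hg.comp (by fun_prop : Continuous fun p : ℝ × ℝ × ℝ =>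
      (p.1 + p.2.1 * z, p.2.2))).mul continuous_const

end HeatKernel

end

end TravellingWave

namespace TravellingWave

open MeasureTheory
open scoped NNReal Topology

noncomputable section

/-! ### Duhamel integrals with square root singularities -/

section Duhamel

/-- The weight that bounds the integrands below. -/
def singularWeight (τ : ℝ) : ℝ := 1 + (√τ)⁻¹

theorem singularWeight_nonneg (τ : ℝ) : 0 ≤ singularWeight τ := by
  unfold singularWeight
  positivity

theorem intervalIntegrable_inv_sqrt (a b : ℝ) (ha : 0 ≤ a) (hb : 0 ≤ b) :
    IntervalIntegrable (fun r => (√r)⁻¹) volume a b := by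
  refine (intervalIntegral.intervalIntegrable_rpow' (r := -(1 / 2)) (by norm_num)).congr ?_
  refine fun r hr => ?_
  have : 0 ≤ r := (le_min ha hb).trans hr.1.le
  simp only [Real.sqrt_eq_rpow, Real.rpow_neg this]

theorem integrableOn_singularWeight {t : ℝ} (ht : 0 ≤ t) :
    IntegrableOn singularWeight (Ioc 0 t) := by
  rw [← intervalIntegrable_iff_integrableOn_Ioc_of_le ht]
  exact intervalIntegrable_const.add (intervalIntegrable_inv_sqrt 0 t le_rfl ht)

/-- The integrable majorant on `(0,1)` used for the Duhamel integrals. -/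
def duhamelMajorant (A r : ℝ) : ℝ := (A + (√(1 - r))⁻¹) * (A + (√r)⁻¹)

theorem intervalIntegrable_duhamelMajorant (A : ℝ) :
    IntervalIntegrable (duhamelMajorant A) volume 0 1 := by
  have h1 := intervalIntegrable_inv_sqrt 0 1 le_rfl zero_le_one
  have h2 : IntervalIntegrable (fun r => (√(1 - r))⁻¹) volume 0 1 := by
    have := (h1.comp_sub_left 1).symm
    simpa using this
  have h3 : IntervalIntegrable (fun r => (√(1 - r))⁻¹ * (√r)⁻¹) volume 0 1 := by
    refine (h2.add h1).mono_fun
      (by fun_prop : Measurable fun r => (√(1 - r))⁻¹ * (√r)⁻¹).aestronglyMeasurable ?_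
    rw [uIoc_of_le zero_le_one]
    filter_upwards [ae_restrict_mem measurableSet_Ioc] with r hr
    rw [Real.norm_of_nonneg (by positivity), Real.norm_of_nonneg (by positivity)]
    rcases hr.2.eq_or_lt with rfl | hr1
    · simp
    have hq : 0 < √r := Real.sqrt_pos.2 hr.1
    have hp : 0 < √(1 - r) := Real.sqrt_pos.2 (by linarith)
    -- This bounds the product of the two singularities by their sum, which is integrable.
    have hpq : 1 ≤ √r + √(1 - r) := by
      have e1 := Real.sq_sqrt hr.1.le
      have e2 := Real.sq_sqrt (show 0 ≤ 1 - r by linarith)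
      nlinarith [mul_pos hp hq]
    have e : (√(1 - r))⁻¹ + (√r)⁻¹ = (√r + √(1 - r)) * ((√(1 - r))⁻¹ * (√r)⁻¹) := by
      field_simp
    rw [e]
    exact le_mul_of_one_le_left (by positivity) hpq
  have h4 := ((intervalIntegrable_const (c := A * A)).add ((h1.add h2).const_mul A)).add h3
  refine h4.congr fun r _ => ?_
  simp only [duhamelMajorant]
  ring

/-- Writing `t = √t * √t` absorbs the scaling of both singularities. The result increases with `t`,
so one majorant serves all times in a bounded interval. -/
theorem mul_singularWeight_eq {t r : ℝ} (ht : 0 < t) (hr : r ∈ Ioo (0 : ℝ) 1) :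
    t * (singularWeight (t * (1 - r)) * singularWeight (t * r)) = duhamelMajorant (√t) r := by
  have h1 : 0 < √t := Real.sqrt_pos.2 ht
  have h2 : 0 < √r := Real.sqrt_pos.2 hr.1
  have h3 : 0 < √(1 - r) := Real.sqrt_pos.2 (by linarith [hr.2])
  have h4 := Real.mul_self_sqrt ht.le
  rw [singularWeight, singularWeight, duhamelMajorant, Real.sqrt_mul ht.le, Real.sqrt_mul ht.le]
  conv_lhs => enter [1]; rw [← h4]
  field_simp

theorem duhamelMajorant_mono {A B : ℝ} (hA : 0 ≤ A) (hAB : A ≤ B) (r : ℝ) :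
    duhamelMajorant A r ≤ duhamelMajorant B r := by
  unfold duhamelMajorant
  have hB : 0 ≤ B := hA.trans hAB
  gcongr

theorem ae_mem_Ioo_of_mem_uIoc : ∀ᵐ r : ℝ, r ∈ Set.uIoc 0 1 → r ∈ Ioo (0 : ℝ) 1 := by
  have : ∀ᵐ r : ℝ, r ≠ 1 := by simp [ae_iff]
  filter_upwards [this] with r hr hmem
  rw [uIoc_of_le zero_le_one] at hmem
  exact ⟨hmem.1, lt_of_le_of_ne hmem.2 hr⟩

/-- The Duhamel integral `∫₀ᵗ F(x, t - s, s) ds`, rescaled to the unit interval. -/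
def duhamel (F : ℝ → ℝ → ℝ → ℝ) (x t : ℝ) : ℝ := ∫ r in (0 : ℝ)..1, t * F x (t * (1 - r)) (t * r)

/-- Integrands that are continuous off the singular end points, with square root singularities. -/
structure IsDuhamelKernel (F : ℝ → ℝ → ℝ → ℝ) (C : ℝ) : Prop where
  continuousOn : ContinuousOn (fun p : ℝ × ℝ × ℝ => F p.1 p.2.1 p.2.2)
    (univ ×ˢ Ioi (0 : ℝ) ×ˢ Ioi (0 : ℝ))
  bound : ∀ x, ∀ τ > 0, ∀ s > 0, |F x τ s| ≤ C * (singularWeight τ * singularWeight s)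

namespace IsDuhamelKernel

variable {F F₁ : ℝ → ℝ → ℝ → ℝ} {C C₁ : ℝ}

theorem continuousAt (h : IsDuhamelKernel F C) {x τ s : ℝ} (hτ : 0 < τ) (hs : 0 < s) :
    ContinuousAt (fun p : ℝ × ℝ × ℝ => F p.1 p.2.1 p.2.2) (x, τ, s) :=
  h.continuousOn.continuousAt (prod_mem_nhds Filter.univ_mem
    (prod_mem_nhds (Ioi_mem_nhds hτ) (Ioi_mem_nhds hs)))

theorem nonneg (h : IsDuhamelKernel F C) : 0 ≤ C := by
  have := (abs_nonneg _).trans (h.bound 0 1 one_pos 1 one_pos)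
  simp only [singularWeight, Real.sqrt_one, inv_one] at this
  linarith

theorem aestronglyMeasurable (h : IsDuhamelKernel F C) (x : ℝ) {t : ℝ} (ht : 0 < t) :
    AEStronglyMeasurable (fun r => t * F x (t * (1 - r)) (t * r))
      (volume.restrict (Set.uIoc 0 1)) := by
  rw [uIoc_of_le zero_le_one, ← restrict_Ioo_eq_restrict_Ioc]
  refine ContinuousOn.aestronglyMeasurable (fun r hr => ?_) measurableSet_Ioo
  refine ContinuousAt.continuousWithinAt ?_
  exact continuousAt_const.mul (ContinuousAt.comp (f := fun r => (x, t * (1 - r), t * r))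
    (h.continuousAt (mul_pos ht (by linarith [hr.2])) (mul_pos ht hr.1)) (by fun_prop))

theorem norm_le (h : IsDuhamelKernel F C) (x : ℝ) {t A : ℝ} (ht : 0 < t) (hA : √t ≤ A) {r : ℝ}
    (hr : r ∈ Ioo (0 : ℝ) 1) :
    ‖t * F x (t * (1 - r)) (t * r)‖ ≤ C * duhamelMajorant A r := by
  rw [norm_mul, Real.norm_of_nonneg ht.le]
  calc _ ≤ t * (C * (singularWeight (t * (1 - r)) * singularWeight (t * r))) := by
        gcongr
        exact h.bound x _ (mul_pos ht (by linarith [hr.2])) _ (mul_pos ht hr.1)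
    _ = C * duhamelMajorant (√t) r := by rw [← mul_singularWeight_eq ht hr]; ring
    _ ≤ _ := mul_le_mul_of_nonneg_left (duhamelMajorant_mono (Real.sqrt_nonneg _) hA r) h.nonneg

theorem intervalIntegrable (h : IsDuhamelKernel F C) (x : ℝ) {t : ℝ} (ht : 0 < t) :
    IntervalIntegrable (fun r => t * F x (t * (1 - r)) (t * r)) volume 0 1 := by
  refine ((intervalIntegrable_duhamelMajorant (√t)).const_mul C).mono_fun'
    (h.aestronglyMeasurable x ht) ?_
  rw [Filter.EventuallyLE, ae_restrict_iff' measurableSet_uIoc]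
  filter_upwards [ae_mem_Ioo_of_mem_uIoc] with r hr hmem
  exact h.norm_le x ht le_rfl (hr hmem)

theorem continuousOn_duhamel (h : IsDuhamelKernel F C) :
    ContinuousOn (fun p : ℝ × ℝ => duhamel F p.1 p.2) (univ ×ˢ Ioi 0) := by
  rintro ⟨x, t⟩ ⟨-, ht⟩
  refine ContinuousAt.continuousWithinAt ?_
  simp only [mem_Ioi] at ht
  have hev : ∀ᶠ p : ℝ × ℝ in 𝓝 (x, t), 0 < p.2 ∧ p.2 < 2 * t :=
    (continuous_snd.tendsto (x, t)).eventually
      (Ioo_mem_nhds ht (show t < 2 * t by linarith))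
  refine intervalIntegral.continuousAt_of_dominated_interval
    (bound := fun r => C * duhamelMajorant (√(2 * t)) r) ?_ ?_
    ((intervalIntegrable_duhamelMajorant _).const_mul C) ?_
  · filter_upwards [hev] with p hp
    exact h.aestronglyMeasurable p.1 hp.1
  · filter_upwards [hev] with p hp
    filter_upwards [ae_mem_Ioo_of_mem_uIoc] with r hr hmem
    exact h.norm_le p.1 hp.1 (Real.sqrt_le_sqrt hp.2.le) (hr hmem)
  · filter_upwards [ae_mem_Ioo_of_mem_uIoc] with r hr hmem
    have hr' := hr hmem
    exact continuousAt_snd.mul (ContinuousAt.comp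
      (f := fun p : ℝ × ℝ => (p.1, p.2 * (1 - r), p.2 * r)) (x := (x, t))
      (h.continuousAt (mul_pos ht (by linarith [hr'.2])) (mul_pos ht hr'.1)) (by fun_prop))

theorem hasDerivAt_duhamel (h : IsDuhamelKernel F C) (h₁ : IsDuhamelKernel F₁ C₁)
    (hd : ∀ x, ∀ τ > 0, ∀ s > 0, HasDerivAt (fun x => F x τ s) (F₁ x τ s) x) (x : ℝ) {t : ℝ}
    (ht : 0 < t) : HasDerivAt (fun x => duhamel F x t) (duhamel F₁ x t) x := by
  refine (intervalIntegral.hasDerivAt_integral_of_dominated_loc_of_deriv_le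
    (F' := fun x r => t * F₁ x (t * (1 - r)) (t * r))
    (bound := fun r => C₁ * duhamelMajorant (√t) r) Filter.univ_mem
    (Filter.Eventually.of_forall fun y => h.aestronglyMeasurable y ht) (h.intervalIntegrable x ht)
    (h₁.aestronglyMeasurable x ht) ?_ ((intervalIntegrable_duhamelMajorant _).const_mul C₁) ?_).2
  · filter_upwards [ae_mem_Ioo_of_mem_uIoc] with r hr hmem y _
    exact h₁.norm_le y ht le_rfl (hr hmem)
  · filter_upwards [ae_mem_Ioo_of_mem_uIoc] with r hr hmem y _
    have hr' := hr hmem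
    exact (hd y _ (mul_pos ht (by linarith [hr'.2])) _ (mul_pos ht hr'.1)).const_mul t

theorem duhamel_sub (h : IsDuhamelKernel F C) (h₁ : IsDuhamelKernel F₁ C₁) (k x : ℝ) {t : ℝ}
    (ht : 0 < t) : duhamel (fun x τ s => F x τ s - k * F₁ x τ s) x t =
      duhamel F x t - k * duhamel F₁ x t := by
  rw [duhamel, duhamel, duhamel, ← intervalIntegral.integral_const_mul,
    ← intervalIntegral.integral_sub (h.intervalIntegrable x ht)
      ((h₁.intervalIntegrable x ht).const_mul k)]
  congr 1
  ext r
  ring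

theorem sub_const_mul (h : IsDuhamelKernel F C) (h₁ : IsDuhamelKernel F₁ C₁) (k : ℝ) :
    IsDuhamelKernel (fun x τ s => F x τ s - k * F₁ x τ s) (C + |k| * C₁) := by
  refine ⟨h.continuousOn.sub (continuousOn_const.mul h₁.continuousOn), fun x τ hτ s hs => ?_⟩
  calc |F x τ s - k * F₁ x τ s| ≤ |F x τ s| + |k| * |F₁ x τ s| := by
        rw [← abs_mul]; exact abs_sub _ _
    _ ≤ C * (singularWeight τ * singularWeight s) +
        |k| * (C₁ * (singularWeight τ * singularWeight s)) := by
        gcongr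
        · exact h.bound x τ hτ s hs
        · exact h₁.bound x τ hτ s hs
    _ = _ := by ring

end IsDuhamelKernel

theorem duhamel_eq_integral (F : ℝ → ℝ → ℝ → ℝ) (x : ℝ) {t : ℝ} (ht : 0 < t) :
    duhamel F x t = ∫ s in (0 : ℝ)..t, F x (t - s) s := by
  have := intervalIntegral.integral_comp_mul_left (a := 0) (b := 1) (fun s => F x (t - s) s) ht.ne'
  rw [duhamel, intervalIntegral.integral_const_mul]
  have h1 : ∀ r, t * (1 - r) = t - t * r := fun r => by ring
  simp only [h1, this, mul_zero, mul_one, smul_eq_mul, mul_inv_cancel_left₀ ht.ne']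

/-- Differentiation of the Duhamel integral in time. -/
theorem IsDuhamelKernel.hasDerivAt_duhamel_time {F D : ℝ → ℝ → ℝ → ℝ} {C C' : ℝ}
    (hF : IsDuhamelKernel F C) (hD : IsDuhamelKernel D C') {g : ℝ → ℝ} (hg : Continuous g) (x : ℝ)
    (h0 : ∀ s, F x 0 s = g s) (hc : ∀ s > 0, ContinuousOn (fun τ => F x τ s) (Ici 0))
    (hd : ∀ τ > 0, ∀ s > 0, HasDerivAt (fun τ => F x τ s) (D x τ s) τ) {t : ℝ} (ht : 0 < t) :
    HasDerivAt (fun t => duhamel F x t) (g t + duhamel D x t) t := by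
  have hC' := hD.nonneg
  have hDc : ∀ s > 0, ContinuousOn (fun τ => D x τ s) (Ioi 0) := fun s hs τ hτ =>
    (ContinuousAt.comp (f := fun τ => (x, τ, s)) (hD.continuousAt hτ hs)
      (by fun_prop)).continuousWithinAt
  -- The moving, singular end point is not differentiated directly: `D(x, r - s, s)` is integrated
  -- over the triangle `0 < s < r < T` by Fubini. It is dominated by the integrand of a convolution
  -- of two integrable weights.
  have hint : ∀ T, 0 < T → Integrable (Function.uncurry fun r s =>
      indicator {p : ℝ × ℝ | 0 < p.2 ∧ p.2 < p.1 ∧ p.1 < T} (fun p => D x (p.1 - p.2) p.2) (r, s))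
      (volume.prod volume) := by
    intro T hT
    have hu := (integrable_indicator_iff measurableSet_Ioc).2 (integrableOn_singularWeight hT.le)
    have hconv := (hu.convolution_integrand (ContinuousLinearMap.mul ℝ ℝ) hu).const_mul C'
    have hop : IsOpen {p : ℝ × ℝ | 0 < p.2 ∧ p.2 < p.1 ∧ p.1 < T} :=
      (isOpen_lt continuous_const continuous_snd).inter
        ((isOpen_lt continuous_snd continuous_fst).inter
          (isOpen_lt continuous_fst continuous_const))
    refine hconv.mono' ?_ (ae_of_all _ ?_)
    · refine (aestronglyMeasurable_indicator_iff hop.measurableSet).2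
        (ContinuousOn.aestronglyMeasurable (fun p hp => ?_) hop.measurableSet)
      refine ContinuousAt.continuousWithinAt ?_
      exact ContinuousAt.comp (f := fun p : ℝ × ℝ => (x, p.1 - p.2, p.2))
        (hD.continuousAt (sub_pos.2 hp.2.1) hp.1) (by fun_prop)
    · rintro ⟨r, s⟩
      have hnn : ∀ τ, 0 ≤ indicator (Ioc 0 T) singularWeight τ := fun τ =>
        indicator_nonneg (fun τ _ => singularWeight_nonneg τ) τ
      by_cases hp : (r, s) ∈ {p : ℝ × ℝ | 0 < p.2 ∧ p.2 < p.1 ∧ p.1 < T}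
      · simp only [Function.uncurry_apply_pair, indicator_of_mem hp]
        obtain ⟨h1, h2, h3⟩ := hp
        simp only at h1 h2 h3
        rw [indicator_of_mem (show s ∈ Ioc 0 T from ⟨h1, by linarith⟩),
          indicator_of_mem (show r - s ∈ Ioc 0 T from ⟨by linarith, by linarith⟩)]
        refine (hD.bound x _ (sub_pos.2 h2) s h1).trans (le_of_eq ?_)
        simp only [ContinuousLinearMap.mul_apply']
        ring
      · simp only [Function.uncurry_apply_pair, indicator_of_notMem hp, norm_zero,
          ContinuousLinearMap.mul_apply']
        exact mul_nonneg hC' (mul_nonneg (hnn _) (hnn _))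
  have hrow : ∀ T r, r ∈ Ioo 0 T → ∫ s, indicator {p : ℝ × ℝ | 0 < p.2 ∧ p.2 < p.1 ∧ p.1 < T}
      (fun p => D x (p.1 - p.2) p.2) (r, s) = duhamel D x r := by
    intro T r hr
    rw [duhamel_eq_integral D x hr.1, intervalIntegral.integral_of_le hr.1.le,
      integral_Ioc_eq_integral_Ioo, ← integral_indicator measurableSet_Ioo]
    congr 1
    ext s
    by_cases hs : s ∈ Ioo 0 r
    · rw [indicator_of_mem hs, indicator_of_mem]
      exact ⟨hs.1, hs.2, hr.2⟩
    · rw [indicator_of_notMem hs, indicator_of_notMem]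
      exact fun h => hs ⟨h.1, h.2.1⟩
  -- For fixed `s`, the fundamental theorem in `τ = r - s` starts from the value `g s` at `τ = 0`.
  have hcol : ∀ T s, s ∈ Ioo 0 T → ∫ r, indicator {p : ℝ × ℝ | 0 < p.2 ∧ p.2 < p.1 ∧ p.1 < T}
      (fun p => D x (p.1 - p.2) p.2) (r, s) = F x (T - s) s - g s := by
    intro T s hs
    have h1 : ∫ τ in (0 : ℝ)..(T - s), D x τ s = F x (T - s) s - g s := by
      rw [← h0 s]
      refine intervalIntegral.integral_eq_sub_of_hasDerivAt_of_le (by linarith [hs.2])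
        ((hc s hs.1).mono Icc_subset_Ici_self) (fun τ hτ => hd τ hτ.1 s hs.1) ?_
      rw [intervalIntegrable_iff_integrableOn_Ioc_of_le (by linarith [hs.2])]
      refine ((integrableOn_singularWeight (t := T - s) (by linarith [hs.2])).const_mul
        (C' * singularWeight s)).mono' (((hDc s hs.1).mono
          Ioc_subset_Ioi_self).aestronglyMeasurable measurableSet_Ioc) ?_
      filter_upwards [ae_restrict_mem measurableSet_Ioc] with τ hτ
      refine (hD.bound x τ hτ.1 s hs.1).trans (le_of_eq ?_)
      ring
    have h2 := intervalIntegral.integral_comp_sub_right (a := s) (b := T) (fun τ => D x τ s) s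
    rw [sub_self] at h2
    rw [← h1, ← h2, intervalIntegral.integral_of_le hs.2.le, integral_Ioc_eq_integral_Ioo,
      ← integral_indicator measurableSet_Ioo]
    congr 1
    ext r
    by_cases hr : r ∈ Ioo s T
    · rw [indicator_of_mem hr, indicator_of_mem]
      exact ⟨hs.1, hr.1, hr.2⟩
    · rw [indicator_of_notMem hr, indicator_of_notMem]
      exact fun h => hr ⟨h.2.1, h.2.2⟩
  have hDint : ∀ T, 0 < T → IntegrableOn (fun r => duhamel D x r) (Ioo 0 T) := by
    intro T hT
    refine ((hint T hT).integral_prod_left.integrableOn (s := Ioo 0 T)).congr_fun ?_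
      measurableSet_Ioo
    intro r hr
    exact hrow T r hr
  -- Comparing rows and columns displays the Duhamel integral as a primitive of a function that is
  -- continuous for positive times.
  have hrep : ∀ T, 0 < T → duhamel F x T = ∫ r in (0 : ℝ)..T, (g r + duhamel D x r) := by
    intro T hT
    have hswap := integral_integral_swap (hint T hT)
    have hL : ∫ r, ∫ s, indicator {p : ℝ × ℝ | 0 < p.2 ∧ p.2 < p.1 ∧ p.1 < T}
        (fun p => D x (p.1 - p.2) p.2) (r, s) = ∫ r in (0 : ℝ)..T, duhamel D x r := by
      rw [intervalIntegral.integral_of_le hT.le, integral_Ioc_eq_integral_Ioo,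
        ← integral_indicator measurableSet_Ioo]
      congr 1
      ext r
      by_cases hr : r ∈ Ioo 0 T
      · rw [indicator_of_mem hr, hrow T r hr]
      · rw [indicator_of_notMem hr]
        refine integral_eq_zero_of_ae (ae_of_all _ fun s => indicator_of_notMem ?_ _)
        exact fun h => hr ⟨h.1.trans h.2.1, h.2.2⟩
    have hR : ∫ s, ∫ r, indicator {p : ℝ × ℝ | 0 < p.2 ∧ p.2 < p.1 ∧ p.1 < T}
        (fun p => D x (p.1 - p.2) p.2) (r, s) = ∫ s in (0 : ℝ)..T, (F x (T - s) s - g s) := by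
      rw [intervalIntegral.integral_of_le hT.le, integral_Ioc_eq_integral_Ioo,
        ← integral_indicator measurableSet_Ioo]
      congr 1
      ext s
      by_cases hs : s ∈ Ioo 0 T
      · rw [indicator_of_mem hs, hcol T s hs]
      · rw [indicator_of_notMem hs]
        refine integral_eq_zero_of_ae (ae_of_all _ fun r => indicator_of_notMem ?_ _)
        exact fun h => hs ⟨h.1, h.2.1.trans h.2.2⟩
    have hFint : IntervalIntegrable (fun s => F x (T - s) s) volume 0 T := by
      have h1 := ((IntervalIntegrable.comp_mul_left (c := T⁻¹) (hF.intervalIntegrable x hT)).const_mul T⁻¹)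
      simp only [zero_div, one_div, inv_inv] at h1
      refine h1.congr fun s _ => ?_
      have e1 : T * (1 - T⁻¹ * s) = T - s := by field_simp
      have e2 : T * (T⁻¹ * s) = s := by field_simp
      simp only [e1, e2, inv_mul_cancel_left₀ hT.ne']
    rw [hL, hR, intervalIntegral.integral_sub hFint (hg.intervalIntegrable _ _)] at hswap
    rw [intervalIntegral.integral_add (hg.intervalIntegrable _ _), hswap,
      duhamel_eq_integral F x hT]
    · ring
    · rw [intervalIntegrable_iff_integrableOn_Ioo_of_le hT.le]
      exact hDint T hT
  have hcont : ContinuousOn (fun r => g r + duhamel D x r) (Ioi 0) :=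
    hg.continuousOn.add (hD.continuousOn_duhamel.comp (f := fun r => (x, r)) (by fun_prop)
      fun r hr => ⟨trivial, hr⟩)
  have hii : IntervalIntegrable (fun r => g r + duhamel D x r) volume 0 t := by
    refine (hg.intervalIntegrable _ _).add ?_
    rw [intervalIntegrable_iff_integrableOn_Ioo_of_le ht.le]
    exact hDint t ht
  have := intervalIntegral.integral_hasDerivAt_right hii
    (hcont.stronglyMeasurableAtFilter isOpen_Ioi t ht) (hcont.continuousAt (Ioi_mem_nhds ht))
  refine this.congr_of_eventuallyEq ?_
  filter_upwards [Ioi_mem_nhds ht] with T hT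
  exact hrep T hT

end Duhamel

end

end TravellingWave

namespace TravellingWave

open MeasureTheory
open scoped NNReal Topology

noncomputable section

/-! ### Odd reflection about both end points -/

section Reflection

/-- The angle variable in which `[a,b]` becomes `[0,π]`. -/
def foldAngle (a b x : ℝ) : ℝ := Real.pi * (x - a) / (b - a)

/-- The retraction of the line onto `[a,b]` by repeated reflection at the end points. -/
def fold (a b x : ℝ) : ℝ := a + (b - a) / Real.pi * Real.arccos (Real.cos (foldAngle a b x))

/-- The extension of a function on `[a,b]` that is odd about both end points. -/
def oddExt (a b : ℝ) (h : ℝ → ℝ) (x : ℝ) : ℝ :=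
  if 0 ≤ Real.sin (foldAngle a b x) then h (fold a b x) else -h (fold a b x)

/-- With `A`, `B` the folded angles, `cos (A - B) = cos x cos y + |sin x sin y| ≥ cos (x - y)`,
while the cosine decreases on `[0,π]`. -/
theorem abs_arccos_cos_sub_le (x y : ℝ) :
    |Real.arccos (Real.cos x) - Real.arccos (Real.cos y)| ≤ |x - y| := by
  set A := Real.arccos (Real.cos x)
  set B := Real.arccos (Real.cos y)
  have hA : A ∈ Icc 0 Real.pi := ⟨Real.arccos_nonneg _, Real.arccos_le_pi _⟩
  have hB : B ∈ Icc 0 Real.pi := ⟨Real.arccos_nonneg _, Real.arccos_le_pi _⟩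
  have hAB : |A - B| ≤ Real.pi := abs_le.2 ⟨by linarith [hA.1, hB.2], by linarith [hA.2, hB.1]⟩
  by_contra! hlt
  have h1 : Real.cos |A - B| < Real.cos |x - y| :=
    Real.cos_lt_cos_of_nonneg_of_le_pi (abs_nonneg _) hAB hlt
  rw [Real.cos_abs, Real.cos_abs, Real.cos_sub, Real.cos_sub] at h1
  have hsin : ∀ z, Real.sin (Real.arccos (Real.cos z)) = |Real.sin z| := fun z => by
    rw [Real.sin_arccos, Real.abs_sin_eq_sqrt_one_sub_cos_sq]
  have hcos : ∀ z, Real.cos (Real.arccos (Real.cos z)) = Real.cos z := fun z =>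
    Real.cos_arccos (Real.neg_one_le_cos z) (Real.cos_le_one z)
  rw [hsin, hsin, hcos, hcos, ← abs_mul] at h1
  linarith [le_abs_self (Real.sin x * Real.sin y)]

variable {a b : ℝ}

theorem fold_mem (hab : a < b) (x : ℝ) : fold a b x ∈ Icc a b := by
  have h1 := Real.arccos_nonneg (Real.cos (foldAngle a b x))
  have h2 := Real.arccos_le_pi (Real.cos (foldAngle a b x))
  have h3 : 0 < b - a := sub_pos.2 hab
  have h4 := Real.pi_pos
  constructor
  · have : 0 ≤ (b - a) / Real.pi * Real.arccos (Real.cos (foldAngle a b x)) := by positivity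
    unfold fold
    linarith
  · have : (b - a) / Real.pi * Real.arccos (Real.cos (foldAngle a b x)) ≤
        (b - a) / Real.pi * Real.pi := by gcongr
    rw [div_mul_cancel₀ _ h4.ne'] at this
    unfold fold
    linarith

theorem foldAngle_mem (hab : a < b) {x : ℝ} (hx : x ∈ Icc a b) :
    foldAngle a b x ∈ Icc 0 Real.pi := by
  have h3 : 0 < b - a := sub_pos.2 hab
  have h4 := Real.pi_pos
  constructor
  · exact div_nonneg (mul_nonneg h4.le (by linarith [hx.1])) h3.le
  · rw [foldAngle, div_le_iff₀ h3]
    gcongr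
    exact hx.2

theorem fold_of_mem (hab : a < b) {x : ℝ} (hx : x ∈ Icc a b) : fold a b x = x := by
  have h := foldAngle_mem hab hx
  have h3 : b - a ≠ 0 := (sub_pos.2 hab).ne'
  have h4 := Real.pi_pos.ne'
  rw [fold, Real.arccos_cos h.1 h.2, foldAngle]
  field_simp
  ring

theorem oddExt_of_mem (hab : a < b) (h : ℝ → ℝ) {x : ℝ} (hx : x ∈ Icc a b) :
    oddExt a b h x = h x := by
  have h1 := foldAngle_mem hab hx
  rw [oddExt, if_pos (Real.sin_nonneg_of_nonneg_of_le_pi h1.1 h1.2), fold_of_mem hab hx]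

@[fun_prop]
theorem continuous_foldAngle : Continuous (foldAngle a b) := by unfold foldAngle; fun_prop

@[fun_prop]
theorem continuous_fold : Continuous (fold a b) := by unfold fold; fun_prop

theorem abs_fold_sub_le (hab : a < b) (x y : ℝ) : |fold a b x - fold a b y| ≤ |x - y| := by
  have h3 : 0 < b - a := sub_pos.2 hab
  have h4 := Real.pi_pos
  have h1 := abs_arccos_cos_sub_le (foldAngle a b x) (foldAngle a b y)
  have h2 : foldAngle a b x - foldAngle a b y = Real.pi / (b - a) * (x - y) := by
    unfold foldAngle
    ring
  rw [h2, abs_mul, abs_of_pos (by positivity : 0 < Real.pi / (b - a))] at h1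
  rw [fold, fold, add_sub_add_left_eq_sub, ← mul_sub, abs_mul,
    abs_of_pos (by positivity : 0 < (b - a) / Real.pi)]
  calc _ ≤ (b - a) / Real.pi * (Real.pi / (b - a) * |x - y|) := by gcongr
    _ = _ := by field_simp

theorem fold_eq_of_sin_eq_zero {x : ℝ} (hx : Real.sin (foldAngle a b x) = 0) :
    fold a b x = a ∨ fold a b x = b := by
  rcases Real.sin_eq_zero_iff_cos_eq.1 hx with h | h
  · left
    simp [fold, h]
  · right
    rw [fold, h, Real.arccos_neg_one, div_mul_cancel₀ _ Real.pi_pos.ne']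
    ring

theorem oddExt_of_sin_eq_zero {h : ℝ → ℝ} (ha : h a = 0) (hb : h b = 0) {x : ℝ}
    (hx : Real.sin (foldAngle a b x) = 0) : oddExt a b h x = 0 := by
  rcases fold_eq_of_sin_eq_zero hx with e | e <;> simp [oddExt, e, ha, hb]

theorem oddExt_eq_neg {h : ℝ → ℝ} (ha : h a = 0) (hb : h b = 0) {x y : ℝ}
    (hs : Real.sin (foldAngle a b x) = -Real.sin (foldAngle a b y))
    (hc : Real.cos (foldAngle a b x) = Real.cos (foldAngle a b y)) :
    oddExt a b h x = -oddExt a b h y := by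
  have hf : fold a b x = fold a b y := by rw [fold, fold, hc]
  rcases lt_trichotomy (Real.sin (foldAngle a b y)) 0 with h1 | h1 | h1
  · rw [oddExt, oddExt, if_pos (by linarith), if_neg (not_le.2 h1), hf, neg_neg]
  · rw [oddExt_of_sin_eq_zero ha hb h1, oddExt_of_sin_eq_zero ha hb (by rw [hs, h1, neg_zero]),
      neg_zero]
  · rw [oddExt, oddExt, if_neg (by linarith), if_pos h1.le, hf]

theorem oddExt_reflect_left {h : ℝ → ℝ} (ha : h a = 0) (hb : h b = 0) (y : ℝ) :
    oddExt a b h (a - y) = -oddExt a b h (a + y) := by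
  have : foldAngle a b (a - y) = -foldAngle a b (a + y) := by
    unfold foldAngle
    ring
  exact oddExt_eq_neg ha hb (by rw [this, Real.sin_neg]) (by rw [this, Real.cos_neg])

theorem oddExt_reflect_right (hab : a < b) {h : ℝ → ℝ} (ha : h a = 0) (hb : h b = 0) (y : ℝ) :
    oddExt a b h (b - y) = -oddExt a b h (b + y) := by
  have h3 : b - a ≠ 0 := (sub_pos.2 hab).ne'
  have : foldAngle a b (b - y) = 2 * Real.pi - foldAngle a b (b + y) := by
    unfold foldAngle
    field_simp
    ring
  exact oddExt_eq_neg ha hb (by rw [this, Real.sin_two_pi_sub]) (by rw [this, Real.cos_two_pi_sub])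

theorem abs_oddExt (h : ℝ → ℝ) (x : ℝ) : |oddExt a b h x| = |h (fold a b x)| := by
  unfold oddExt
  split_ifs <;> simp

theorem oddExt_sub (h k : ℝ → ℝ) (x : ℝ) :
    oddExt a b h x - oddExt a b k x = oddExt a b (fun y => h y - k y) x := by
  unfold oddExt
  split_ifs <;> ring

/-- The sign can change only where the fold lands on `a` or `b`, and there `g` vanishes. -/
theorem continuous_oddExt (hab : a < b) {g : ℝ → ℝ → ℝ}
    (hg : ContinuousOn (fun p : ℝ × ℝ => g p.1 p.2) (Icc a b ×ˢ univ)) (ha : ∀ s, g a s = 0)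
    (hb : ∀ s, g b s = 0) :
    Continuous fun p : ℝ × ℝ => oddExt a b (fun y => g y p.2) p.1 := by
  have hc : Continuous fun p : ℝ × ℝ => g (fold a b p.1) p.2 :=
    hg.comp_continuous (f := fun p : ℝ × ℝ => (fold a b p.1, p.2)) (by fun_prop)
      fun p => ⟨fold_mem hab _, trivial⟩
  unfold oddExt
  refine Continuous.if_le hc hc.neg continuous_const (by fun_prop) fun p hp => ?_
  rcases fold_eq_of_sin_eq_zero hp.symm with e | e <;> simp [e, ha, hb]

/-- For equal signs the fold is `1`-Lipschitz. For opposite signs the estimate is split at a zero of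
the sine between the two points, where the extension vanishes. -/
theorem abs_oddExt_sub_le (hab : a < b) {h : ℝ → ℝ} (ha : h a = 0) (hb : h b = 0) {l : ℝ}
    (hl : ∀ x ∈ Icc a b, ∀ y ∈ Icc a b, |h x - h y| ≤ l * |x - y|) (x y : ℝ) :
    |oddExt a b h x - oddExt a b h y| ≤ l * |x - y| := by
  have hl0 : 0 ≤ l := by
    have h1 := (abs_nonneg _).trans (hl a (left_mem_Icc.2 hab.le) b (right_mem_Icc.2 hab.le))
    exact nonneg_of_mul_nonneg_left h1 (abs_pos.2 (sub_ne_zero.2 hab.ne))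
  have same : ∀ x y, |h (fold a b x) - h (fold a b y)| ≤ l * |x - y| := fun x y =>
    (hl _ (fold_mem hab x) _ (fold_mem hab y)).trans
      (mul_le_mul_of_nonneg_left (abs_fold_sub_le hab x y) hl0)
  have opp : ∀ x y, 0 ≤ Real.sin (foldAngle a b x) → Real.sin (foldAngle a b y) < 0 →
      |oddExt a b h x - oddExt a b h y| ≤ l * |x - y| := by
    intro x y hx hy
    have hcont : ContinuousOn (fun z => Real.sin (foldAngle a b z)) (uIcc y x) :=
      (by fun_prop : Continuous fun z => Real.sin (foldAngle a b z)).continuousOn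
    obtain ⟨z, hz, hz0⟩ := intermediate_value_uIcc hcont
      (show (0 : ℝ) ∈ uIcc (Real.sin (foldAngle a b y)) (Real.sin (foldAngle a b x)) by
        rw [uIcc_of_le (hy.le.trans hx)]
        exact ⟨hy.le, hx⟩)
    have hhz : h (fold a b z) = 0 := by
      rcases fold_eq_of_sin_eq_zero hz0 with e | e <;> simp [e, ha, hb]
    have h1 := same x z
    have h2 := same z y
    rw [hhz, sub_zero] at h1
    rw [hhz, zero_sub, abs_neg] at h2
    have h3 : |x - z| + |z - y| = |x - y| := by
      rcases le_total y x with hxy | hxy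
      · rw [uIcc_of_le hxy] at hz
        rw [abs_of_nonneg (by linarith [hz.2]), abs_of_nonneg (by linarith [hz.1]),
          abs_of_nonneg (by linarith)]
        ring
      · rw [uIcc_of_ge hxy] at hz
        rw [abs_of_nonpos (by linarith [hz.1]), abs_of_nonpos (by linarith [hz.2]),
          abs_of_nonpos (by linarith)]
        ring
    calc _ ≤ |oddExt a b h x| + |oddExt a b h y| := abs_sub _ _
      _ ≤ l * |x - z| + l * |z - y| := by rw [abs_oddExt, abs_oddExt]; gcongr
      _ = _ := by rw [← mul_add, h3]
  by_cases hx : 0 ≤ Real.sin (foldAngle a b x) <;> by_cases hy : 0 ≤ Real.sin (foldAngle a b y)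
  · rw [oddExt, oddExt, if_pos hx, if_pos hy]
    exact same x y
  · exact opp x y hx (not_le.1 hy)
  · rw [abs_sub_comm, abs_sub_comm x]
    exact opp y x hy (not_le.1 hx)
  · rw [oddExt, oddExt, if_neg hx, if_neg hy, ← neg_sub_neg, neg_neg, neg_neg, abs_sub_comm,
      abs_sub_comm x]
    simpa [abs_sub_comm] using same x y

end Reflection

/-! ### Mild solutions of the damped linear heat equation -/

section Mild

/-- The damped heat semigroup applied to the source `g(·,s)`, and its first two derivatives. -/
def sourceKernel (l : ℝ) (g : ℝ → ℝ → ℝ) (x τ s : ℝ) : ℝ :=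
  Real.exp (-(l * τ)) * average heatKernel (fun y => g y s) x √τ

/-- The formal space derivative of `sourceKernel`, of the order in the index. -/
def sourceKernel₁ (l : ℝ) (g : ℝ → ℝ → ℝ) (x τ s : ℝ) : ℝ :=
  Real.exp (-(l * τ)) * ((√τ)⁻¹ * average heatKernel₁ (fun y => g y s) x √τ)

/-- The formal space derivative of `sourceKernel`, of the order in the index. -/
def sourceKernel₂ (l : ℝ) (g : ℝ → ℝ → ℝ) (x τ s : ℝ) : ℝ :=
  Real.exp (-(l * τ)) * (τ⁻¹ * average heatKernel₂ (fun y => g y s) x √τ)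

variable {l : ℝ} {g g' : ℝ → ℝ → ℝ} {M : ℝ}

theorem continuous_slice (hg : Continuous fun p : ℝ × ℝ => g p.1 p.2) (s : ℝ) :
    Continuous fun y => g y s :=
  hg.comp (by fun_prop : Continuous fun y : ℝ => (y, s))

theorem hasDerivAt_sourceKernel (hg : Continuous fun p : ℝ × ℝ => g p.1 p.2)
    (hM : ∀ x s, |g x s| ≤ M) (x : ℝ) {τ : ℝ} (hτ : 0 < τ) (s : ℝ) :
    HasDerivAt (fun x => sourceKernel l g x τ s) (sourceKernel₁ l g x τ s) x :=
  (hasDerivAt_average expDecay_heatKernel continuous_heatKernel expDecay_heatKernel₁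
    continuous_heatKernel₁ hasDerivAt_heatKernel
    (continuous_slice hg s) (fun y => hM y s) x
    (Real.sqrt_pos.2 hτ)).const_mul _

theorem hasDerivAt_sourceKernel₁ (hg : Continuous fun p : ℝ × ℝ => g p.1 p.2)
    (hM : ∀ x s, |g x s| ≤ M) (x : ℝ) {τ : ℝ} (hτ : 0 < τ) (s : ℝ) :
    HasDerivAt (fun x => sourceKernel₁ l g x τ s) (sourceKernel₂ l g x τ s) x := by
  have := ((hasDerivAt_average expDecay_heatKernel₁ continuous_heatKernel₁ expDecay_heatKernel₂
    continuous_heatKernel₂ hasDerivAt_heatKernel₁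
    (continuous_slice hg s) (fun y => hM y s) x
    (Real.sqrt_pos.2 hτ)).const_mul (√τ)⁻¹).const_mul (Real.exp (-(l * τ)))
  refine this.congr_deriv ?_
  have h2 : τ⁻¹ = (√τ)⁻¹ * (√τ)⁻¹ := by rw [← mul_inv, Real.mul_self_sqrt hτ.le]
  rw [sourceKernel₂, h2]
  ring

theorem hasDerivAt_sourceKernel_time (hg : Continuous fun p : ℝ × ℝ => g p.1 p.2)
    (hM : ∀ x s, |g x s| ≤ M) (x : ℝ) {τ : ℝ} (hτ : 0 < τ) (s : ℝ) :
    HasDerivAt (fun τ => sourceKernel l g x τ s)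
      (sourceKernel₂ l g x τ s - l * sourceKernel l g x τ s) τ := by
  have h1 := hasDerivAt_average_time
    (continuous_slice hg s) (fun y => hM y s) x hτ
  have h2 := (((hasDerivAt_id τ).const_mul l).neg.exp).mul h1
  refine h2.congr_deriv ?_
  simp only [sourceKernel, sourceKernel₂, Pi.neg_apply, id]
  ring

theorem continuous_sourceKernel (l : ℝ) (hg : Continuous fun p : ℝ × ℝ => g p.1 p.2)
    (hM : ∀ x s, |g x s| ≤ M) :
    Continuous fun p : ℝ × ℝ × ℝ => sourceKernel l g p.1 p.2.1 p.2.2 :=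
  (by fun_prop : Continuous fun p : ℝ × ℝ × ℝ => Real.exp (-(l * p.2.1))).mul
    ((continuous_average expDecay_heatKernel continuous_heatKernel hg hM).comp
      (by fun_prop : Continuous fun p : ℝ × ℝ × ℝ => (p.1, √p.2.1, p.2.2)))

theorem exp_neg_mul_le_one (hl : 0 ≤ l) {τ : ℝ} (hτ : 0 ≤ τ) : Real.exp (-(l * τ)) ≤ 1 :=
  Real.exp_le_one_iff.2 (by have := mul_nonneg hl hτ; linarith)

theorem abs_sourceKernel_le (hM : ∀ x s, |g x s| ≤ M) (x τ s : ℝ) :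
    |sourceKernel l g x τ s| ≤ M * Real.exp (-(l * τ)) := by
  rw [sourceKernel, abs_mul, abs_of_pos (Real.exp_pos _), mul_comm]
  gcongr
  exact abs_average_heatKernel_le (fun y => hM y s) x _

theorem abs_sourceKernel₁_le (hM : ∀ x s, |g x s| ≤ M) (x τ s : ℝ) :
    |sourceKernel₁ l g x τ s| ≤ M * kernelMass * (Real.exp (-(l * τ)) * (√τ)⁻¹) := by
  rw [sourceKernel₁, abs_mul, abs_mul, abs_of_pos (Real.exp_pos _), abs_of_nonneg (by positivity),
    mul_comm (M * kernelMass), mul_assoc]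
  gcongr
  exact abs_average_le expDecay_heatKernel₁ (fun y => hM y s) x _

theorem one_le_singularWeight (τ : ℝ) : 1 ≤ singularWeight τ := by
  unfold singularWeight
  linarith [inv_nonneg.2 (Real.sqrt_nonneg τ)]

theorem inv_sqrt_le_singularWeight (τ : ℝ) : (√τ)⁻¹ ≤ singularWeight τ := by
  unfold singularWeight
  linarith

theorem isDuhamelKernel_sourceKernel (hl : 0 ≤ l) (hg : Continuous fun p : ℝ × ℝ => g p.1 p.2)
    (hM : ∀ x s, |g x s| ≤ M) : IsDuhamelKernel (sourceKernel l g) M := by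
  have hM0 : 0 ≤ M := (abs_nonneg _).trans (hM 0 0)
  refine ⟨(continuous_sourceKernel l hg hM).continuousOn, fun x τ hτ s _ => ?_⟩
  refine (abs_sourceKernel_le hM x τ s).trans ?_
  gcongr
  refine (exp_neg_mul_le_one hl hτ.le).trans ?_
  exact one_le_mul_of_one_le_of_one_le (one_le_singularWeight τ) (one_le_singularWeight s)

theorem isDuhamelKernel_sourceKernel₁ (hl : 0 ≤ l) (hg : Continuous fun p : ℝ × ℝ => g p.1 p.2)
    (hM : ∀ x s, |g x s| ≤ M) : IsDuhamelKernel (sourceKernel₁ l g) (M * kernelMass) := by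
  have hM0 : 0 ≤ M := (abs_nonneg _).trans (hM 0 0)
  have := kernelMass_nonneg
  refine ⟨?_, fun x τ hτ s _ => ?_⟩
  · refine (by fun_prop : Continuous fun p : ℝ × ℝ × ℝ =>
      Real.exp (-(l * p.2.1))).continuousOn.mul (ContinuousOn.mul (ContinuousOn.inv₀
        (by fun_prop) fun p hp => (Real.sqrt_pos.2 hp.2.1).ne') ?_)
    exact ((continuous_average expDecay_heatKernel₁ continuous_heatKernel₁ hg hM).comp
      (by fun_prop : Continuous fun p : ℝ × ℝ × ℝ => (p.1, √p.2.1, p.2.2))).continuousOn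
  · refine (abs_sourceKernel₁_le hM x τ s).trans (mul_le_mul_of_nonneg_left ?_ (by positivity))
    calc _ ≤ 1 * singularWeight τ := by
          gcongr
          · exact exp_neg_mul_le_one hl hτ.le
          · exact inv_sqrt_le_singularWeight τ
      _ ≤ singularWeight τ * singularWeight s := by
          rw [one_mul]
          exact le_mul_of_one_le_right (singularWeight_nonneg τ) (one_le_singularWeight s)

/-- The Lipschitz constant of the source may blow up like `s^{-1/2}`, which is what mild solutions
with merely continuous initial values provide; the zero mean of `heatKernel₂` supplies `τ^{-1/2}`.
-/
theorem isDuhamelKernel_sourceKernel₂ (hl : 0 ≤ l) (hg : Continuous fun p : ℝ × ℝ => g p.1 p.2)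
    (hM : ∀ x s, |g x s| ≤ M) {L : ℝ} (hL0 : 0 ≤ L)
    (hL : ∀ s > 0, ∀ x y, |g x s - g y s| ≤ L * singularWeight s * |x - y|) :
    IsDuhamelKernel (sourceKernel₂ l g) (L * kernelMass) := by
  have := kernelMass_nonneg
  refine ⟨?_, fun x τ hτ s hs => ?_⟩
  · refine (by fun_prop : Continuous fun p : ℝ × ℝ × ℝ =>
      Real.exp (-(l * p.2.1))).continuousOn.mul (ContinuousOn.mul (ContinuousOn.inv₀
        (by fun_prop) fun p hp => (ne_of_gt hp.2.1)) ?_)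
    exact ((continuous_average expDecay_heatKernel₂ continuous_heatKernel₂ hg hM).comp
      (by fun_prop : Continuous fun p : ℝ × ℝ × ℝ => (p.1, √p.2.1, p.2.2))).continuousOn
  · have h1 := abs_average_heatKernel₂_le
      (continuous_slice hg s) (fun y => hM y s)
      (hL s hs) x (Real.sqrt_nonneg τ)
    have h2 : τ⁻¹ = (√τ)⁻¹ * (√τ)⁻¹ := by rw [← mul_inv, Real.mul_self_sqrt hτ.le]
    have hs0 := singularWeight_nonneg s
    have hτ0 : 0 < √τ := Real.sqrt_pos.2 hτ
    rw [sourceKernel₂, abs_mul, abs_mul, abs_of_pos (Real.exp_pos _), abs_of_pos (inv_pos.2 hτ)]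
    calc _ ≤ 1 * (τ⁻¹ * (L * singularWeight s * √τ * kernelMass)) := by
          gcongr
          · exact exp_neg_mul_le_one hl hτ.le
      _ = L * kernelMass * ((√τ)⁻¹ * singularWeight s) := by
          rw [h2]
          field_simp
      _ ≤ _ := by
          gcongr
          exact inv_sqrt_le_singularWeight τ

theorem continuous_duhamel_sourceKernel (l : ℝ) (hg : Continuous fun p : ℝ × ℝ => g p.1 p.2)
    (hM : ∀ x s, |g x s| ≤ M) :
    Continuous fun p : ℝ × ℝ => duhamel (sourceKernel l g) p.1 p.2 := by
  refine intervalIntegral.continuous_parametric_intervalIntegral_of_continuous' ?_ 0 1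
  exact (by fun_prop : Continuous fun q : (ℝ × ℝ) × ℝ => q.1.2).mul
    ((continuous_sourceKernel l hg hM).comp (by fun_prop :
      Continuous fun q : (ℝ × ℝ) × ℝ => (q.1.1, q.1.2 * (1 - q.2), q.1.2 * q.2)))

theorem duhamel_zero (F : ℝ → ℝ → ℝ → ℝ) (x : ℝ) : duhamel F x 0 = 0 := by simp [duhamel]

/-- The damping yields the small factor `1/l` uniformly in time, so the nonlinear fixed point
problem is solved on all of `[0,∞)` in one step. -/
theorem abs_duhamel_sourceKernel_le (hl : 0 < l) (hM : ∀ x s, |g x s| ≤ M) (x : ℝ) {t : ℝ}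
    (ht : 0 ≤ t) : |duhamel (sourceKernel l g) x t| ≤ M / l := by
  have hM0 : 0 ≤ M := (abs_nonneg _).trans (hM 0 0)
  rcases ht.eq_or_lt with rfl | ht
  · rw [duhamel_zero, abs_zero]
    positivity
  have h1 : |duhamel (sourceKernel l g) x t| ≤ ∫ s in (0 : ℝ)..t, M * Real.exp (-(l * (t - s))) := by
    rw [duhamel_eq_integral _ _ ht, ← Real.norm_eq_abs]
    refine intervalIntegral.norm_integral_le_of_norm_le ht.le
      (ae_of_all _ fun s _ => abs_sourceKernel_le hM x (t - s) s) ?_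
    exact (by fun_prop : Continuous fun s => M * Real.exp (-(l * (t - s)))).intervalIntegrable _ _
  have h2 := integral_exp_const_mul (l := -l) (by linarith) t
  rw [intervalIntegral.integral_comp_sub_left (fun τ => M * Real.exp (-(l * τ))), sub_self,
    sub_zero, intervalIntegral.integral_const_mul] at h1
  simp only [neg_mul] at h2
  rw [h2] at h1
  refine h1.trans ?_
  have h3 := Real.exp_pos (-(l * t))
  rw [div_neg, ← neg_div, mul_div_assoc']
  gcongr
  nlinarith

theorem duhamel_sourceKernel_sub (hl : 0 ≤ l) (hg : Continuous fun p : ℝ × ℝ => g p.1 p.2)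
    (hM : ∀ x s, |g x s| ≤ M) (hg' : Continuous fun p : ℝ × ℝ => g' p.1 p.2) {M' : ℝ}
    (hM' : ∀ x s, |g' x s| ≤ M') (x : ℝ) {t : ℝ} (ht : 0 ≤ t) :
    duhamel (sourceKernel l g) x t - duhamel (sourceKernel l g') x t =
      duhamel (sourceKernel l fun x s => g x s - g' x s) x t := by
  rcases ht.eq_or_lt with rfl | ht
  · simp [duhamel_zero]
  have h1 := (isDuhamelKernel_sourceKernel hl hg hM).duhamel_sub
    (isDuhamelKernel_sourceKernel hl hg' hM') 1 x ht
  rw [one_mul] at h1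
  rw [← h1]
  congr 1
  ext y τ s
  rw [one_mul, sourceKernel, sourceKernel, sourceKernel, ← mul_sub, average, average, average,
    ← integral_sub
      (integrable_average expDecay_heatKernel continuous_heatKernel
        (continuous_slice hg s) (fun y => hM y s) _ _)
      (integrable_average expDecay_heatKernel continuous_heatKernel
        (continuous_slice hg' s) (fun y => hM' y s) _ _)]
  simp only [sub_mul]

/-- The first derivative of the Duhamel integral is bounded, uniformly in time. -/
theorem exists_abs_duhamel_sourceKernel₁_le (hl : 0 < l) (hM : ∀ x s, |g x s| ≤ M) :
    ∃ C, ∀ x, ∀ t > 0, |duhamel (sourceKernel₁ l g) x t| ≤ C := by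
  have hM0 : 0 ≤ M := (abs_nonneg _).trans (hM 0 0)
  have hI : IntegrableOn (fun τ => Real.exp (-(l * τ)) * (√τ)⁻¹) (Ioi 0) := by
    refine (integrableOn_rpow_mul_exp_neg_mul_rpow (p := 1) (s := -(1 / 2)) (b := l)
      (by norm_num) (by norm_num) hl).congr_fun (fun τ hτ => ?_) measurableSet_Ioi
    simp only [Real.rpow_one, Real.rpow_neg (le_of_lt hτ), ← Real.sqrt_eq_rpow, neg_mul]
    exact mul_comm _ _
  refine ⟨∫ τ in Ioi (0 : ℝ), M * kernelMass * (Real.exp (-(l * τ)) * (√τ)⁻¹), fun x t ht => ?_⟩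
  have hI' := hI.const_mul (M * kernelMass)
  have hII : IntervalIntegrable (fun τ => M * kernelMass * (Real.exp (-(l * τ)) * (√τ)⁻¹))
      volume 0 t := by
    rw [intervalIntegrable_iff_integrableOn_Ioc_of_le ht.le]
    exact IntegrableOn.mono_set hI' Ioc_subset_Ioi_self
  have h1 : |duhamel (sourceKernel₁ l g) x t| ≤
      ∫ s in (0 : ℝ)..t, M * kernelMass * (Real.exp (-(l * (t - s))) * (√(t - s))⁻¹) := by
    rw [duhamel_eq_integral _ _ ht, ← Real.norm_eq_abs]
    refine intervalIntegral.norm_integral_le_of_norm_le ht.le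
      (ae_of_all _ fun s _ => abs_sourceKernel₁_le hM x (t - s) s) ?_
    simpa using (hII.comp_sub_left t).symm
  rw [intervalIntegral.integral_comp_sub_left
    (fun τ => M * kernelMass * (Real.exp (-(l * τ)) * (√τ)⁻¹)), sub_self, sub_zero,
    intervalIntegral.integral_of_le ht.le] at h1
  refine h1.trans (setIntegral_mono_set hI' ?_ Ioc_subset_Ioi_self.eventuallyLE)
  have := kernelMass_nonneg
  exact ae_of_all _ fun τ => by simp only [Pi.zero_apply]; positivity

/-- The mild solution of `ω_t = ω_xx - l ω + g` with initial value `h`, and its derivatives. -/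
def mild (l : ℝ) (h : ℝ → ℝ) (g : ℝ → ℝ → ℝ) (x t : ℝ) : ℝ :=
  sourceKernel l (fun y _ => h y) x t 0 + duhamel (sourceKernel l g) x t

/-- The formal space derivative of `mild`, of the order in the index. -/
def mild₁ (l : ℝ) (h : ℝ → ℝ) (g : ℝ → ℝ → ℝ) (x t : ℝ) : ℝ :=
  sourceKernel₁ l (fun y _ => h y) x t 0 + duhamel (sourceKernel₁ l g) x t

/-- The formal space derivative of `mild`, of the order in the index. -/
def mild₂ (l : ℝ) (h : ℝ → ℝ) (g : ℝ → ℝ → ℝ) (x t : ℝ) : ℝ :=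
  sourceKernel₂ l (fun y _ => h y) x t 0 + duhamel (sourceKernel₂ l g) x t

variable {h : ℝ → ℝ} {N L : ℝ}

theorem continuous_mild (l : ℝ) (hh : Continuous h) (hN : ∀ x, |h x| ≤ N)
    (hg : Continuous fun p : ℝ × ℝ => g p.1 p.2) (hM : ∀ x s, |g x s| ≤ M) :
    Continuous fun p : ℝ × ℝ => mild l h g p.1 p.2 := by
  refine Continuous.add ?_ (continuous_duhamel_sourceKernel l hg hM)
  exact (continuous_sourceKernel l (g := fun y _ => h y)
    (hh.comp continuous_fst) fun x _ => hN x).comp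
      (by fun_prop : Continuous fun p : ℝ × ℝ => (p.1, p.2, (0 : ℝ)))

theorem mild_zero (l : ℝ) (h : ℝ → ℝ) (g : ℝ → ℝ → ℝ) (x : ℝ) : mild l h g x 0 = h x := by
  simp [mild, sourceKernel, duhamel_zero, average_heatKernel_zero]

theorem abs_mild_le (hl : 0 < l) (hN : ∀ x, |h x| ≤ N) (hM : ∀ x s, |g x s| ≤ M) (x : ℝ) {t : ℝ}
    (ht : 0 ≤ t) : |mild l h g x t| ≤ N + M / l := by
  have hN0 : 0 ≤ N := (abs_nonneg _).trans (hN 0)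
  refine (abs_add_le _ _).trans (add_le_add ?_ (abs_duhamel_sourceKernel_le hl hM x ht))
  refine (abs_sourceKernel_le (g := fun y _ => h y) (fun x _ => hN x) x t 0).trans ?_
  exact mul_le_of_le_one_right hN0 (exp_neg_mul_le_one hl.le ht)

theorem abs_mild_sub_le (hl : 0 < l) (hg : Continuous fun p : ℝ × ℝ => g p.1 p.2)
    (hM : ∀ x s, |g x s| ≤ M) (hg' : Continuous fun p : ℝ × ℝ => g' p.1 p.2) {M' : ℝ}
    (hM' : ∀ x s, |g' x s| ≤ M') {D : ℝ} (hD : ∀ x s, |g x s - g' x s| ≤ D) (x : ℝ) {t : ℝ}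
    (ht : 0 ≤ t) : |mild l h g x t - mild l h g' x t| ≤ D / l := by
  rw [mild, mild, add_sub_add_left_eq_sub, duhamel_sourceKernel_sub hl.le hg hM hg' hM' x ht]
  exact abs_duhamel_sourceKernel_le hl hD x ht

/-- The heat kernel is even, so oddness about `x` gives the Dirichlet condition there. -/
theorem mild_eq_zero {x : ℝ} (hodd : ∀ y, h (x - y) = -h (x + y))
    (hg : ∀ s y, g (x - y) s = -g (x + y) s) (l t : ℝ) : mild l h g x t = 0 := by
  have h1 : ∀ τ s, sourceKernel l g x τ s = 0 := fun τ s => by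
    rw [sourceKernel, average_heatKernel_eq_zero (hg s), mul_zero]
  have h2 : sourceKernel l (fun y _ => h y) x t 0 = 0 := by
    rw [sourceKernel, average_heatKernel_eq_zero hodd, mul_zero]
  simp [mild, h2, duhamel, h1]

theorem hasDerivAt_mild (hl : 0 ≤ l) (hh : Continuous h) (hN : ∀ x, |h x| ≤ N)
    (hg : Continuous fun p : ℝ × ℝ => g p.1 p.2) (hM : ∀ x s, |g x s| ≤ M) (x : ℝ) {t : ℝ}
    (ht : 0 < t) : HasDerivAt (fun x => mild l h g x t) (mild₁ l h g x t) x :=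
  (hasDerivAt_sourceKernel (hh.comp continuous_fst) (fun x _ => hN x) x ht 0).add
    ((isDuhamelKernel_sourceKernel hl hg hM).hasDerivAt_duhamel
      (isDuhamelKernel_sourceKernel₁ hl hg hM)
      (fun x _ hτ s _ => hasDerivAt_sourceKernel hg hM x hτ s) x ht)

/-- Mild solutions are Lipschitz in space for positive times. -/
theorem exists_abs_mild_sub_le (hl : 0 < l) (hh : Continuous h) (hN : ∀ x, |h x| ≤ N)
    (hg : Continuous fun p : ℝ × ℝ => g p.1 p.2) (hM : ∀ x s, |g x s| ≤ M) :
    ∃ C, 0 ≤ C ∧ ∀ t > 0, ∀ x y,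
      |mild l h g x t - mild l h g y t| ≤ C * singularWeight t * |x - y| := by
  obtain ⟨C, hC⟩ := exists_abs_duhamel_sourceKernel₁_le hl hM
  have hC0 : 0 ≤ C := (abs_nonneg _).trans (hC 0 1 one_pos)
  have hN0 : 0 ≤ N := (abs_nonneg _).trans (hN 0)
  have hk := kernelMass_nonneg
  refine ⟨N * kernelMass + C, by positivity, fun t ht x y => ?_⟩
  have hb : ∀ z, ‖mild₁ l h g z t‖ ≤ (N * kernelMass + C) * singularWeight t := by
    intro z
    have h1 := abs_sourceKernel₁_le (l := l) (g := fun y _ => h y) (fun x _ => hN x) z t 0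
    have h2 : Real.exp (-(l * t)) * (√t)⁻¹ ≤ 1 * singularWeight t := by
      gcongr
      · exact exp_neg_mul_le_one hl.le ht.le
      · exact inv_sqrt_le_singularWeight t
    rw [one_mul] at h2
    calc _ ≤ _ := abs_add_le _ _
      _ ≤ N * kernelMass * singularWeight t + C * 1 := by
        rw [mul_one]
        refine add_le_add (h1.trans ?_) (hC z t ht)
        gcongr
      _ ≤ N * kernelMass * singularWeight t + C * singularWeight t := by
        gcongr
        exact one_le_singularWeight t
      _ = _ := by ring
  have := convex_univ.norm_image_sub_le_of_norm_hasDerivWithin_le (𝕜 := ℝ) (s := univ)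
    (fun z _ => (hasDerivAt_mild hl.le hh hN hg hM z ht).hasDerivWithinAt) (fun z _ => hb z)
    (mem_univ y) (mem_univ x)
  simpa [Real.norm_eq_abs] using this

theorem continuousOn_mild₁ (hl : 0 ≤ l) (hh : Continuous h) (hN : ∀ x, |h x| ≤ N)
    (hg : Continuous fun p : ℝ × ℝ => g p.1 p.2) (hM : ∀ x s, |g x s| ≤ M) :
    ContinuousOn (fun p : ℝ × ℝ => mild₁ l h g p.1 p.2) (univ ×ˢ Ioi 0) := by
  refine ContinuousOn.add ?_ (isDuhamelKernel_sourceKernel₁ hl hg hM).continuousOn_duhamel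
  -- The source time `1` is a dummy: this source does not depend on `s`, and kernel continuity is
  -- available only for `s > 0`.
  exact (isDuhamelKernel_sourceKernel₁ hl (g := fun y _ => h y) (hh.comp continuous_fst)
    fun x _ => hN x).continuousOn.comp (f := fun p : ℝ × ℝ => (p.1, p.2, (1 : ℝ))) (by fun_prop)
      fun p hp => ⟨trivial, hp.2, show (0 : ℝ) < 1 from one_pos⟩

/-- Proved directly, since the initial value `h` is only continuous and the kernel bound for
`sourceKernel₂` requires a Lipschitz source. -/
theorem continuousOn_sourceKernel₂ (l : ℝ) (hh : Continuous h) (hN : ∀ x, |h x| ≤ N) :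
    ContinuousOn (fun p : ℝ × ℝ => sourceKernel₂ l (fun y _ => h y) p.1 p.2 0) (univ ×ˢ Ioi 0) := by
  refine (by fun_prop : Continuous fun p : ℝ × ℝ =>
    Real.exp (-(l * p.2))).continuousOn.mul (ContinuousOn.mul (ContinuousOn.inv₀
      (by fun_prop) fun p hp => (ne_of_gt hp.2)) ?_)
  exact ((continuous_average (g := fun y _ => h y) expDecay_heatKernel₂ continuous_heatKernel₂
    (hh.comp continuous_fst) fun x _ => hN x).comp
    (by fun_prop : Continuous fun p : ℝ × ℝ => (p.1, √p.2, (0 : ℝ)))).continuousOn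

theorem continuousOn_mild₂ (hl : 0 ≤ l) (hh : Continuous h) (hN : ∀ x, |h x| ≤ N)
    (hg : Continuous fun p : ℝ × ℝ => g p.1 p.2) (hM : ∀ x s, |g x s| ≤ M) (hL0 : 0 ≤ L)
    (hL : ∀ s > 0, ∀ x y, |g x s - g y s| ≤ L * singularWeight s * |x - y|) :
    ContinuousOn (fun p : ℝ × ℝ => mild₂ l h g p.1 p.2) (univ ×ˢ Ioi 0) :=
  (continuousOn_sourceKernel₂ l hh hN).add
    (isDuhamelKernel_sourceKernel₂ hl hg hM hL0 hL).continuousOn_duhamel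

theorem hasDerivAt_mild₁ (hl : 0 ≤ l) (hh : Continuous h) (hN : ∀ x, |h x| ≤ N)
    (hg : Continuous fun p : ℝ × ℝ => g p.1 p.2) (hM : ∀ x s, |g x s| ≤ M) (hL0 : 0 ≤ L)
    (hL : ∀ s > 0, ∀ x y, |g x s - g y s| ≤ L * singularWeight s * |x - y|) (x : ℝ) {t : ℝ}
    (ht : 0 < t) : HasDerivAt (fun x => mild₁ l h g x t) (mild₂ l h g x t) x :=
  (hasDerivAt_sourceKernel₁ (hh.comp continuous_fst) (fun x _ => hN x) x ht 0).add
    ((isDuhamelKernel_sourceKernel₁ hl hg hM).hasDerivAt_duhamel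
      (isDuhamelKernel_sourceKernel₂ hl hg hM hL0 hL)
      (fun x _ hτ s _ => hasDerivAt_sourceKernel₁ hg hM x hτ s) x ht)

theorem hasDerivAt_mild_time (hl : 0 ≤ l) (hh : Continuous h) (hN : ∀ x, |h x| ≤ N)
    (hg : Continuous fun p : ℝ × ℝ => g p.1 p.2) (hM : ∀ x s, |g x s| ≤ M) (hL0 : 0 ≤ L)
    (hL : ∀ s > 0, ∀ x y, |g x s - g y s| ≤ L * singularWeight s * |x - y|) (x : ℝ) {t : ℝ}
    (ht : 0 < t) : HasDerivAt (fun t => mild l h g x t)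
      (mild₂ l h g x t - l * mild l h g x t + g x t) t := by
  have hF := isDuhamelKernel_sourceKernel hl hg hM
  have hF₂ := isDuhamelKernel_sourceKernel₂ hl hg hM hL0 hL
  have h1 := hasDerivAt_sourceKernel_time (l := l) (g := fun y _ => h y) (hh.comp continuous_fst)
    (fun x _ => hN x) x ht 0
  have h2 := hF.hasDerivAt_duhamel_time (hF₂.sub_const_mul hF l)
    (hg.comp (by fun_prop : Continuous fun s : ℝ => (x, s))) x
    (fun s => by simp [sourceKernel, average_heatKernel_zero])
    (fun s _ => ((continuous_sourceKernel l hg hM).comp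
      (by fun_prop : Continuous fun τ : ℝ => (x, τ, s))).continuousOn)
    (fun τ hτ s _ => hasDerivAt_sourceKernel_time hg hM x hτ s) ht
  rw [hF₂.duhamel_sub hF l x ht] at h2
  refine (h1.add h2).congr_deriv ?_
  simp only [mild, mild₂, Function.comp_apply]
  ring

end Mild

end

end TravellingWave

namespace TravellingWave

open MeasureTheory
open scoped NNReal Topology BoundedContinuousFunction

noncomputable section

/-! ### The semilinear Dirichlet problem without drift -/

section Semilinear

theorem continuous_oddExt_single {a b : ℝ} (hab : a < b) {h : ℝ → ℝ}
    (hh : ContinuousOn h (Icc a b)) (ha : h a = 0) (hb : h b = 0) : Continuous (oddExt a b h) := by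
  have h0 : ContinuousOn (fun p : ℝ × ℝ => h p.1) (Icc a b ×ˢ univ) :=
    hh.comp continuousOn_fst fun p hp => hp.1
  have h1 : Continuous fun p : ℝ × ℝ => oddExt a b h p.1 :=
    continuous_oddExt hab (g := fun y _ => h y) h0 (fun _ => ha) fun _ => hb
  have h2 : Continuous fun x : ℝ => (x, (0 : ℝ)) := by fun_prop
  exact (h1.comp h2).congr fun x => rfl

/-- A function minus the affine interpolation of its values at the end points. -/
def dirichletPart (a b : ℝ) (ω : ℝ → ℝ → ℝ) (y s : ℝ) : ℝ :=
  ω y s - ((b - y) * ω a s + (y - a) * ω b s) / (b - a)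

/-- The reaction term `G` in the damped variable `ω = e^{-ls} w`. -/
def dampedReaction (l a b : ℝ) (G : ℝ → ℝ → ℝ) (ω : ℝ → ℝ → ℝ) (y s : ℝ) : ℝ :=
  Real.exp (-(l * max s 0)) * G y (Real.exp (l * max s 0) * dirichletPart a b ω y s)

/-- The reaction term, extended to the line by reflection. -/
def reactionSource (l a b : ℝ) (G : ℝ → ℝ → ℝ) (ω : ℝ → ℝ → ℝ) (x s : ℝ) : ℝ :=
  oddExt a b (fun y => dampedReaction l a b G ω y s) x

variable {a b l K : ℝ} {G ω ω' : ℝ → ℝ → ℝ}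

theorem dirichletPart_left (hab : a < b) (ω : ℝ → ℝ → ℝ) (s : ℝ) :
    dirichletPart a b ω a s = 0 := by
  have : b - a ≠ 0 := (sub_pos.2 hab).ne'
  unfold dirichletPart
  field_simp
  ring

theorem dirichletPart_right (hab : a < b) (ω : ℝ → ℝ → ℝ) (s : ℝ) :
    dirichletPart a b ω b s = 0 := by
  have : b - a ≠ 0 := (sub_pos.2 hab).ne'
  unfold dirichletPart
  field_simp
  ring

/-- Subtracting the interpolation makes the reflected source continuous for every `ω` in the fixed
point space; for the solution itself, which satisfies the boundary conditions, it changes nothing.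
-/
theorem dirichletPart_of_eq_zero {s : ℝ} (ha : ω a s = 0) (hb : ω b s = 0) (y : ℝ) :
    dirichletPart a b ω y s = ω y s := by
  simp [dirichletPart, ha, hb]

theorem abs_dirichletPart_sub_le (hab : a < b) {D : ℝ} (hD : ∀ y s, |ω y s - ω' y s| ≤ D) {y : ℝ}
    (hy : y ∈ Icc a b) (s : ℝ) :
    |dirichletPart a b ω y s - dirichletPart a b ω' y s| ≤ 2 * D := by
  have h3 : 0 < b - a := sub_pos.2 hab
  have h1 : dirichletPart a b ω y s - dirichletPart a b ω' y s = (ω y s - ω' y s) -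
      ((b - y) * (ω a s - ω' a s) + (y - a) * (ω b s - ω' b s)) / (b - a) := by
    unfold dirichletPart
    ring
  have h2 : |((b - y) * (ω a s - ω' a s) + (y - a) * (ω b s - ω' b s)) / (b - a)| ≤ D := by
    rw [abs_div, abs_of_pos h3, div_le_iff₀ h3]
    calc _ ≤ |(b - y) * (ω a s - ω' a s)| + |(y - a) * (ω b s - ω' b s)| := abs_add_le _ _
      _ ≤ (b - y) * D + (y - a) * D := by
        rw [abs_mul, abs_mul, abs_of_nonneg (sub_nonneg.2 hy.1), abs_of_nonneg (sub_nonneg.2 hy.2)]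
        have := sub_nonneg.2 hy.1
        have := sub_nonneg.2 hy.2
        gcongr
        · exact hD _ _
        · exact hD _ _
      _ = _ := by ring
  rw [h1]
  calc _ ≤ _ := abs_sub _ _
    _ ≤ D + D := add_le_add (hD y s) h2
    _ = _ := by ring

/-- Reaction terms on `[a,b]` that are jointly Lipschitz continuous and compatible with the
homogeneous Dirichlet condition. -/
structure IsDirichletReaction (a b K : ℝ) (G : ℝ → ℝ → ℝ) : Prop where
  nonneg : 0 ≤ K
  lipschitz : ∀ x ∈ Icc a b, ∀ y ∈ Icc a b, ∀ w v, |G x w - G y v| ≤ K * (|x - y| + |w - v|)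
  left : G a 0 = 0
  right : G b 0 = 0

namespace IsDirichletReaction

/-- The two exponentials cancel, so the constant does not depend on `l`. The factor `2` comes from
`dirichletPart`. -/
theorem abs_dampedReaction_sub_le (hG : IsDirichletReaction a b K G) (hab : a < b) {D : ℝ}
    (hD : ∀ y s, |ω y s - ω' y s| ≤ D) {y : ℝ} (hy : y ∈ Icc a b) (s : ℝ) :
    |dampedReaction l a b G ω y s - dampedReaction l a b G ω' y s| ≤ 2 * K * D := by
  have h1 := abs_dirichletPart_sub_le hab hD hy s
  have hK := hG.nonneg
  rw [dampedReaction, dampedReaction, ← mul_sub, abs_mul, abs_of_pos (Real.exp_pos _)]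
  calc _ ≤ Real.exp (-(l * max s 0)) * (K * (|y - y| +
        |Real.exp (l * max s 0) * dirichletPart a b ω y s -
          Real.exp (l * max s 0) * dirichletPart a b ω' y s|)) := by
        gcongr
        exact hG.lipschitz y hy y hy _ _
    _ = (Real.exp (-(l * max s 0)) * Real.exp (l * max s 0)) * (K *
        |dirichletPart a b ω y s - dirichletPart a b ω' y s|) := by
        rw [sub_self, abs_zero, zero_add, ← mul_sub, abs_mul, abs_of_pos (Real.exp_pos _)]
        ring
    _ = K * |dirichletPart a b ω y s - dirichletPart a b ω' y s| := by
        rw [← Real.exp_add]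
        simp
    _ ≤ K * (2 * D) := by gcongr
    _ = _ := by ring

theorem dampedReaction_left (hG : IsDirichletReaction a b K G) (hab : a < b) (l : ℝ)
    (ω : ℝ → ℝ → ℝ) (s : ℝ) : dampedReaction l a b G ω a s = 0 := by
  rw [dampedReaction, dirichletPart_left hab, mul_zero, hG.left, mul_zero]

theorem dampedReaction_right (hG : IsDirichletReaction a b K G) (hab : a < b) (l : ℝ)
    (ω : ℝ → ℝ → ℝ) (s : ℝ) : dampedReaction l a b G ω b s = 0 := by
  rw [dampedReaction, dirichletPart_right hab, mul_zero, hG.right, mul_zero]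

theorem abs_zero_le (hG : IsDirichletReaction a b K G) (hab : a < b) {y : ℝ} (hy : y ∈ Icc a b) :
    |G y 0| ≤ K * (b - a) := by
  have h1 := hG.lipschitz y hy a (left_mem_Icc.2 hab.le) 0 0
  rw [hG.left, sub_zero, sub_self, abs_zero, add_zero, abs_of_nonneg (sub_nonneg.2 hy.1)] at h1
  exact h1.trans (mul_le_mul_of_nonneg_left (by linarith [hy.2]) hG.nonneg)

theorem abs_reactionSource_le (hG : IsDirichletReaction a b K G) (hab : a < b) (hl : 0 ≤ l) {D : ℝ}
    (hD : ∀ y s, |ω y s| ≤ D) (x s : ℝ) :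
    |reactionSource l a b G ω x s| ≤ K * (b - a) + 2 * K * D := by
  have hy := fold_mem hab x
  have h1 := hG.abs_dampedReaction_sub_le (l := l) (ω := ω) (ω' := fun _ _ => 0) hab
    (fun y s => by simpa using hD y s) hy s
  have h2 : |dampedReaction l a b G (fun _ _ => 0) (fold a b x) s| ≤ K * (b - a) := by
    rw [dampedReaction, dirichletPart_of_eq_zero rfl rfl, mul_zero, abs_mul,
      abs_of_pos (Real.exp_pos _)]
    exact (mul_le_of_le_one_left (abs_nonneg _) (exp_neg_mul_le_one hl (le_max_right _ _))).trans
      (hG.abs_zero_le hab hy)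
  rw [reactionSource, abs_oddExt]
  have h3 := abs_add_le (dampedReaction l a b G (fun _ _ => 0) (fold a b x) s)
    (dampedReaction l a b G ω (fold a b x) s -
      dampedReaction l a b G (fun _ _ => 0) (fold a b x) s)
  rw [add_sub_cancel] at h3
  linarith

theorem abs_reactionSource_sub_le (hG : IsDirichletReaction a b K G) (hab : a < b) {D : ℝ}
    (hD : ∀ y s, |ω y s - ω' y s| ≤ D) (x s : ℝ) :
    |reactionSource l a b G ω x s - reactionSource l a b G ω' x s| ≤ 2 * K * D := by
  rw [reactionSource, reactionSource, oddExt_sub, abs_oddExt]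
  exact hG.abs_dampedReaction_sub_le hab hD (fold_mem hab x) s

theorem continuousOn (hG : IsDirichletReaction a b K G) :
    ContinuousOn (fun p : ℝ × ℝ => G p.1 p.2) (Icc a b ×ˢ univ) := by
  refine (LipschitzOnWith.of_dist_le_mul (K := ⟨2 * K, by have := hG.nonneg; positivity⟩)
    fun p hp q hq => ?_).continuousOn
  have h1 := hG.lipschitz p.1 hp.1 q.1 hq.1 p.2 q.2
  have h2 : |p.1 - q.1| ≤ dist p q := by rw [← Real.dist_eq]; exact le_max_left _ _
  have h3 : |p.2 - q.2| ≤ dist p q := by rw [← Real.dist_eq]; exact le_max_right _ _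
  have hK := hG.nonneg
  rw [Real.dist_eq]
  refine h1.trans ?_
  change _ ≤ 2 * K * dist p q
  nlinarith

theorem continuous_reactionSource (hG : IsDirichletReaction a b K G) (hab : a < b) (l : ℝ)
    (hω : Continuous fun p : ℝ × ℝ => ω p.1 p.2) :
    Continuous fun p : ℝ × ℝ => reactionSource l a b G ω p.1 p.2 := by
  refine continuous_oddExt hab (g := dampedReaction l a b G ω) ?_
    (hG.dampedReaction_left hab l ω) (hG.dampedReaction_right hab l ω)
  have hd : Continuous fun p : ℝ × ℝ => dirichletPart a b ω p.1 p.2 := by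
    have h1 : Continuous fun p : ℝ × ℝ => ω a p.2 :=
      hω.comp (by fun_prop : Continuous fun p : ℝ × ℝ => (a, p.2))
    have h2 : Continuous fun p : ℝ × ℝ => ω b p.2 :=
      hω.comp (by fun_prop : Continuous fun p : ℝ × ℝ => (b, p.2))
    unfold dirichletPart
    fun_prop
  refine (by fun_prop : Continuous fun p : ℝ × ℝ => Real.exp (-(l * max p.2 0))).continuousOn.mul ?_
  exact hG.continuousOn.comp (f := fun p : ℝ × ℝ =>
    (p.1, Real.exp (l * max p.2 0) * dirichletPart a b ω p.1 p.2))
    (by fun_prop : Continuous _).continuousOn fun p hp => ⟨hp.1, trivial⟩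

/-- The mild formulation of the damped problem has a solution. -/
theorem exists_mild_solution (hG : IsDirichletReaction a b K G) (hab : a < b) {h : ℝ → ℝ}
    (hh : Continuous h) {N : ℝ} (hN : ∀ x, |h x| ≤ N) :
    ∃ l > 0, ∃ ω : ℝ → ℝ → ℝ, ∃ D, Continuous (fun p : ℝ × ℝ => ω p.1 p.2) ∧
      (∀ x s, |ω x s| ≤ D) ∧
      ∀ x, ∀ t ≥ 0, ω x t = mild l h (reactionSource l a b G ω) x t := by
  have hK := hG.nonneg
  -- The source is `2K`-Lipschitz in `ω` and the damping divides by `l`, so the contraction constant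
  -- is at most `1/2`.
  set l : ℝ := 4 * K + 1 with hl
  have hl0 : 0 < l := by positivity
  have hcont : ∀ ω : ℝ × ℝ →ᵇ ℝ, Continuous fun p : ℝ × ℝ =>
      reactionSource l a b G (fun y s => ω (y, s)) p.1 p.2 := fun ω =>
    hG.continuous_reactionSource hab l (ω := fun y s => ω (y, s)) ω.continuous
  have hbound : ∀ (ω : ℝ × ℝ →ᵇ ℝ) x s, |reactionSource l a b G (fun y s => ω (y, s)) x s| ≤
      K * (b - a) + 2 * K * ‖ω‖ := fun ω =>
    hG.abs_reactionSource_le hab hl0.le fun y s => ω.norm_coe_le_norm (y, s)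
  let T : (ℝ × ℝ →ᵇ ℝ) → (ℝ × ℝ →ᵇ ℝ) := fun ω => BoundedContinuousFunction.ofNormedAddCommGroup
    (fun p => mild l h (reactionSource l a b G fun y s => ω (y, s)) p.1 (max p.2 0))
    ((continuous_mild l hh hN (hcont ω) (hbound ω)).comp
      (by fun_prop : Continuous fun p : ℝ × ℝ => (p.1, max p.2 0)))
    (N + (K * (b - a) + 2 * K * ‖ω‖) / l)
    (fun p => abs_mild_le hl0 hN (hbound ω) p.1 (le_max_right _ _))
  have hT : ContractingWith (1 / 2) T := by
    refine ⟨by norm_num [← NNReal.coe_lt_coe], LipschitzWith.of_dist_le_mul fun ω ω' => ?_⟩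
    rw [dist_eq_norm, dist_eq_norm]
    refine (BoundedContinuousFunction.norm_le (by positivity)).2 fun p => ?_
    have h1 := abs_mild_sub_le (h := h) hl0 (hcont ω) (hbound ω) (hcont ω') (hbound ω')
      (hG.abs_reactionSource_sub_le hab fun y s => (ω - ω').norm_coe_le_norm (y, s)) p.1
      (le_max_right p.2 0)
    refine h1.trans ?_
    rw [div_le_iff₀ hl0]
    push_cast
    rw [hl]
    nlinarith [norm_nonneg (ω - ω')]
  obtain ⟨ω, hω⟩ : ∃ ω, T ω = ω := ⟨_, hT.fixedPoint_isFixedPt⟩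
  refine ⟨l, hl0, fun y s => ω (y, s), ‖ω‖, ω.continuous, fun x s => ω.norm_coe_le_norm (x, s),
    fun x t ht => ?_⟩
  conv_lhs => rw [← hω]
  change mild l h _ x (max t 0) = _
  rw [max_eq_left ht]

theorem reactionSource_eq (hab : a < b) {s : ℝ} (hs : 0 ≤ s) (ha : ω a s = 0) (hb : ω b s = 0)
    {x : ℝ} (hx : x ∈ Icc a b) :
    reactionSource l a b G ω x s = Real.exp (-(l * s)) * G x (Real.exp (l * s) * ω x s) := by
  rw [reactionSource, oddExt_of_mem hab _ hx, dampedReaction, dirichletPart_of_eq_zero ha hb,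
    max_eq_left hs]

theorem abs_reactionSource_sub_le_of_lipschitz (hG : IsDirichletReaction a b K G) (hab : a < b)
    (hl : 0 ≤ l) {s L : ℝ} (hs : 0 ≤ s) (ha : ω a s = 0) (hb : ω b s = 0)
    (hL : ∀ x y, |ω x s - ω y s| ≤ L * |x - y|) (x y : ℝ) :
    |reactionSource l a b G ω x s - reactionSource l a b G ω y s| ≤ K * (1 + L) * |x - y| := by
  refine abs_oddExt_sub_le hab (hG.dampedReaction_left hab l ω s)
    (hG.dampedReaction_right hab l ω s) (fun x hx y hy => ?_) x y
  have hK := hG.nonneg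
  have h2 := exp_neg_mul_le_one hl hs
  rw [dampedReaction, dampedReaction, dirichletPart_of_eq_zero ha hb,
    dirichletPart_of_eq_zero ha hb, max_eq_left hs, ← mul_sub, abs_mul, abs_of_pos (Real.exp_pos _)]
  calc _ ≤ Real.exp (-(l * s)) * (K * (|x - y| +
        |Real.exp (l * s) * ω x s - Real.exp (l * s) * ω y s|)) := by
        gcongr
        exact hG.lipschitz x hx y hy _ _
    _ = Real.exp (-(l * s)) * (K * |x - y|) +
        (Real.exp (-(l * s)) * Real.exp (l * s)) * (K * |ω x s - ω y s|) := by
        rw [← mul_sub, abs_mul, abs_of_pos (Real.exp_pos _)]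
        ring
    _ ≤ 1 * (K * |x - y|) + 1 * (K * (L * |x - y|)) := by
        rw [← Real.exp_add, neg_add_cancel, Real.exp_zero]
        gcongr
        exact hL x y
    _ = _ := by ring

/-- Classical solvability of the semilinear heat equation with homogeneous Dirichlet
conditions. -/
theorem exists_classical_solution (hG : IsDirichletReaction a b K G) (hab : a < b) {w₀ : ℝ → ℝ}
    (hw : ContinuousOn w₀ (Icc a b)) (hwa : w₀ a = 0) (hwb : w₀ b = 0) :
    ∃ w wt wx wxx : ℝ → ℝ → ℝ, Continuous (fun p : ℝ × ℝ => w p.1 p.2) ∧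
      (∀ t ≥ 0, w a t = 0) ∧ (∀ t ≥ 0, w b t = 0) ∧ (∀ x ∈ Icc a b, w x 0 = w₀ x) ∧
      ContinuousOn (fun p : ℝ × ℝ => wx p.1 p.2) (univ ×ˢ Ioi 0) ∧
      ContinuousOn (fun p : ℝ × ℝ => wxx p.1 p.2) (univ ×ˢ Ioi 0) ∧
      ∀ x ∈ Icc a b, ∀ t > 0, HasDerivAt (fun s => w x s) (wt x t) t ∧
        HasDerivAt (fun y => w y t) (wx x t) x ∧ HasDerivAt (fun y => wx y t) (wxx x t) x ∧
        wt x t = wxx x t + G x (w x t) := by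
  set h : ℝ → ℝ := oddExt a b w₀ with hh
  have hhc : Continuous h := continuous_oddExt_single hab hw hwa hwb
  obtain ⟨N, hN'⟩ := (isCompact_Icc (a := a) (b := b)).exists_bound_of_continuousOn hw
  have hN : ∀ x, |h x| ≤ N := fun x => by
    rw [hh, abs_oddExt]
    exact hN' _ (fold_mem hab x)
  obtain ⟨l, hl, ω, D, hωc, hωD, hω⟩ := hG.exists_mild_solution hab hhc hN
  set g := reactionSource l a b G ω with hg
  have hgc : Continuous fun p : ℝ × ℝ => g p.1 p.2 := hG.continuous_reactionSource hab l hωc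
  have hgM : ∀ x s, |g x s| ≤ K * (b - a) + 2 * K * D := hG.abs_reactionSource_le hab hl.le hωD
  have hωa : ∀ t ≥ 0, ω a t = 0 := fun t ht => by
    rw [hω a t ht]
    exact mild_eq_zero (oddExt_reflect_left hwa hwb) (fun s => oddExt_reflect_left
      (h := fun y => dampedReaction l a b G ω y s)
      (hG.dampedReaction_left hab l ω s) (hG.dampedReaction_right hab l ω s)) l t
  have hωb : ∀ t ≥ 0, ω b t = 0 := fun t ht => by
    rw [hω b t ht]
    exact mild_eq_zero (oddExt_reflect_right hab hwa hwb) (fun s => oddExt_reflect_right hab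
      (h := fun y => dampedReaction l a b G ω y s)
      (hG.dampedReaction_left hab l ω s) (hG.dampedReaction_right hab l ω s)) l t
  -- Bootstrap: `ω` is mild, hence Lipschitz in space for positive times; the source inherits this,
  -- and so the second space derivative exists.
  obtain ⟨C, hC0, hC⟩ := exists_abs_mild_sub_le hl hhc hN hgc hgM
  have hK := hG.nonneg
  have hgL : ∀ s > 0, ∀ x y, |g x s - g y s| ≤ K * (1 + C) * singularWeight s * |x - y| := by
    intro s hs x y
    refine (hG.abs_reactionSource_sub_le_of_lipschitz hab hl.le (L := C * singularWeight s)
      (le_of_lt hs) (hωa s (le_of_lt hs)) (hωb s (le_of_lt hs)) (fun x y => ?_) x y).trans ?_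
    · rw [hω x s (le_of_lt hs), hω y s (le_of_lt hs)]
      exact hC s hs x y
    · have h1 := one_le_singularWeight s
      refine mul_le_mul_of_nonneg_right ?_ (abs_nonneg _)
      rw [mul_assoc]
      exact mul_le_mul_of_nonneg_left (by nlinarith) hK
  have hL0 : 0 ≤ K * (1 + C) := by positivity
  -- The factor `e^{lt}` undoes the damping and cancels the term `-l ω` in the equation.
  refine ⟨fun x t => Real.exp (l * t) * ω x t,
    fun x t => Real.exp (l * t) * (mild₂ l h g x t + g x t),
    fun x t => Real.exp (l * t) * mild₁ l h g x t, fun x t => Real.exp (l * t) * mild₂ l h g x t,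
    ?_, fun t ht => ?_, fun t ht => ?_,
    fun x hx => ?_, ?_, ?_, fun x hx t ht => ⟨?_, ?_, ?_, ?_⟩⟩
  · exact (by fun_prop : Continuous fun p : ℝ × ℝ => Real.exp (l * p.2)).mul hωc
  · simp only [hωa t ht, mul_zero]
  · simp only [hωb t ht, mul_zero]
  · simp only [hω x 0 le_rfl, mild_zero, mul_zero, Real.exp_zero, one_mul]
    exact oddExt_of_mem hab _ hx
  · exact (by fun_prop : Continuous fun p : ℝ × ℝ => Real.exp (l * p.2)).continuousOn.mul
      (continuousOn_mild₁ hl.le hhc hN hgc hgM)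
  · exact (by fun_prop : Continuous fun p : ℝ × ℝ => Real.exp (l * p.2)).continuousOn.mul
      (continuousOn_mild₂ hl.le hhc hN hgc hgM hL0 hgL)
  · have h1 := ((hasDerivAt_id t).const_mul l).exp.mul
      (hasDerivAt_mild_time hl.le hhc hN hgc hgM hL0 hgL x ht)
    refine (h1.congr_of_eventuallyEq ?_).congr_deriv ?_
    · filter_upwards [Ioi_mem_nhds ht] with s hs
      rw [hω x s (le_of_lt hs)]
      rfl
    · simp only [id, mul_one]
      ring
  · have h1 := (hasDerivAt_mild hl.le hhc hN hgc hgM x ht).const_mul (Real.exp (l * t))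
    refine h1.congr_of_eventuallyEq (Filter.Eventually.of_forall fun y => ?_)
    simp only [hω y t (le_of_lt ht)]
  · exact (hasDerivAt_mild₁ hl.le hhc hN hgc hgM hL0 hgL x ht).const_mul (Real.exp (l * t))
  · have h1 := reactionSource_eq (l := l) (G := G) hab (le_of_lt ht) (hωa t (le_of_lt ht))
      (hωb t (le_of_lt ht)) hx
    simp only [hg, h1, mul_add, ← mul_assoc, ← Real.exp_add]
    simp

end IsDirichletReaction

end Semilinear

end

end TravellingWave

namespace TravellingWave

open scoped NNReal Topology

noncomputable section

/-! ### Removal of the drift, cutoff, and exponential stability -/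

section Stability

/-- The retraction of the line onto `[-1,1]`. -/
def cutoff (z : ℝ) : ℝ := projIcc (-1 : ℝ) 1 (by norm_num) z

theorem cutoff_mem (z : ℝ) : cutoff z ∈ Icc (-1 : ℝ) 1 := Subtype.coe_prop _

theorem cutoff_of_mem {z : ℝ} (hz : z ∈ Icc (-1 : ℝ) 1) : cutoff z = z := by
  rw [cutoff, projIcc_of_mem _ hz]

theorem abs_cutoff_sub_le (y z : ℝ) : |cutoff y - cutoff z| ≤ |y - z| := by
  have h := (LipschitzWith.projIcc (by norm_num : (-1 : ℝ) ≤ 1)).dist_le_mul y z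
  rwa [NNReal.coe_one, one_mul] at h

/-- The reaction term of the perturbation `v` of `V`, in the variable `z = e^{cx/2} v`. -/
def scaledReaction (f : ℝ → ℝ) (c : ℝ) (V : ℝ → ℝ) (x z : ℝ) : ℝ :=
  Real.exp (c / 2 * x) * (f (V x + Real.exp (-(c / 2 * x)) * z) - f (V x))

/-- The reaction term of the perturbation `v` of `V`, cut off for large `v`. -/
def cutoffReaction (f : ℝ → ℝ) (c : ℝ) (V : ℝ → ℝ) (x v : ℝ) : ℝ :=
  f (V x + Real.exp (-(c / 2 * x)) * cutoff (Real.exp (c / 2 * x) * v)) - f (V x)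

variable {f V : ℝ → ℝ} {a b c : ℝ}

theorem exp_neg_mul_scaledReaction (f : ℝ → ℝ) (c : ℝ) (V : ℝ → ℝ) (x v : ℝ) :
    Real.exp (-(c / 2 * x)) * scaledReaction f c V x (cutoff (Real.exp (c / 2 * x) * v)) =
      cutoffReaction f c V x v := by
  rw [scaledReaction, cutoffReaction, ← mul_assoc, ← Real.exp_add, neg_add_cancel, Real.exp_zero,
    one_mul]

theorem cutoffReaction_of_abs_le {x v : ℝ} (h : Real.exp (c / 2 * x) * |v| ≤ 1) :
    cutoffReaction f c V x v = f (V x + v) - f (V x) := by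
  have h1 : |Real.exp (c / 2 * x) * v| ≤ 1 := by rwa [abs_mul, Real.abs_exp]
  rw [cutoffReaction, cutoff_of_mem (abs_le.1 h1), ← mul_assoc, ← Real.exp_add, neg_add_cancel,
    Real.exp_zero, one_mul]

/-- The reaction is jointly `C¹`, hence Lipschitz on the compact convex set `[a,b] × [-1,1]`, and
the cutoff is a `1`-Lipschitz map into `[-1,1]`. -/
theorem exists_scaledReaction_lipschitz (hf : ContDiff ℝ 1 f) (hV : ContDiff ℝ 1 V)
    (a b c : ℝ) : ∃ K ≥ 0, ∀ x ∈ Icc a b, ∀ y ∈ Icc a b, ∀ u v,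
      |scaledReaction f c V x (cutoff u) - scaledReaction f c V y (cutoff v)| ≤
        K * (|x - y| + |u - v|) := by
  have h1 : ContDiff ℝ 1 fun p : ℝ × ℝ => scaledReaction f c V p.1 p.2 := by
    unfold scaledReaction
    fun_prop
  obtain ⟨K, hK⟩ := h1.contDiffOn.exists_lipschitzOnWith one_ne_zero
    ((convex_Icc a b).prod (convex_Icc (-1 : ℝ) 1)) (isCompact_Icc.prod isCompact_Icc)
  refine ⟨K, K.2, fun x hx y hy u v => ?_⟩
  have h2 := hK.dist_le_mul (x, cutoff u) ⟨hx, cutoff_mem u⟩ (y, cutoff v) ⟨hy, cutoff_mem v⟩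
  rw [Real.dist_eq] at h2
  refine h2.trans (mul_le_mul_of_nonneg_left ?_ K.2)
  rw [Prod.dist_eq, Real.dist_eq, Real.dist_eq]
  have h3 := abs_cutoff_sub_le u v
  refine max_le ?_ ?_
  · linarith [abs_nonneg (u - v)]
  · linarith [abs_nonneg (x - y)]

theorem exists_cutoffReaction_lipschitz (hf : ContDiff ℝ 1 f) (hV : ContDiff ℝ 1 V)
    (a b c : ℝ) : ∃ K ≥ 0, ∀ x ∈ Icc a b, ∀ u v,
      |cutoffReaction f c V x u - cutoffReaction f c V x v| ≤ K * |u - v| := by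
  obtain ⟨K, hK0, hK⟩ := exists_scaledReaction_lipschitz hf hV a b c
  refine ⟨K, hK0, fun x hx u v => ?_⟩
  have h1 := hK x hx x hx (Real.exp (c / 2 * x) * u) (Real.exp (c / 2 * x) * v)
  rw [sub_self, abs_zero, zero_add, ← mul_sub, abs_mul, Real.abs_exp] at h1
  rw [← exp_neg_mul_scaledReaction, ← exp_neg_mul_scaledReaction, ← mul_sub, abs_mul, Real.abs_exp]
  calc _ ≤ Real.exp (-(c / 2 * x)) * (K * (Real.exp (c / 2 * x) * |u - v|)) := by gcongr
    _ = (Real.exp (-(c / 2 * x)) * Real.exp (c / 2 * x)) * (K * |u - v|) := by ring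
    _ = K * |u - v| := by rw [← Real.exp_add, neg_add_cancel, Real.exp_zero, one_mul]

/-- For `z = e^{cx/2} v` the operator `v_xx + c v_x` becomes `z_xx - (c²/4) z`; the zero-order term
is counted as reaction. -/
theorem exists_isDirichletReaction (hf : ContDiff ℝ 1 f) (hV : ContDiff ℝ 1 V) (a b c : ℝ) :
    ∃ K, IsDirichletReaction a b K
      fun x w => scaledReaction f c V x (cutoff w) - c ^ 2 / 4 * w := by
  obtain ⟨K, hK0, hK⟩ := exists_scaledReaction_lipschitz hf hV a b c
  have h0 : ∀ x, scaledReaction f c V x (cutoff 0) = 0 := fun x => by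
    rw [cutoff_of_mem (by norm_num), scaledReaction, mul_zero, add_zero, sub_self, mul_zero]
  have hc : 0 ≤ c ^ 2 / 4 := by positivity
  refine ⟨K + c ^ 2 / 4, by positivity, fun x hx y hy u v => ?_, ?_, ?_⟩
  · have h1 : |c ^ 2 / 4 * v - c ^ 2 / 4 * u| = c ^ 2 / 4 * |u - v| := by
      rw [← mul_sub, abs_mul, abs_of_nonneg hc, abs_sub_comm]
    calc _ = |(scaledReaction f c V x (cutoff u) - scaledReaction f c V y (cutoff v)) +
          (c ^ 2 / 4 * v - c ^ 2 / 4 * u)| := by ring_nf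
      _ ≤ K * (|x - y| + |u - v|) + c ^ 2 / 4 * |u - v| :=
          (abs_add_le _ _).trans (add_le_add (hK x hx y hy u v) h1.le)
      _ ≤ _ := by nlinarith [abs_nonneg (x - y)]
  · simp [h0]
  · simp [h0]

/-- The equation for the perturbation of `V`, with the reaction term cut off, has a classical
solution. -/
theorem exists_cutoff_solution (hf : ContDiff ℝ 1 f) (hV : ContDiff ℝ 1 V) (hab : a < b) (c : ℝ)
    {v₀ : ℝ → ℝ} (hv : ContinuousOn v₀ (Icc a b)) (hva : v₀ a = 0) (hvb : v₀ b = 0) :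
    ∃ v vx vxx : ℝ → ℝ → ℝ, Continuous (fun p : ℝ × ℝ => v p.1 p.2) ∧
      (∀ t ≥ 0, v a t = 0) ∧ (∀ t ≥ 0, v b t = 0) ∧ (∀ x ∈ Icc a b, v x 0 = v₀ x) ∧
      ContinuousOn (fun p : ℝ × ℝ => vx p.1 p.2) (univ ×ˢ Ioi 0) ∧
      ContinuousOn (fun p : ℝ × ℝ => vxx p.1 p.2) (univ ×ˢ Ioi 0) ∧
      ∀ x ∈ Icc a b, ∀ t > 0,
        HasDerivAt (fun s => v x s) (vxx x t + c * vx x t + cutoffReaction f c V x (v x t)) t ∧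
        HasDerivAt (fun y => v y t) (vx x t) x ∧ HasDerivAt (fun y => vx y t) (vxx x t) x := by
  obtain ⟨K, hG⟩ := exists_isDirichletReaction hf hV a b c
  have he : Continuous fun x : ℝ => Real.exp (c / 2 * x) := by fun_prop
  have he' : Continuous fun p : ℝ × ℝ => Real.exp (-(c / 2 * p.1)) := by fun_prop
  have hd : ∀ x, HasDerivAt (fun x => Real.exp (-(c / 2 * x)))
      (-(c / 2) * Real.exp (-(c / 2 * x))) x := fun x =>
    (((hasDerivAt_id x).const_mul (c / 2)).neg.exp).congr_deriv (by simp [mul_comm])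
  have hone : ∀ x, Real.exp (-(c / 2 * x)) * Real.exp (c / 2 * x) = 1 := fun x => by
    rw [← Real.exp_add, neg_add_cancel, Real.exp_zero]
  obtain ⟨w, wt, wx, wxx, hw, hwa, hwb, hw0, hwx, hwxx, hder⟩ := hG.exists_classical_solution hab
    (w₀ := fun x => Real.exp (c / 2 * x) * v₀ x) (he.continuousOn.mul hv) (by simp [hva])
    (by simp [hvb])
  refine ⟨fun x t => Real.exp (-(c / 2 * x)) * w x t,
    fun x t => Real.exp (-(c / 2 * x)) * (wx x t - c / 2 * w x t),
    fun x t => Real.exp (-(c / 2 * x)) * (wxx x t - c * wx x t + c ^ 2 / 4 * w x t),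
    he'.mul hw, fun t ht => by simp [hwa t ht], fun t ht => by simp [hwb t ht], fun x hx => ?_,
    he'.continuousOn.mul (hwx.sub (hw.continuousOn.const_mul _)),
    he'.continuousOn.mul ((hwxx.sub (hwx.const_mul _)).add (hw.continuousOn.const_mul _)),
    fun x hx t ht => ?_⟩
  · simp only [hw0 x hx, ← mul_assoc, hone, one_mul]
  obtain ⟨h1, h2, h3, h4⟩ := hder x hx t ht
  refine ⟨(h1.const_mul _).congr_deriv ?_, ((hd x).mul h2).congr_deriv (by ring),
    ((hd x).mul (h3.sub (h2.const_mul (c / 2)))).congr_deriv (by simp only [Pi.sub_apply]; ring)⟩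
  rw [h4, ← exp_neg_mul_scaledReaction, ← mul_assoc (Real.exp (c / 2 * x)),
    mul_comm (Real.exp (c / 2 * x)), hone, one_mul]
  ring

theorem exists_linearization_remainder_le (hf : ContDiff ℝ 1 f) {ω : ℝ} (hω : 0 < ω) :
    ∃ δ > 0, ∀ y ∈ Icc (0 : ℝ) 1, ∀ s, |s| ≤ δ → |f (y + s) - f y - deriv f y * s| ≤ ω * |s| := by
  have hd : Continuous (deriv f) := hf.continuous_deriv le_rfl
  obtain ⟨ρ, hρ, h⟩ := Metric.uniformContinuousOn_iff.1
    ((isCompact_Icc (a := (-1 : ℝ)) (b := 2)).uniformContinuousOn_of_continuous hd.continuousOn)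
    ω hω
  -- The bound `1` keeps `y + s` in `[-1,2]`, where `f'` is uniformly continuous; halving `ρ` gives
  -- the strict inequality required there.
  refine ⟨min (ρ / 2) 1, by positivity, fun y hy s hs => ?_⟩
  have hs1 := hs.trans (min_le_left _ _)
  have hs2 := hs.trans (min_le_right _ _)
  have hdiff : ∀ z, HasDerivAt (fun z => f z - deriv f y * z) (deriv f z - deriv f y) z :=
    fun z => ((hf.differentiable one_ne_zero z).hasDerivAt.sub
      ((hasDerivAt_id z).const_mul _)).congr_deriv (by simp)
  have h1 := (convex_Icc (y - |s|) (y + |s|)).norm_image_sub_le_of_norm_hasDerivWithin_le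
    (x := y) (y := y + s) (C := ω) (fun z _ => (hdiff z).hasDerivWithinAt) (fun z hz => ?_)
    ⟨by linarith [abs_nonneg s], by linarith [abs_nonneg s]⟩
    ⟨by linarith [neg_abs_le s], by linarith [le_abs_self s]⟩
  · rw [Real.norm_eq_abs, Real.norm_eq_abs, add_sub_cancel_left] at h1
    refine le_trans (le_of_eq ?_) h1
    congr 1
    ring
  · have h2 := h z ⟨by linarith [hz.1, hy.1], by linarith [hz.2, hy.2]⟩ y
      ⟨by linarith [hy.1], by linarith [hy.2]⟩
      (by rw [Real.dist_eq, abs_lt]; constructor <;> linarith [hz.1, hz.2])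
    rw [Real.dist_eq] at h2
    exact h2.le

variable {ψ ψ₁ ψ₂ : ℝ → ℝ} {ω m M ε K : ℝ}

/-- Perturbations that start below a small multiple of the barrier decay. -/
theorem IsBarrier.le_of_initial_le (hB : IsBarrier f c a b V ψ ψ₁ ψ₂ ω m M) (hε : 0 ≤ ε)
    {H : ℝ → ℝ → ℝ} (hH : ∀ x ∈ Icc a b, ∀ u v, |H x u - H x v| ≤ K * |u - v|)
    (hlin : ∀ x ∈ Icc a b, ∀ s ≥ 0, s ≤ ε * M → H x s ≤ (deriv f (V x) + ω) * s)
    {v vx vxx : ℝ → ℝ → ℝ} (hv : Continuous fun p : ℝ × ℝ => v p.1 p.2)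
    (hva : ∀ t ≥ 0, v a t = 0) (hvb : ∀ t ≥ 0, v b t = 0) (hab : a < b)
    (hv0 : ∀ x ∈ Icc a b, v x 0 ≤ ε * ψ x)
    (hder : ∀ x ∈ Icc a b, ∀ t > 0,
        HasDerivAt (fun s => v x s) (vxx x t + c * vx x t + H x (v x t)) t ∧
        HasDerivAt (fun y => v y t) (vx x t) x ∧ HasDerivAt (fun y => vx y t) (vxx x t) x)
    {x : ℝ} (hx : x ∈ Icc a b) {t : ℝ} (ht : 0 ≤ t) :
    v x t ≤ ε * ψ x * Real.exp (-ω * t) := by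
  have hE : ∀ t : ℝ, HasDerivAt (fun t => Real.exp (-ω * t)) (-ω * Real.exp (-ω * t)) t :=
    fun t => (((hasDerivAt_id t).const_mul (-ω)).exp).congr_deriv (by simp [mul_comm])
  have hs : ∀ x ∈ Icc a b, ∀ t, 0 ≤ ε * ψ x * Real.exp (-ω * t) := fun x hx t =>
    mul_nonneg (mul_nonneg hε (hB.pos hx).le) (Real.exp_pos _).le
  -- `εψe^{-ωt}` is a supersolution: `ψ` provides the rate `2ω`, the nonlinear remainder costs `ω`,
  -- and the time derivative uses the other `ω`.
  refine sub_nonpos.1 (parabolic_comparison (T := t) (c := c) (K := K)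
    (d := fun x t => v x t - ε * ψ x * Real.exp (-ω * t))
    (dt := fun x t => vxx x t + c * vx x t + H x (v x t) -
      ε * ψ x * (-ω * Real.exp (-ω * t)))
    (dx := fun x t => vx x t - ε * ψ₁ x * Real.exp (-ω * t))
    (dxx := fun x t => vxx x t - ε * ψ₂ x * Real.exp (-ω * t))
    ?_ (fun y hy => ?_) (fun s hs' => ?_) (fun s hs' => ?_) (fun y hy s hs' => ⟨?_, ?_, ?_⟩)
    (fun y hy s hs' hpos => ?_) x hx t ⟨ht, le_rfl⟩)
  · refine hv.continuousOn.sub (((continuousOn_const).mul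
      (hB.continuousOn.comp continuousOn_fst fun p hp => hp.1)).mul ?_)
    exact (by fun_prop : Continuous fun p : ℝ × ℝ => Real.exp (-ω * p.2)).continuousOn
  · simpa using hv0 y hy
  · rw [hva s hs'.1.le, zero_sub]
    exact neg_nonpos.2 (hs a (left_mem_Icc.2 hab.le) s)
  · rw [hvb s hs'.1.le, zero_sub]
    exact neg_nonpos.2 (hs b (right_mem_Icc.2 hab.le) s)
  · exact (hder y (Ioo_subset_Icc_self hy) s hs'.1).1.sub ((hE s).const_mul _)
  · exact (hder y (Ioo_subset_Icc_self hy) s hs'.1).2.1.sub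
      (((hB.hasDerivAt_fst y (Ioo_subset_Icc_self hy)).const_mul ε).mul_const _)
  · exact (hder y (Ioo_subset_Icc_self hy) s hs'.1).2.2.sub
      (((hB.hasDerivAt_snd y (Ioo_subset_Icc_self hy)).const_mul ε).mul_const _)
  · have hy' := Ioo_subset_Icc_self hy
    have hexp : Real.exp (-ω * s) ≤ 1 := Real.exp_le_one_iff.2
      (by nlinarith [hB.rate_pos, hs'.1])
    have hle : ε * ψ y * Real.exp (-ω * s) ≤ ε * M :=
      (mul_le_of_le_one_right (mul_nonneg hε (hB.pos hy').le) hexp).trans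
        (mul_le_mul_of_nonneg_left (hB.upper y hy') hε)
    have h1 := hlin y hy' _ (hs y hy' s) hle
    have h2 := (le_abs_self _).trans (hH y hy' (v y s) (ε * ψ y * Real.exp (-ω * s)))
    rw [abs_of_pos hpos] at h2
    have h3 := mul_le_mul_of_nonneg_left (hB.supersolution y hy')
      (mul_nonneg hε (Real.exp_pos (-ω * s)).le)
    nlinarith

/-- The one-sided estimate is applied to `v`, and to `-v` with the reaction `-H(x, -s)`. -/
theorem IsBarrier.abs_le_of_initial_le (hB : IsBarrier f c a b V ψ ψ₁ ψ₂ ω m M) (hε : 0 ≤ ε)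
    {H : ℝ → ℝ → ℝ} (hH : ∀ x ∈ Icc a b, ∀ u v, |H x u - H x v| ≤ K * |u - v|)
    (hlin : ∀ x ∈ Icc a b, ∀ s, |s| ≤ ε * M → |H x s - deriv f (V x) * s| ≤ ω * |s|)
    {v vx vxx : ℝ → ℝ → ℝ} (hv : Continuous fun p : ℝ × ℝ => v p.1 p.2)
    (hva : ∀ t ≥ 0, v a t = 0) (hvb : ∀ t ≥ 0, v b t = 0) (hab : a < b)
    (hv0 : ∀ x ∈ Icc a b, |v x 0| ≤ ε * ψ x)
    (hder : ∀ x ∈ Icc a b, ∀ t > 0,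
        HasDerivAt (fun s => v x s) (vxx x t + c * vx x t + H x (v x t)) t ∧
        HasDerivAt (fun y => v y t) (vx x t) x ∧ HasDerivAt (fun y => vx y t) (vxx x t) x)
    {x : ℝ} (hx : x ∈ Icc a b) {t : ℝ} (ht : 0 ≤ t) :
    |v x t| ≤ ε * ψ x * Real.exp (-ω * t) := by
  refine abs_le'.2 ⟨?_, ?_⟩
  · refine hB.le_of_initial_le hε hH (fun y hy s hs hsM => ?_) hv hva hvb hab
      (fun y hy => (le_abs_self _).trans (hv0 y hy)) hder hx ht
    have h1 := (le_abs_self _).trans (hlin y hy s (by rwa [abs_of_nonneg hs]))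
    rw [abs_of_nonneg hs] at h1
    linarith
  · refine hB.le_of_initial_le (K := K) (H := fun x s => -H x (-s)) (v := fun x t => -v x t)
      (vx := fun x t => -vx x t) (vxx := fun x t => -vxx x t) hε (fun y hy u w => ?_)
      (fun y hy s hs hsM => ?_) hv.neg (fun t ht => by simp [hva t ht])
      (fun t ht => by simp [hvb t ht]) hab (fun y hy => (neg_le_abs _).trans (hv0 y hy))
      (fun y hy s hs => ?_) hx ht
    · have h1 := hH y hy (-w) (-u)
      rwa [neg_sub_neg, ← neg_sub_neg (H y (-u))] at h1
    · have h1 := (neg_le_abs _).trans (hlin y hy (-s) (by rwa [abs_neg, abs_of_nonneg hs]))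
      rw [abs_neg, abs_of_nonneg hs] at h1
      linarith
    · obtain ⟨h1, h2, h3⟩ := hder y hy s hs
      refine ⟨h1.neg.congr_deriv ?_, h2.neg, h3.neg⟩
      rw [neg_neg]
      ring

theorem abs_sub_le_supDist {g h : ℝ → ℝ} (hg : ContinuousOn g (Icc a b))
    (hh : ContinuousOn h (Icc a b)) {x : ℝ} (hx : x ∈ Icc a b) :
    |g x - h x| ≤ supDist a b g h := by
  have h1 : BddAbove (range fun x : Icc a b => |g x - h x|) := by
    obtain ⟨C, hC⟩ := isCompact_Icc.exists_bound_of_continuousOn (hg.sub hh)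
    refine ⟨C, ?_⟩
    rintro _ ⟨y, rfl⟩
    exact hC y y.2
  exact le_ciSup h1 ⟨x, hx⟩

theorem supDist_le {g h : ℝ → ℝ} {C : ℝ} (hab : a ≤ b) (H : ∀ x ∈ Icc a b, |g x - h x| ≤ C) :
    supDist a b g h ≤ C :=
  haveI : Nonempty (Icc a b) := ⟨⟨a, left_mem_Icc.2 hab⟩⟩
  ciSup_le fun x => H x x.2

theorem supDist_congr {g h h' : ℝ → ℝ} (H : EqOn h h' (Icc a b)) :
    supDist a b g h = supDist a b g h' :=
  iSup_congr fun x => by rw [H x.2]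

theorem isExponentiallyStable_congr {Φ : ℝ → ℝ} (H : EqOn Φ V (Icc a b))
    (h : IsExponentiallyStable f c a b V) : IsExponentiallyStable f c a b Φ := by
  simpa only [IsExponentiallyStable, supDist_congr H] using h

/-- The cut off equation is always solvable globally. For small data the barrier keeps its solution
below the cutoff level, so `V + v` solves the original problem for all times; comparison gives
uniqueness. -/
theorem IsConnection.isExponentiallyStable {P : ℝ → ℝ} (hf : ContDiff ℝ 1 f) (hab : a < b)
    (hV : IsConnection c a b (truncation f) V P) (hB : IsBarrier f c a b V ψ ψ₁ ψ₂ ω m M) :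
    IsExponentiallyStable f c a b V := by
  have hVc : ContDiff ℝ 1 V := contDiff_one_iff_deriv.2
    ⟨fun x => (hV.hasDerivAt_fst x).differentiableAt, by
      rw [funext fun x => (hV.hasDerivAt_fst x).deriv]
      exact hV.continuous_snd⟩
  have hm := hB.lower_pos
  have hM : 0 < M := (hB.pos (left_mem_Icc.2 hab.le)).trans_le (hB.upper a (left_mem_Icc.2 hab.le))
  obtain ⟨K, hK0, hK⟩ := exists_cutoffReaction_lipschitz hf hVc a b c
  obtain ⟨δ, hδ, hrem⟩ := exists_linearization_remainder_le hf hB.rate_pos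
  obtain ⟨E, hE⟩ := (isCompact_Icc (a := a) (b := b)).exists_bound_of_continuousOn
    (by fun_prop : Continuous fun x : ℝ => Real.exp (c / 2 * x)).continuousOn
  have hE' : ∀ x ∈ Icc a b, Real.exp (c / 2 * x) ≤ E := fun x hx => by
    simpa using hE x hx
  have hE0 : 0 < E := (Real.exp_pos _).trans_le (hE' a (left_mem_Icc.2 hab.le))
  -- Below `δ` the remainder estimate holds; below `E⁻¹` the cutoff is inactive.
  set η := min δ E⁻¹ with hη
  have hη0 : 0 < η := by positivity
  have hcut : ∀ x ∈ Icc a b, ∀ s, |s| ≤ η → cutoffReaction f c V x s = f (V x + s) - f (V x) := by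
    intro x hx s hs
    refine cutoffReaction_of_abs_le ?_
    calc _ ≤ E * E⁻¹ := mul_le_mul (hE' x hx) (hs.trans (min_le_right _ _)) (abs_nonneg _) hE0.le
      _ = 1 := mul_inv_cancel₀ hE0.ne'
  -- With `ε = ‖u₀ - V‖ / m` the data lie below `εm ≤ εψ`, and the solution stays below `εM
  -- e^{-ωt}`. This gives `K = M / m`, and `εM ≤ η` is the smallness condition.
  refine ⟨M / m, by positivity, ω, hB.rate_pos, η * m / M, by positivity,
    fun u₀ hu₀ hu₀a hu₀b hdist => ?_⟩
  have hVcont : ContinuousOn V (Icc a b) := hV.continuous_fst.continuousOn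
  have hpt : ∀ x ∈ Icc a b, |u₀ x - V x| ≤ supDist a b u₀ V := fun x hx =>
    abs_sub_le_supDist hu₀ hVcont hx
  have hd0 : 0 ≤ supDist a b u₀ V := (abs_nonneg _).trans (hpt a (left_mem_Icc.2 hab.le))
  set ε := supDist a b u₀ V / m with hε
  have hε0 : 0 ≤ ε := by positivity
  have hεM : ε * M ≤ η := by
    rw [le_div_iff₀ hM] at hdist
    rw [hε, div_mul_eq_mul_div, div_le_iff₀ hm]
    exact hdist
  obtain ⟨v, vx, vxx, hv, hva, hvb, hv0, hvx, hvxx, hder⟩ := exists_cutoff_solution hf hVc hab c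
    (hu₀.sub hVcont) (by simp [hu₀a, hV.left]) (by simp [hu₀b, hV.right])
  have hdecay : ∀ x ∈ Icc a b, ∀ t ≥ 0, |v x t| ≤ ε * ψ x * Real.exp (-ω * t) := by
    intro x hx t ht
    refine hB.abs_le_of_initial_le hε0 hK (fun y hy s hs => ?_) hv hva hvb hab (fun y hy => ?_)
      hder hx ht
    · rw [hcut y hy s (hs.trans hεM)]
      exact hrem _ (hV.mem_Icc y hy) s ((hs.trans hεM).trans (min_le_left _ _))
    · rw [hv0 y hy]
      calc _ ≤ ε * m := by
            rw [hε, div_mul_cancel₀ _ hm.ne']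
            exact hpt y hy
        _ ≤ _ := mul_le_mul_of_nonneg_left (hB.lower y hy) hε0
  have hdecay' : ∀ x ∈ Icc a b, ∀ t ≥ 0, |v x t| ≤ ε * M * Real.exp (-ω * t) := fun x hx t ht =>
    (hdecay x hx t ht).trans (mul_le_mul_of_nonneg_right
      (mul_le_mul_of_nonneg_left (hB.upper x hx) hε0) (Real.exp_pos _).le)
  have hsmall : ∀ x ∈ Icc a b, ∀ t ≥ 0, |v x t| ≤ η := fun x hx t ht => by
    refine ((hdecay' x hx t ht).trans (mul_le_of_le_one_right (by positivity) ?_)).trans hεM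
    exact Real.exp_le_one_iff.2 (by nlinarith [hB.rate_pos])
  have hsub : Ioo a b ×ˢ Ioi (0 : ℝ) ⊆ univ ×ˢ Ioi 0 := prod_mono (subset_univ _) subset_rfl
  obtain ⟨L, hL⟩ := exists_lipschitzWith_truncation hf
  have hV2 : Continuous fun p : ℝ × ℝ => V p.1 := hV.continuous_fst.comp continuous_fst
  have hP2 : Continuous fun p : ℝ × ℝ => P p.1 := hV.continuous_snd.comp continuous_fst
  have hT2 : Continuous fun p : ℝ × ℝ => truncation f (V p.1) := hL.continuous.comp hV2
  have hux : ContinuousOn (fun p : ℝ × ℝ => P p.1 + vx p.1 p.2) (Ioo a b ×ˢ Ioi 0) :=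
    hP2.continuousOn.add (hvx.mono hsub)
  have huxx : ContinuousOn (fun p : ℝ × ℝ => -c * P p.1 - truncation f (V p.1) + vxx p.1 p.2)
      (Ioo a b ×ˢ Ioi 0) :=
    ((hP2.const_mul _).sub hT2).continuousOn.add (hvxx.mono hsub)
  have hsol : IsClassicalSolution f c a b u₀ fun x t => V x + v x t := by
    refine ⟨(hV2.add hv).continuousOn,
      ⟨fun x t => -c * P x - truncation f (V x) + vxx x t + c * (P x + vx x t) + f (V x + v x t),
      fun x t => P x + vx x t, fun x t => -c * P x - truncation f (V x) + vxx x t,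
      (huxx.add (hux.const_mul c)).add (hf.continuous.comp (hV2.add hv)).continuousOn, hux, huxx,
      fun x hx t ht => ?_⟩, fun t ht => by simp [hV.left, hva t (le_of_lt ht)],
      fun t ht => by simp [hV.right, hvb t (le_of_lt ht)], fun x hx => by simp [hv0 x hx]⟩
    have hx' := Ioo_subset_Icc_self hx
    obtain ⟨h1, h2, h3⟩ := hder x hx' t ht
    refine ⟨(h1.const_add _).congr_deriv ?_, (hV.hasDerivAt_fst x).add h2,
      ((hV.hasDerivAt_snd x).add h3).congr_deriv (by ring), rfl⟩
    simp only [hcut x hx' _ (hsmall x hx' t (le_of_lt ht)), truncation_of_mem (hV.mem_Icc x hx')]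
    ring
  refine ⟨_, hsol, fun w hw => hsol.unique hf hw, fun t ht => supDist_le hab.le fun x hx => ?_⟩
  rw [add_sub_cancel_left]
  refine (hdecay' x hx t ht).trans (le_of_eq ?_)
  rw [hε]
  ring

theorem IsConnection.contDiff_two {P : ℝ → ℝ} (hf : ContDiff ℝ 1 f)
    (hV : IsConnection c a b (truncation f) V P) : ContDiff ℝ 2 V := by
  obtain ⟨L, hL⟩ := exists_lipschitzWith_truncation hf
  exact contDiff_two_of_hasDerivAt hV.hasDerivAt_fst hV.hasDerivAt_snd
    ((hV.continuous_snd.const_mul _).sub (hL.continuous.comp hV.continuous_fst))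

end Stability

end

end TravellingWave

theorem proposition4p4 (f : ℝ → ℝ) (hf : TravellingWave.IsBistable f) (a b : ℝ) (hab : a < b)
    (c : ℝ) :
    (∃ Φ : ℝ → ℝ, TravellingWave.IsEquilibrium f c a b Φ ∧
      ∀ Ψ : ℝ → ℝ, TravellingWave.IsEquilibrium f c a b Ψ → ∀ x ∈ Set.Icc a b, Ψ x = Φ x) ∧
    ∀ Φ : ℝ → ℝ, TravellingWave.IsEquilibrium f c a b Φ →
      ContDiffOn ℝ 2 Φ (Set.Icc a b) ∧
      StrictMonoOn Φ (Set.Icc a b) ∧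
      (∀ x ∈ Set.Icc a b, 0 < derivWithin Φ (Set.Icc a b) x) ∧
      TravellingWave.spectrumLin f c a b Φ ⊆ {z : ℂ | z.re < 0} ∧
      TravellingWave.IsExponentiallyStable f c a b Φ := by
  have hfc := hf.contDiff
  have h0 := hf.truncation_of_nonpos 0 le_rfl
  have h1 := hf.truncation_of_one_le 1 le_rfl
  obtain ⟨K, hK⟩ := TravellingWave.exists_lipschitzWith_truncation hfc
  refine ⟨?_, fun Φ hΦ => ?_⟩
  · obtain ⟨V, P, hV⟩ := hf.exists_connection c hab
    refine ⟨V, hV.isEquilibrium, fun Ψ hΨ x hx => ?_⟩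
    obtain ⟨W, Q, hW, hΨW⟩ := hΨ.exists_connection hfc hab
    rw [hΨW hx]
    exact TravellingWave.IsConnection.eqOn hK h0 h1 hW hV hx
  -- All the assertions depend only on the values on `[a,b]`, so they are proved for the smooth
  -- extension `V` and transferred to `Φ`.
  · obtain ⟨V, P, hV, hΦV⟩ := hΦ.exists_connection hfc hab
    obtain ⟨ψ, ψ₁, ψ₂, ω, m, M, hB⟩ := hV.exists_barrier hf hab
    refine ⟨(hV.contDiff_two hfc).contDiffOn.congr hΦV, (hV.strictMonoOn hK h0 h1).congr hΦV.symm,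
      fun x hx => ?_, ?_,
      TravellingWave.isExponentiallyStable_congr hΦV (hV.isExponentiallyStable hfc hab hB)⟩
    · rw [derivWithin_congr hΦV (hΦV hx),
        (hV.hasDerivAt_fst x).hasDerivWithinAt.derivWithin (uniqueDiffOn_Icc hab x hx)]
      exact hV.deriv_pos hK h0 h1 hab hx
    · rw [TravellingWave.spectrumLin_congr hΦV]
      exact hB.spectrumLin_subset hab hfc hV.continuous_fst.continuousOn
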